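/- Conventions. For $a\in\mathscr S'(\mathbf R^{2d})$ and $t\in\mathbf R$ let $a_t(x,D):\mathscr S(\mathbf R^d)\to\mathscr S'(\mathbf R^d)$ be the operator with distribution kernel $K_{a,t}(x,y)=(\mathscr F_2^{-1}a)((1-t)x+ty,\,x-y)$, where $(\mathscr F_2^{-1}a)(u,v)=(2\pi)^{-d/2}\int a(u,\xi)e^{i\langle v,\xi\rangle}\,d\xi$, and let $Aa$ be the operator with kernel $(Aa)(x,y)=(2\pi)^{-d/2}\int a((y-x)/2,\xi)e^{-i\langle x+y,\xi\rangle}\,d\xi$ (both understood in the distribution sense). A \emph{tempered Hilbert space} on $\mathbf R^d$ is a complex Hilbert space $\mathscr H\subseteq\mathscr S'(\mathbf R^d)$, continuously embedded, in which $\mathscr S(\mathbf R^d)$ is contained and dense. Its $L^2$-dual $\mathscr H'$ consists of all $\varphi\in\mathscr S'(\mathbf R^d)$ such that $\|\varphi\|_{\mathscr H'}=\sup|(\varphi,f)_{L^2}|<\infty$, where the supremum is over $f\in\mathscr S(\mathbf R^d)$ with $\|f\|_{\mathscr H}\le1$, and $(\varphi,f)_{L^2}=\langle\varphi,\overline f\rangle$;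 this is a Hilbert norm. For $p\in[1,\infty]$ the Schatten--von Neumann class $\mathscr I_p(\mathscr H_1,\mathscr H_2)$ consists of the bounded linear $T:\mathscr H_1\to\mathscr H_2$ such that $\|T\|_{\mathscr I_p}=\sup\big(\sum_j|(Tf_j,g_j)_{\mathscr H_2}|^p\big)^{1/p}<\infty$ (with a supremum over $j$ if $p=\infty$), the outer supremum being over all finite or infinite orthonormal sequences $(f_j)$ in $\mathscr H_1$ and $(g_j)$ in $\mathscr H_2$. Let $s_{t,p}(\mathscr H_1,\mathscr H_2)$ and $s_p^A(\mathscr H_1,\mathscr H_2)$ be the sets of all $a\in\mathscr S'(\mathbf R^{2d})$ such that $a_t(x,D)$, respectively $Aa$, extends from $\mathscr S(\mathbf R^d)$ to an element of $\mathscr I_p(\mathscr H_1,\mathscr H_2)$, normed by the $\mathscr I_p$ norm of that extension. Theorem. Let $t\in\mathbf R$, $p\in[1,\infty)$, $1/p+1/p'=1$, and let $\mathscr H_1,\mathscr H_2$ be tempered Hilbert spaces on $\mathbf R^d$. Put $Y=s_{t,p}(\mathscr H_1,\mathscr H_2)$ and $X=s_{t,p'}(\mathscr H_1',\mathscr H_2')$.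 Then $\mathscr S(\mathbf R^{2d})\subseteq X\cap Y$, and the form $(\varphi,\psi)_{L^2}=\int\varphi\overline\psi$ on $\mathscr S(\mathbf R^{2d})$ extends to a continuous sesquilinear form $(a,b)_{L^2}$ on $X\times Y$ such that: (i) it is the only continuous sesquilinear extension with $|(a,b)_{L^2}|\le\|a\|_X\|b\|_Y$ for all $a\in X$, $b\in Y$, and, if $p>1$, the only continuous sesquilinear extension at all; (ii) if $b\in Y$ and $(a,b)_{L^2}=0$ for all $a\in X$, then $b=0$; (iii) for every $\ell\in Y^*$ there is exactly one $a\in X$ such that $\overline{\ell(b)}=(a,b)_{L^2}$ for all $b\in Y$; (iv) if $\ell\in Y^*$ and $a\in X$ satisfy $\overline{\ell(b)}=(a,b)_{L^2}$ for all $b\in Y$, then $\|\ell\|=\|a\|_X$. The same holds with $Y=s_p^A(\mathscr H_1,\mathscr H_2)$ and $X=s_{p'}^A(\mathscr H_1',\mathscr H_2')$. If instead $a_t(x,D)$ is normalized by $a_t(x,D)f(x)=(2\pi)^{-d}\iint a((1-t)x+ty,\xi)f(y)e^{i\langle x-y,\xi\rangle}\,dy\,d\xi$, that is, if the kernel $K_{a,t}$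 above is multiplied by $(2\pi)^{-d/2}$, then the statement for $s_{t,p}$ holds with the bound in (i) replaced by $(2\pi)^d\|a\|_X\|b\|_Y$ and the equality in (iv) replaced by $\|\ell\|=(2\pi)^d\|a\|_X$. -/

import Mathlib

open MeasureTheory SchwartzMap
open scoped SchwartzMap ContDiff ComplexConjugate ENNReal

set_option linter.unusedSectionVars false

noncomputable section
namespace PartialFourier

variable {E : Type} [NormedAddCommGroup E] [InnerProductSpace ℝ E] [FiniteDimensional ℝ E]
  [MeasurableSpace E] [BorelSpace E]
  {G : Type} [NormedAddCommGroup G] [NormedSpace ℝ G] [NormedSpace ℂ G] [IsScalarTower ℝ ℂ G]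
  [SMulCommClass ℝ ℂ G]

theorem slice_bound (k : ℕ) : ∃ (s : Finset (ℕ × ℕ)) (C : ℝ), 0 ≤ C ∧
    ∀ F : 𝓢(E × E, G), ∀ u v : E, ‖u‖ ^ k * ‖F (u, v)‖ ≤
      C * s.sup (schwartzSeminormFamily ℂ (E × E) G) F *
        (1 + ‖v‖) ^ (-((Module.finrank ℝ E + 1 : ℕ) : ℝ)) := by
  obtain ⟨r, hr⟩ : ∃ r, r = Module.finrank ℝ E + 1 := ⟨_, rfl⟩
  rw [← hr]
  refine ⟨Finset.Iic (k + r, 0), 2 ^ (k + r), by positivity, fun F u v => ?_⟩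
  have h := one_add_le_sup_seminorm_apply (𝕜 := ℂ) (m := (k + r, 0)) (k := k + r) (n := 0)
    le_rfl le_rfl F (u, v)
  rw [norm_iteratedFDeriv_zero] at h
  have hu : ‖u‖ ≤ ‖((u, v) : E × E)‖ := le_max_left _ _
  have hv : ‖v‖ ≤ ‖((u, v) : E × E)‖ := le_max_right _ _
  rw [Real.rpow_neg (by positivity), Real.rpow_natCast, ← div_eq_mul_inv, le_div_iff₀ (by positivity)]
  refine le_trans ?_ h
  calc ‖u‖ ^ k * ‖F (u, v)‖ * (1 + ‖v‖) ^ r = (‖u‖ ^ k * (1 + ‖v‖) ^ r) * ‖F (u, v)‖ := by ring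
    _ ≤ _ := by
      rw [pow_add]
      gcongr
      linarith

theorem integrable_weight :
    Integrable (fun v : E => (1 + ‖v‖) ^ (-((Module.finrank ℝ E + 1 : ℕ) : ℝ))) :=
  integrable_one_add_norm (by push_cast; linarith)

theorem integrable_slice (F : 𝓢(E × E, G)) (u : E) : Integrable (fun v : E => F (u, v)) := by
  obtain ⟨s, C, hC, h⟩ := slice_bound (E := E) (G := G) 0
  refine (integrable_weight.const_mul (C * s.sup (schwartzSeminormFamily ℂ (E × E) G) F)).mono'
    (F.continuous.comp (by fun_prop)).aestronglyMeasurable (.of_forall fun v => ?_)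
  simpa using h F u v

/-- The character `e^{i⟨v, ξ⟩}`. -/
def expI (v ξ : E) : ℂ := Complex.exp (Complex.I * (inner ℝ v ξ : ℝ))

theorem norm_expI (v ξ : E) : ‖expI v ξ‖ = 1 := by
  rw [expI, mul_comm, Complex.norm_exp_ofReal_mul_I]

theorem continuous_expI (ξ : E) : Continuous fun v : E => expI v ξ := by
  unfold expI; fun_prop

/-- The unnormalized partial Fourier integral `∫ e^{i⟨v, ξ⟩} F(u, v) dv` at the point `(u, ξ)`. -/
def integ (F : 𝓢(E × E, G)) (x : E × E) : G := ∫ v : E, expI v x.2 • F (x.1, v)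

theorem integrable_integrand (F : 𝓢(E × E, G)) (x : E × E) :
    Integrable (fun v : E => expI v x.2 • F (x.1, v)) := by
  refine (integrable_slice F x.1).norm.mono'
    ((continuous_expI x.2).smul (F.continuous.comp (by fun_prop))).aestronglyMeasurable
    (.of_forall fun v => ?_)
  rw [norm_smul, norm_expI, one_mul]

theorem integ_add (F F' : 𝓢(E × E, G)) (x : E × E) :
    integ (F + F') x = integ F x + integ F' x := by
  simp only [integ, add_apply, smul_add]
  exact integral_add (integrable_integrand F x) (integrable_integrand F' x)

theorem integ_smul (c : ℂ) (F : 𝓢(E × E, G)) (x : E × E) :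
    integ (c • F) x = c • integ F x := by
  simp only [integ, smul_apply, smul_comm _ c]
  exact integral_smul c _

/-- Precomposition of a linear map with `(h, k) ↦ (h, 0)`. -/
def compFst : (E × E →L[ℝ] G) →L[ℂ] (E × E →L[ℝ] G) :=
  LinearMap.mkContinuous
    { toFun := fun f : E × E →L[ℝ] G => f.comp ((ContinuousLinearMap.inl ℝ E E).comp (ContinuousLinearMap.fst ℝ E E))
      map_add' := fun _ _ => rfl
      map_smul' := fun _ _ => rfl }
    ‖(ContinuousLinearMap.inl ℝ E E).comp (ContinuousLinearMap.fst ℝ E E)‖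
    (fun _ => (ContinuousLinearMap.opNorm_comp_le _ _).trans (mul_comm _ _).le)

theorem compFst_apply (f : E × E →L[ℝ] G) (h : E × E) : compFst f h = f (h.1, 0) := rfl

/-- The bilinear form `((u, v), (h, k)) ↦ ⟨v, k⟩`. -/
def sndForm : E × E →L[ℝ] E × E →L[ℝ] ℝ :=
  ((innerSL ℝ : E →L[ℝ] E →L[ℝ] ℝ).bilinearComp (ContinuousLinearMap.snd ℝ E E)
    (ContinuousLinearMap.snd ℝ E E))

/-- The map on Schwartz functions with `(integ F)' = integ (dMap F)`. -/
def dMap : 𝓢(E × E, G) →L[ℂ] 𝓢(E × E, E × E →L[ℝ] G) :=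
  (postcompCLM compFst).comp (fderivCLM ℂ (E × E) G) +
    Complex.I • smulRightCLM ℂ G sndForm

theorem dMap_apply (F : 𝓢(E × E, G)) (x : E × E) (h : E × E) :
    dMap F x h = fderiv ℝ F x (h.1, 0) + (inner ℝ x.2 h.2 : ℝ) • Complex.I • F x := by
  simp [dMap, compFst_apply, sndForm, ContinuousLinearMap.bilinearComp_apply, smul_comm Complex.I]

theorem hasFDerivAt_integrand (F : 𝓢(E × E, G)) (v : E) (x : E × E) :
    HasFDerivAt (fun x : E × E => expI v x.2 • F (x.1, v)) (expI v x.2 • dMap F (x.1, v)) x := by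
  have h1 : HasFDerivAt (fun x : E × E => F (x.1, v))
      ((fderiv ℝ F (x.1, v)).comp ((ContinuousLinearMap.inl ℝ E E).comp
        (ContinuousLinearMap.fst ℝ E E))) x := by
    refine (F.hasFDerivAt (x.1, v)).comp x (f := fun x : E × E => (x.1, v)) ?_
    exact (hasFDerivAt_fst (p := x)).prodMk (hasFDerivAt_const v x) |>.congr_fderiv (by ext <;> simp)
  have h2 : HasFDerivAt (fun x : E × E => expI v x.2)
      ((expI v x.2 * Complex.I) • (Complex.ofRealCLM.comp ((innerSL ℝ v).comp
        (ContinuousLinearMap.snd ℝ E E)))) x := by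
    have h3 : HasFDerivAt (fun x : E × E => Complex.I * ((inner ℝ v x.2 : ℝ) : ℂ))
        (Complex.I • (Complex.ofRealCLM.comp ((innerSL ℝ v).comp
        (ContinuousLinearMap.snd ℝ E E)))) x :=
      ((Complex.ofRealCLM.comp ((innerSL ℝ v).comp
        (ContinuousLinearMap.snd ℝ E E))).hasFDerivAt (x := x)).const_mul Complex.I
    have := h3.cexp
    rw [smul_smul] at this
    exact this
  refine (h2.smul h1).congr_fderiv ?_
  ext h
  · simp [dMap_apply]
  · simp [dMap_apply, ← smul_assoc]
    congr 1
    ring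

theorem hasFDerivAt_integ (F : 𝓢(E × E, G)) (x : E × E) :
    HasFDerivAt (integ F) (integ (dMap F) x) x := by
  obtain ⟨s, C, hC, h⟩ := slice_bound (E := E) (G := E × E →L[ℝ] G) 0
  refine hasFDerivAt_integral_of_dominated_of_fderiv_le (𝕜 := ℝ) (s := Set.univ)
    (F := fun (x : E × E) v => expI v x.2 • F (x.1, v))
    (F' := fun (x : E × E) v => expI v x.2 • dMap F (x.1, v))
    (bound := fun v => C * s.sup (schwartzSeminormFamily ℂ (E × E) (E × E →L[ℝ] G)) (dMap F) *
      (1 + ‖v‖) ^ (-((Module.finrank ℝ E + 1 : ℕ) : ℝ)))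
    Filter.univ_mem (.of_forall fun x => (integrable_integrand F x).aestronglyMeasurable)
    (integrable_integrand F x) (integrable_integrand (dMap F) x).aestronglyMeasurable
    (.of_forall fun v x _ => ?_) (integrable_weight.const_mul _)
    (.of_forall fun v x _ => hasFDerivAt_integrand F v x)
  rw [norm_smul, norm_expI, one_mul]
  simpa using h (dMap F) x.1 v

theorem contDiff_integ (n : ℕ) : ∀ {G : Type} [NormedAddCommGroup G] [NormedSpace ℝ G]
    [NormedSpace ℂ G] [IsScalarTower ℝ ℂ G] [SMulCommClass ℝ ℂ G] (F : 𝓢(E × E, G)),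
    ContDiff ℝ n (integ F) := by
  induction n with
  | zero =>
    intro G _ _ _ _ _ F
    exact contDiff_zero.2 (continuous_iff_continuousAt.2
      fun x => (hasFDerivAt_integ F x).continuousAt)
  | succ n ih =>
    intro G _ _ _ _ _ F
    exact contDiff_succ_iff_hasFDerivAt.2 ⟨integ (dMap F), ih (dMap F), hasFDerivAt_integ F⟩

theorem norm_integ_le (F : 𝓢(E × E, G)) (x : E × E) : ‖integ F x‖ ≤ ∫ v, ‖F (x.1, v)‖ := by
  refine (norm_integral_le_integral_norm _).trans (le_of_eq ?_)
  simp only [norm_smul, norm_expI, one_mul]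

theorem integ_apply_vec (F : 𝓢(E × E, E × E →L[ℝ] G)) (x h : E × E) :
    integ F x h = ∫ v : E, expI v x.2 • F (x.1, v) h :=
  ContinuousLinearMap.integral_apply (integrable_integrand F x) h

/-- Integration by parts in the direction of `ξ`. -/
theorem norm_snd_mul_integ_le (F : 𝓢(E × E, G)) (x : E × E) :
    ‖x.2‖ * ‖integ F x‖ ≤ ‖integ (fderivCLM ℂ (E × E) G F) x‖ := by
  rcases eq_or_ne x.2 0 with h0 | h0
  · simp [h0]
  have hpos : 0 < ‖x.2‖ := norm_pos_iff.2 h0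
  have key : integ (fderivCLM ℂ (E × E) G F) x (0, x.2) =
      -(((‖x.2‖ ^ 2 : ℝ) : ℂ) • Complex.I • integ F x) := by
    rw [integ_apply_vec]
    have hd1 : ∀ v : E, HasFDerivAt (fun v : E => expI v x.2)
        (expI v x.2 • (Complex.I • (Complex.ofRealCLM.comp (innerSL ℝ x.2)))) v := by
      intro v
      have h3 : HasFDerivAt (fun v : E => Complex.I * ((inner ℝ v x.2 : ℝ) : ℂ))
          (Complex.I • (Complex.ofRealCLM.comp (innerSL ℝ x.2))) v := by
        have := ((Complex.ofRealCLM.comp (innerSL ℝ x.2)).hasFDerivAt (x := v)).const_mul Complex.I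
        simpa [real_inner_comm] using this
      exact h3.cexp
    have hf1 : ∀ v : E, fderiv ℝ (fun v : E => expI v x.2) v x.2 =
        ((‖x.2‖ ^ 2 : ℝ) : ℂ) * Complex.I * expI v x.2 := by
      intro v
      rw [(hd1 v).fderiv]
      simp
      ring
    have hf2 : ∀ v : E, fderiv ℝ (fun v : E => F (x.1, v)) v x.2 =
        fderivCLM ℂ (E × E) G F (x.1, v) (0, x.2) := by
      intro v
      have : HasFDerivAt (fun v : E => F (x.1, v))
          ((fderiv ℝ F (x.1, v)).comp (ContinuousLinearMap.inr ℝ E E)) v :=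
        (F.hasFDerivAt (x.1, v)).comp v (f := fun v : E => (x.1, v)) (hasFDerivAt_prodMk_right x.1 v)
      rw [this.fderiv]
      simp
    have hd2 : Differentiable ℝ fun v : E => F (x.1, v) :=
      F.differentiable.comp (by fun_prop)
    have ibp := integral_smul_fderiv_eq_neg_fderiv_smul_of_integrable (μ := volume) (𝕜 := ℂ)
      (f := fun v : E => expI v x.2) (g := fun v : E => F (x.1, v)) (v := x.2)
      (by
        simp only [hf1, mul_smul]
        exact ((integrable_integrand F x).smul Complex.I).smul ((‖x.2‖ ^ 2 : ℝ) : ℂ))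
      (by
        simp only [hf2]
        exact (integrable_integrand (fderivCLM ℂ (E × E) G F) x).apply_continuousLinearMap (0, x.2))
      (integrable_integrand F x) (fun v _ => (hd1 v).differentiableAt) (fun v _ => hd2 v)
    simp only [hf1, hf2, mul_smul] at ibp
    rw [ibp, integral_smul, integral_smul]
    rfl
  have h1 := (integ (fderivCLM ℂ (E × E) G F) x).le_opNorm (0, x.2)
  rw [key, norm_neg, norm_smul, norm_smul, Complex.norm_I, one_mul, Prod.norm_mk, norm_zero,
    max_eq_right (norm_nonneg _), Complex.norm_real, Real.norm_of_nonneg (by positivity)] at h1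
  refine le_of_mul_le_mul_right ?_ hpos
  calc _ = ‖x.2‖ ^ 2 * ‖integ F x‖ := by ring
    _ ≤ _ := h1

theorem seminorm_comp_le {G' : Type} [NormedAddCommGroup G'] [NormedSpace ℝ G'] [NormedSpace ℂ G']
    [SMulCommClass ℝ ℂ G'] (T : 𝓢(E × E, G) →L[ℂ] 𝓢(E × E, G')) (s : Finset (ℕ × ℕ)) :
    ∃ (s' : Finset (ℕ × ℕ)) (C : ℝ), 0 ≤ C ∧ ∀ F,
      s.sup (schwartzSeminormFamily ℂ (E × E) G') (T F) ≤
        C * s'.sup (schwartzSeminormFamily ℂ (E × E) G) F := by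
  have hc : Continuous ⇑(s.sup (schwartzSeminormFamily ℂ (E × E) G')) :=
    Seminorm.continuous_finsetSup fun i _ =>
      (schwartz_withSeminorms ℂ (E × E) G').continuous_seminorm i
  obtain ⟨s', C, -, h⟩ := Seminorm.bound_of_continuous (schwartz_withSeminorms ℂ (E × E) G)
    ((s.sup (schwartzSeminormFamily ℂ (E × E) G')).comp T.toLinearMap) (hc.comp T.continuous)
  exact ⟨s', C, C.2, fun F => h F⟩

theorem bound_fst (k : ℕ) : ∃ (s : Finset (ℕ × ℕ)) (C : ℝ), 0 ≤ C ∧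
    ∀ (F : 𝓢(E × E, G)) (x : E × E), ‖x.1‖ ^ k * ‖integ F x‖ ≤
      C * s.sup (schwartzSeminormFamily ℂ (E × E) G) F := by
  obtain ⟨s, C, hC, h⟩ := slice_bound (E := E) (G := G) k
  refine ⟨s, C * ∫ v : E, (1 + ‖v‖) ^ (-((Module.finrank ℝ E + 1 : ℕ) : ℝ)), ?_, fun F x => ?_⟩
  · exact mul_nonneg hC (integral_nonneg fun v => by positivity)
  calc ‖x.1‖ ^ k * ‖integ F x‖ ≤ ‖x.1‖ ^ k * ∫ v, ‖F (x.1, v)‖ := by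
        gcongr; exact norm_integ_le F x
    _ = ∫ v, ‖x.1‖ ^ k * ‖F (x.1, v)‖ := (integral_const_mul _ _).symm
    _ ≤ ∫ v, C * s.sup (schwartzSeminormFamily ℂ (E × E) G) F *
        (1 + ‖v‖) ^ (-((Module.finrank ℝ E + 1 : ℕ) : ℝ)) :=
        integral_mono ((integrable_slice F x.1).norm.const_mul _)
          (integrable_weight.const_mul _) fun v => h F x.1 v
    _ = _ := by rw [integral_const_mul]; ring

theorem bound_snd (k : ℕ) : ∀ {G : Type} [NormedAddCommGroup G] [NormedSpace ℝ G]
    [NormedSpace ℂ G] [IsScalarTower ℝ ℂ G] [SMulCommClass ℝ ℂ G],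
    ∃ (s : Finset (ℕ × ℕ)) (C : ℝ), 0 ≤ C ∧
    ∀ (F : 𝓢(E × E, G)) (x : E × E), ‖x.2‖ ^ k * ‖integ F x‖ ≤
      C * s.sup (schwartzSeminormFamily ℂ (E × E) G) F := by
  induction k with
  | zero =>
    intro G _ _ _ _ _
    simpa using bound_fst (E := E) (G := G) 0
  | succ k ih =>
    intro G _ _ _ _ _
    obtain ⟨s, C, hC, h⟩ := ih (G := E × E →L[ℝ] G)
    obtain ⟨s', C', hC', h'⟩ := seminorm_comp_le (fderivCLM ℂ (E × E) G) s
    refine ⟨s', C * C', by positivity, fun F x => ?_⟩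
    calc ‖x.2‖ ^ (k + 1) * ‖integ F x‖ = ‖x.2‖ ^ k * (‖x.2‖ * ‖integ F x‖) := by ring
      _ ≤ ‖x.2‖ ^ k * ‖integ (fderivCLM ℂ (E × E) G F) x‖ := by
        gcongr; exact norm_snd_mul_integ_le F x
      _ ≤ C * s.sup (schwartzSeminormFamily ℂ (E × E) _) (fderivCLM ℂ (E × E) G F) := h _ x
      _ ≤ C * (C' * s'.sup (schwartzSeminormFamily ℂ (E × E) G) F) := by gcongr; exact h' F
      _ = _ := by ring

theorem bound_integ (k n : ℕ) : ∀ {G : Type} [NormedAddCommGroup G] [NormedSpace ℝ G]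
    [NormedSpace ℂ G] [IsScalarTower ℝ ℂ G] [SMulCommClass ℝ ℂ G],
    ∃ (s : Finset (ℕ × ℕ)) (C : ℝ), 0 ≤ C ∧
    ∀ (F : 𝓢(E × E, G)) (x : E × E), ‖x‖ ^ k * ‖iteratedFDeriv ℝ n (integ F) x‖ ≤
      C * s.sup (schwartzSeminormFamily ℂ (E × E) G) F := by
  induction n with
  | zero =>
    intro G _ _ _ _ _
    obtain ⟨s, C, hC, h⟩ := bound_fst (E := E) (G := G) k
    obtain ⟨s', C', hC', h'⟩ := bound_snd (E := E) k (G := G)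
    refine ⟨s ∪ s', C + C', by positivity, fun F x => ?_⟩
    have e1 : s.sup (schwartzSeminormFamily ℂ (E × E) G) F ≤
        (s ∪ s').sup (schwartzSeminormFamily ℂ (E × E) G) F :=
      Seminorm.le_def.1 (Finset.sup_mono Finset.subset_union_left) F
    have e2 : s'.sup (schwartzSeminormFamily ℂ (E × E) G) F ≤
        (s ∪ s').sup (schwartzSeminormFamily ℂ (E × E) G) F :=
      Seminorm.le_def.1 (Finset.sup_mono Finset.subset_union_right) F
    rw [norm_iteratedFDeriv_zero]
    have hx : ‖x‖ ^ k ≤ ‖x.1‖ ^ k + ‖x.2‖ ^ k := by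
      rw [Prod.norm_def]
      rcases max_choice ‖x.1‖ ‖x.2‖ with e | e <;> rw [e]
      · have : 0 ≤ ‖x.2‖ ^ k := by positivity
        linarith
      · have : 0 ≤ ‖x.1‖ ^ k := by positivity
        linarith
    calc ‖x‖ ^ k * ‖integ F x‖ ≤ (‖x.1‖ ^ k + ‖x.2‖ ^ k) * ‖integ F x‖ := by gcongr
      _ = ‖x.1‖ ^ k * ‖integ F x‖ + ‖x.2‖ ^ k * ‖integ F x‖ := by ring
      _ ≤ C * (s ∪ s').sup (schwartzSeminormFamily ℂ (E × E) G) F +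
          C' * (s ∪ s').sup (schwartzSeminormFamily ℂ (E × E) G) F :=
        add_le_add ((h F x).trans (by gcongr)) ((h' F x).trans (by gcongr))
      _ = _ := by ring
  | succ n ih =>
    intro G _ _ _ _ _
    obtain ⟨s, C, hC, h⟩ := ih (G := E × E →L[ℝ] G)
    obtain ⟨s', C', hC', h'⟩ := seminorm_comp_le (dMap (E := E) (G := G)) s
    refine ⟨s', C * C', by positivity, fun F x => ?_⟩
    have e : fderiv ℝ (integ F) = integ (dMap F) := funext fun y => (hasFDerivAt_integ F y).fderiv
    rw [← norm_iteratedFDeriv_fderiv, e]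
    calc _ ≤ C * s.sup (schwartzSeminormFamily ℂ (E × E) _) (dMap F) := h _ x
      _ ≤ C * (C' * s'.sup (schwartzSeminormFamily ℂ (E × E) G) F) := by gcongr; exact h' F
      _ = _ := by ring

/-- The map `F ↦ ((u, ξ) ↦ ∫ e^{i⟨v, ξ⟩} F(u, v) dv)` on Schwartz functions. -/
def integCLM : 𝓢(E × E, ℂ) →L[ℂ] 𝓢(E × E, ℂ) :=
  mkCLM (fun F => integ F) integ_add (fun c F x => integ_smul c F x)
    (fun F => contDiff_infty.2 fun n => contDiff_integ n F)
    (fun n => bound_integ n.1 n.2)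

end PartialFourier

/-- `ℝᵈ` with the Euclidean norm. Phase space `ℝ²ᵈ` is written as the product `Rd d × Rd d`. -/
abbrev Rd (d : ℕ) : Type := EuclideanSpace ℝ (Fin d)

namespace SchattenSymbol

instance (d : ℕ) : (volume : Measure (Rd d × Rd d)).IsAddHaarMeasure :=
  inferInstanceAs ((volume : Measure (Rd d)).prod (volume : Measure (Rd d))).IsAddHaarMeasure

/-! ### Schwartz functions and tempered distributions -/

section Schwartz

variable {V : Type} [NormedAddCommGroup V] [NormedSpace ℝ V]

/-- The pointwise complex conjugate of a Schwartz function. -/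
def conjS (φ : 𝓢(V, ℂ)) : 𝓢(V, ℂ) :=
  postcompCLM (𝕜 := ℝ) (Complex.conjCLE : ℂ →L[ℝ] ℂ) φ

theorem conjS_apply (φ : 𝓢(V, ℂ)) (x : V) : conjS φ x = conj (φ x) := rfl

theorem conjS_conjS (φ : 𝓢(V, ℂ)) : conjS (conjS φ) = φ := by
  ext x; simp [conjS_apply]

theorem conjS_add (φ ψ : 𝓢(V, ℂ)) : conjS (φ + ψ) = conjS φ + conjS ψ := by
  ext x; simp [conjS_apply]

theorem conjS_smul (c : ℂ) (φ : 𝓢(V, ℂ)) : conjS (c • φ) = conj c • conjS φ := by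
  ext x; simp [conjS_apply]

variable [MeasureSpace V] [BorelSpace V] [FiniteDimensional ℝ V]
  [(volume : Measure V).IsAddHaarMeasure]

/-- The tempered distribution `ψ ↦ ∫ φ ψ` of a Schwartz function `φ`. -/
def ofS (φ : 𝓢(V, ℂ)) : 𝓢'(V, ℂ) := toTemperedDistributionCLM V ℂ volume φ

theorem ofS_injective : Function.Injective (ofS (V := V)) := by
  intro φ ψ h
  have h1 := MeasureTheory.Lp.toTemperedDistribution_toLp_eq (p := 2) (μ := (volume : Measure V)) φ
  have h2 := MeasureTheory.Lp.toTemperedDistribution_toLp_eq (p := 2) (μ := (volume : Measure V)) ψ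
  have h3 := LinearMap.ker_eq_bot.1
    (MeasureTheory.Lp.ker_toTemperedDistributionCLM_eq_bot (F := ℂ)
      (μ := (volume : Measure V)) (p := 2))
  exact injective_toLp 2 volume (h3 ((h1.trans h).trans h2.symm))

end Schwartz

section Kernels

variable {d : ℕ}

/-- The tensor product `(ψ ⊗ φ)(x, y) = ψ(x) φ(y)` of Schwartz functions. -/
def tensor (ψ φ : 𝓢(Rd d, ℂ)) : 𝓢(Rd d × Rd d, ℂ) where
  toFun z := ψ z.1 * φ z.2
  smooth' := (ψ.smooth'.comp contDiff_fst).mul (φ.smooth'.comp contDiff_snd)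
  decay' := by
    intro k n
    have hfst : ∀ (i : ℕ) (z : Rd d × Rd d),
        ‖iteratedFDeriv ℝ i (fun z : Rd d × Rd d => ψ z.1) z‖ ≤ ‖iteratedFDeriv ℝ i ψ z.1‖ := by
      intro i z
      have h := (ContinuousLinearMap.fst ℝ (Rd d) (Rd d)).iteratedFDeriv_comp_right
        (ψ.smooth ⊤) z (i := i) (by exact_mod_cast le_top)
      refine (congrArg norm h).le.trans
        ((ContinuousMultilinearMap.norm_compContinuousLinearMap_le _ _).trans ?_)
      refine mul_le_of_le_one_right (norm_nonneg _) (Finset.prod_le_one (fun _ _ => norm_nonneg _)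
        fun _ _ => ContinuousLinearMap.norm_fst_le ..)
    have hsnd : ∀ (i : ℕ) (z : Rd d × Rd d),
        ‖iteratedFDeriv ℝ i (fun z : Rd d × Rd d => φ z.2) z‖ ≤ ‖iteratedFDeriv ℝ i φ z.2‖ := by
      intro i z
      have h := (ContinuousLinearMap.snd ℝ (Rd d) (Rd d)).iteratedFDeriv_comp_right
        (φ.smooth ⊤) z (i := i) (by exact_mod_cast le_top)
      refine (congrArg norm h).le.trans
        ((ContinuousMultilinearMap.norm_compContinuousLinearMap_le _ _).trans ?_)
      refine mul_le_of_le_one_right (norm_nonneg _) (Finset.prod_le_one (fun _ _ => norm_nonneg _)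
        fun _ _ => ContinuousLinearMap.norm_snd_le ..)
    refine ⟨∑ i ∈ Finset.range (n + 1), (n.choose i : ℝ) *
      (SchwartzMap.seminorm ℝ k i ψ * SchwartzMap.seminorm ℝ 0 (n - i) φ +
        SchwartzMap.seminorm ℝ 0 i ψ * SchwartzMap.seminorm ℝ k (n - i) φ), fun z => ?_⟩
    have hmul := norm_iteratedFDeriv_mul_le (𝕜 := ℝ) (N := ∞) (n := n)
      (f := fun z : Rd d × Rd d => ψ z.1) (g := fun z : Rd d × Rd d => φ z.2)
      (ψ.smooth'.comp contDiff_fst) (φ.smooth'.comp contDiff_snd) z (by exact_mod_cast le_top)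
    refine (mul_le_mul_of_nonneg_left hmul (by positivity)).trans ?_
    rw [Finset.mul_sum]
    refine Finset.sum_le_sum fun i _ => ?_
    have hz : ‖z‖ ^ k ≤ ‖z.1‖ ^ k + ‖z.2‖ ^ k := by
      rw [Prod.norm_def]
      rcases max_choice ‖z.1‖ ‖z.2‖ with e | e <;> rw [e]
      · have : 0 ≤ ‖z.2‖ ^ k := by positivity
        linarith
      · have : 0 ≤ ‖z.1‖ ^ k := by positivity
        linarith
    have a1 := ψ.le_seminorm ℝ k i z.1
    have a2 := ψ.norm_iteratedFDeriv_le_seminorm ℝ i z.1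
    have b1 := φ.le_seminorm ℝ k (n - i) z.2
    have b2 := φ.norm_iteratedFDeriv_le_seminorm ℝ (n - i) z.2
    calc _ ≤ (‖z.1‖ ^ k + ‖z.2‖ ^ k) * ((n.choose i : ℝ) * ‖iteratedFDeriv ℝ i ψ z.1‖ *
          ‖iteratedFDeriv ℝ (n - i) φ z.2‖) := by
          gcongr
          · exact hfst i z
          · exact hsnd (n - i) z
      _ = (n.choose i : ℝ) * ((‖z.1‖ ^ k * ‖iteratedFDeriv ℝ i ψ z.1‖) *
          ‖iteratedFDeriv ℝ (n - i) φ z.2‖ + ‖iteratedFDeriv ℝ i ψ z.1‖ *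
          (‖z.2‖ ^ k * ‖iteratedFDeriv ℝ (n - i) φ z.2‖)) := by ring
      _ ≤ _ := by
          gcongr

theorem tensor_apply (ψ φ : 𝓢(Rd d, ℂ)) (x y : Rd d) : tensor ψ φ (x, y) = ψ x * φ y := rfl

/-- The inverse partial Fourier transform in the second variable,
`(𝓕₂⁻¹ F)(u, v) = (2π)^{-d/2} ∫ F(u, ξ) e^{i⟨ξ, v⟩} dξ`, on Schwartz functions. -/
def partialFourierInvS : 𝓢(Rd d × Rd d, ℂ) →L[ℂ] 𝓢(Rd d × Rd d, ℂ) :=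
  (((2 * Real.pi) ^ (-(d : ℝ) / 2) : ℝ) : ℂ) • PartialFourier.integCLM

theorem partialFourierInvS_apply (F : 𝓢(Rd d × Rd d, ℂ)) (u v : Rd d) :
    partialFourierInvS F (u, v) = (((2 * Real.pi) ^ (-(d : ℝ) / 2) : ℝ) : ℂ) *
      ∫ ξ : Rd d, Complex.exp (Complex.I * (inner ℝ ξ v : ℝ)) * F (u, ξ) := rfl

/-- The partial Fourier transform in the second variable,
`(𝓕₂ F)(u, v) = (2π)^{-d/2} ∫ F(u, ξ) e^{-i⟨ξ, v⟩} dξ`, on Schwartz functions. -/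
def partialFourierS : 𝓢(Rd d × Rd d, ℂ) →L[ℂ] 𝓢(Rd d × Rd d, ℂ) :=
  (compCLMOfContinuousLinearEquiv ℂ ((ContinuousLinearEquiv.refl ℝ (Rd d)).prodCongr
    (ContinuousLinearEquiv.neg ℝ))).comp partialFourierInvS

theorem partialFourierS_apply (F : 𝓢(Rd d × Rd d, ℂ)) (u v : Rd d) :
    partialFourierS F (u, v) = (((2 * Real.pi) ^ (-(d : ℝ) / 2) : ℝ) : ℂ) *
      ∫ ξ : Rd d, Complex.exp (-(Complex.I * (inner ℝ ξ v : ℝ))) * F (u, ξ) := by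
  have h : partialFourierS F (u, v) = partialFourierInvS F (u, -v) := rfl
  rw [h, partialFourierInvS_apply]
  simp

/-- The transform `𝓕₂⁻¹` of tempered distributions, `⟨𝓕₂⁻¹ a, F⟩ = ⟨a, 𝓕₂⁻¹ F⟩`. -/
def partialFourierInv : 𝓢'(Rd d × Rd d, ℂ) →ₗ[ℂ] 𝓢'(Rd d × Rd d, ℂ) :=
  (PointwiseConvergenceCLM.precomp ℂ (partialFourierInvS (d := d))).toLinearMap

/-- The transform `𝓕₂` of tempered distributions, `⟨𝓕₂ a, F⟩ = ⟨a, 𝓕₂ F⟩`. -/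
def partialFourier : 𝓢'(Rd d × Rd d, ℂ) →ₗ[ℂ] 𝓢'(Rd d × Rd d, ℂ) :=
  (PointwiseConvergenceCLM.precomp ℂ (partialFourierS (d := d))).toLinearMap

/-- The pullback `K ∘ L` of a tempered distribution under a linear change of variables `L` with
`|det L| = 1`: `⟨K ∘ L, F⟩ = ⟨K, F ∘ L⁻¹⟩`. -/
def unimodularPullback (L : (Rd d × Rd d) ≃L[ℝ] Rd d × Rd d) :
    𝓢'(Rd d × Rd d, ℂ) →ₗ[ℂ] 𝓢'(Rd d × Rd d, ℂ) :=
  (PointwiseConvergenceCLM.precomp ℂ (compCLMOfContinuousLinearEquiv ℂ L.symm)).toLinearMap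

/-- The change of variables `(x, y) ↦ ((1 - t) x + t y, x - y)`, of determinant `±1`. -/
def quantCoord (t : ℝ) : (Rd d × Rd d) ≃L[ℝ] Rd d × Rd d :=
  LinearEquiv.toContinuousLinearEquiv
    { toFun := fun z => ((1 - t) • z.1 + t • z.2, z.1 - z.2)
      invFun := fun w => (w.1 + t • w.2, w.1 - (1 - t) • w.2)
      map_add' := fun z w => by ext <;> simp <;> ring
      map_smul' := fun c z => by ext <;> simp <;> ring
      left_inv := fun z => by ext <;> simp <;> ring
      right_inv := fun z => by ext <;> simp <;> ring }

/-- The change of variables `(x, y) ↦ ((y - x) / 2, x + y)`, of determinant `±1`. -/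
def twistCoord : (Rd d × Rd d) ≃L[ℝ] Rd d × Rd d :=
  LinearEquiv.toContinuousLinearEquiv
    { toFun := fun z => ((1 / 2 : ℝ) • (z.2 - z.1), z.1 + z.2)
      invFun := fun w => ((1 / 2 : ℝ) • w.2 - w.1, (1 / 2 : ℝ) • w.2 + w.1)
      map_add' := fun z w => by ext <;> simp <;> ring
      map_smul' := fun c z => by ext <;> simp <;> ring
      left_inv := fun z => by ext <;> simp <;> ring
      right_inv := fun z => by ext <;> simp <;> ring }

/-- The kernel `K(x, y) = (𝓕₂⁻¹ a)((1 - t) x + t y, x - y)` of the operator `a_t(x, D)`, with the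
unitary normalization `(2π)^{-d/2}` of the Fourier transform. -/
def quantKernel (t : ℝ) : 𝓢'(Rd d × Rd d, ℂ) →ₗ[ℂ] 𝓢'(Rd d × Rd d, ℂ) :=
  unimodularPullback (quantCoord t) ∘ₗ partialFourierInv

/-- The kernel `K(x, y) = (2π)^{-d} ∫ a((1 - t) x + t y, ξ) e^{i⟨x - y, ξ⟩} dξ` of the
pseudo-differential operator `(2π)^{-d} ∬ a((1 - t) x + t y, ξ) f(y) e^{i⟨x - y, ξ⟩} dy dξ`. -/
def quantKernelStd (t : ℝ) : 𝓢'(Rd d × Rd d, ℂ) →ₗ[ℂ] 𝓢'(Rd d × Rd d, ℂ) :=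
  (((2 * Real.pi) ^ (-(d : ℝ) / 2) : ℝ) : ℂ) • quantKernel t

/-- The kernel `(Aa)(x, y) = (2π)^{-d/2} ∫ a((y - x) / 2, ξ) e^{-i⟨x + y, ξ⟩} dξ`. -/
def twistKernel : 𝓢'(Rd d × Rd d, ℂ) →ₗ[ℂ] 𝓢'(Rd d × Rd d, ℂ) :=
  unimodularPullback twistCoord ∘ₗ partialFourier

end Kernels

/-! ### Tempered Hilbert spaces and their `L²`-duals -/

section TemperedHilbert

variable {d : ℕ} {H : Type*} [NormedAddCommGroup H] [InnerProductSpace ℂ H]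

/-- A tempered Hilbert space on `ℝᵈ` is a Hilbert space `H`, continuously embedded in the tempered
distributions (by `ι`), which contains the Schwartz functions as a dense subspace. -/
class IsTempered (ι : H →ₗ[ℂ] 𝓢'(Rd d, ℂ)) : Prop where
  injective : Function.Injective ι
  continuous : Continuous ι
  schwartz_mem : ∀ φ : 𝓢(Rd d, ℂ), ∃ f : H, ι f = ofS φ
  schwartz_dense : Dense {f : H | ∃ φ : 𝓢(Rd d, ℂ), ι f = ofS φ}

/-- The tempered distributions `φ` for which `f ↦ (φ, f)_{L²}` is bounded on the Schwartz functions
with respect to the norm of `H`. Here `(φ, f)_{L²} = ⟨φ, conj f⟩` for Schwartz functions `f`. -/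
def l2DualSubmodule (ι : H →ₗ[ℂ] 𝓢'(Rd d, ℂ)) : Submodule ℂ 𝓢'(Rd d, ℂ) where
  carrier := {φ | ∃ C : ℝ, ∀ (g : 𝓢(Rd d, ℂ)) (f : H), ι f = ofS g → ‖φ (conjS g)‖ ≤ C * ‖f‖}
  zero_mem' := ⟨0, fun g f _ => by simp⟩
  add_mem' := by
    rintro φ ψ ⟨C, hC⟩ ⟨C', hC'⟩
    refine ⟨C + C', fun g f h => ?_⟩
    rw [add_mul]
    exact (norm_add_le (φ (conjS g)) (ψ (conjS g))).trans (add_le_add (hC g f h) (hC' g f h))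
  smul_mem' := by
    rintro c φ ⟨C, hC⟩
    refine ⟨‖c‖ * C, fun g f h => ?_⟩
    rw [mul_assoc]
    exact (norm_smul_le c (φ (conjS g))).trans (mul_le_mul_of_nonneg_left (hC g f h) (norm_nonneg c))

/-- The `L²`-dual `H'` of `H`. Its norm is `‖φ‖ = sup |(φ, f)_{L²}|` over Schwartz functions `f`
with `‖f‖_H ≤ 1`, see `L2Dual.isLUB_norm`. -/
def L2Dual (ι : H →ₗ[ℂ] 𝓢'(Rd d, ℂ)) : Type := l2DualSubmodule ι

namespace L2Dual

variable (ι : H →ₗ[ℂ] 𝓢'(Rd d, ℂ))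

instance : AddCommGroup (L2Dual ι) := inferInstanceAs (AddCommGroup (l2DualSubmodule ι))

instance : Module ℂ (L2Dual ι) := inferInstanceAs (Module ℂ (l2DualSubmodule ι))

/-- The inclusion of `H'` in the tempered distributions. -/
def incl : L2Dual ι →ₗ[ℂ] 𝓢'(Rd d, ℂ) := (l2DualSubmodule ι).subtype

theorem incl_injective : Function.Injective (incl ι) := Subtype.val_injective

variable [IsTempered ι] [CompleteSpace H]

theorem existsUnique_riesz (φ : L2Dual ι) : ∃! h : H, ∀ (g : 𝓢(Rd d, ℂ)) (f : H),
    ι f = ofS g → incl ι φ (conjS g) = inner ℂ f h := by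
  obtain ⟨C, hC⟩ := φ.2
  let D : Submodule ℂ H :=
    { carrier := {f : H | ∃ g : 𝓢(Rd d, ℂ), ι f = ofS g}
      zero_mem' := ⟨0, by simp [ofS]⟩
      add_mem' := by
        rintro f f' ⟨g, hg⟩ ⟨g', hg'⟩
        exact ⟨g + g', by rw [map_add, hg, hg']; simp [ofS]⟩
      smul_mem' := by
        rintro c f ⟨g, hg⟩
        exact ⟨c • g, by rw [map_smul, hg]; simp [ofS]⟩ }
  choose s hs using fun f : D => f.2
  have hs_eq : ∀ (f : D) (g : 𝓢(Rd d, ℂ)), ι f = ofS g → s f = g := fun f g h =>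
    ofS_injective ((hs f).symm.trans h)
  let l : D →ₗ[ℂ] ℂ :=
    { toFun := fun f => conj (incl ι φ (conjS (s f)))
      map_add' := fun f f' => by
        have : s (f + f') = s f + s f' := hs_eq _ _ (by
          rw [Submodule.coe_add, map_add, hs, hs]; simp [ofS])
        rw [this, conjS_add, map_add, map_add]
      map_smul' := fun c f => by
        have : s (c • f) = c • s f := hs_eq _ _ (by
          rw [Submodule.coe_smul, map_smul, hs]; simp [ofS])
        rw [this, conjS_smul, map_smul, smul_eq_mul, map_mul, Complex.conj_conj]
        rfl }
  let L : StrongDual ℂ D := l.mkContinuous C fun f => by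
    have h1 : ‖l f‖ = ‖incl ι φ (conjS (s f))‖ := RCLike.norm_conj _
    rw [h1]
    exact hC (s f) f (hs f)
  obtain ⟨M, hM, -⟩ := exists_extension_norm_eq D L
  refine ⟨(InnerProductSpace.toDual ℂ H).symm M, fun g f h => ?_, fun h' hh' => ?_⟩
  · have h1 : M f = conj (incl ι φ (conjS g)) := by
      rw [← hs_eq ⟨f, g, h⟩ g h]
      exact hM ⟨f, g, h⟩
    rw [← inner_conj_symm, InnerProductSpace.toDual_symm_apply, h1, Complex.conj_conj]
  · refine (IsTempered.schwartz_dense (ι := ι)).eq_of_inner_right (𝕜 := ℂ) ?_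
    rintro f ⟨g, hg⟩
    have h1 : M f = conj (incl ι φ (conjS g)) := by
      rw [← hs_eq ⟨f, g, hg⟩ g hg]
      exact hM ⟨f, g, hg⟩
    rw [← hh' g f hg, ← inner_conj_symm, InnerProductSpace.toDual_symm_apply, h1,
      Complex.conj_conj]

/-- The element `R φ` of `H` with `(φ, f)_{L²} = (R φ, f)_H` for all Schwartz functions `f`. -/
def riesz : L2Dual ι →ₗ[ℂ] H where
  toFun φ := (existsUnique_riesz ι φ).choose
  map_add' φ ψ := by
    refine (existsUnique_riesz ι (φ + ψ)).unique (existsUnique_riesz ι (φ + ψ)).choose_spec.1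
      fun g f h => ?_
    rw [inner_add_right, ← (existsUnique_riesz ι φ).choose_spec.1 g f h,
      ← (existsUnique_riesz ι ψ).choose_spec.1 g f h, map_add]
    rfl
  map_smul' c φ := by
    refine (existsUnique_riesz ι (c • φ)).unique (existsUnique_riesz ι (c • φ)).choose_spec.1
      fun g f h => ?_
    rw [RingHom.id_apply, inner_smul_right, ← (existsUnique_riesz ι φ).choose_spec.1 g f h,
      map_smul]
    rfl

theorem riesz_spec (φ : L2Dual ι) (g : 𝓢(Rd d, ℂ)) (f : H) (h : ι f = ofS g) :
    incl ι φ (conjS g) = inner ℂ f (riesz ι φ) :=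
  (existsUnique_riesz ι φ).choose_spec.1 g f h

theorem riesz_injective : Function.Injective (riesz ι) := by
  refine (injective_iff_map_eq_zero _).2 fun φ h0 => incl_injective ι ?_
  rw [map_zero]
  ext g
  obtain ⟨f, hf⟩ := IsTempered.schwartz_mem (ι := ι) (conjS g)
  have := riesz_spec ι φ (conjS g) f hf
  rwa [conjS_conjS, h0, inner_zero_right] at this

instance : NormedAddCommGroup (L2Dual ι) :=
  NormedAddCommGroup.induced (L2Dual ι) H (riesz ι) (riesz_injective ι)

theorem norm_def (φ : L2Dual ι) : ‖φ‖ = ‖riesz ι φ‖ := rfl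

/-- The inner product of `H'` induced by its norm. -/
instance : InnerProductSpace ℂ (L2Dual ι) where
  norm_smul_le c φ := by
    rw [norm_def, norm_def, map_smul, norm_smul]
  inner φ ψ := inner ℂ (riesz ι φ) (riesz ι ψ)
  norm_sq_eq_re_inner φ := norm_sq_eq_re_inner (𝕜 := ℂ) (riesz ι φ)
  conj_inner_symm φ ψ := inner_conj_symm (riesz ι φ) (riesz ι ψ)
  add_left φ ψ χ := by rw [map_add, inner_add_left]
  smul_left φ ψ c := by rw [map_smul, inner_smul_left]

theorem isLUB_norm (φ : L2Dual ι) : IsLUB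
    {r : ℝ | ∃ (g : 𝓢(Rd d, ℂ)) (f : H), ι f = ofS g ∧ ‖f‖ ≤ 1 ∧ r = ‖incl ι φ (conjS g)‖}
    ‖φ‖ := by
  constructor
  · rintro r ⟨g, f, h, hf, rfl⟩
    rw [riesz_spec ι φ g f h, norm_def]
    exact (norm_inner_le_norm _ _).trans (mul_le_of_le_one_left (norm_nonneg _) hf)
  · intro b hb
    have hb' : ∀ (g : 𝓢(Rd d, ℂ)) (f : H), ι f = ofS g → ‖inner ℂ f (riesz ι φ)‖ ≤ b * ‖f‖ := by
      intro g f h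
      rcases eq_or_ne f 0 with rfl | hf
      · simp
      have hn : 0 < ‖f‖ := norm_pos_iff.2 hf
      have h1 : ι ((‖f‖ : ℂ)⁻¹ • f) = ofS ((‖f‖ : ℂ)⁻¹ • g) := by
        rw [map_smul, h]; simp [ofS]
      have h2 := hb ⟨_, _, h1, by rw [norm_smul]; simp [hn.ne'], rfl⟩
      rw [riesz_spec ι φ _ _ h1, inner_smul_left, norm_mul] at h2
      simp only [map_inv₀, Complex.conj_ofReal, norm_inv, Complex.norm_real, norm_norm] at h2
      rwa [inv_mul_le_iff₀ hn, mul_comm] at h2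
    have hall : ∀ f : H, ‖inner ℂ f (riesz ι φ)‖ ≤ b * ‖f‖ := by
      have hcl : IsClosed {f : H | ‖inner ℂ f (riesz ι φ)‖ ≤ b * ‖f‖} :=
        isClosed_le (by fun_prop) (by fun_prop)
      intro f
      have hsub : {f : H | ∃ g : 𝓢(Rd d, ℂ), ι f = ofS g} ⊆
          {f : H | ‖inner ℂ f (riesz ι φ)‖ ≤ b * ‖f‖} := fun f ⟨g, hg⟩ => hb' g f hg
      exact hcl.closure_subset_iff.2 hsub ((IsTempered.schwartz_dense (ι := ι)) f)
    rw [norm_def]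
    rcases eq_or_ne (riesz ι φ) 0 with h0 | h0
    · rw [h0, norm_zero]
      exact le_trans (norm_nonneg _) (hb ⟨0, 0, by simp [ofS], by simp, rfl⟩)
    · have h1 := hall (riesz ι φ)
      have hn : 0 < ‖riesz ι φ‖ := norm_pos_iff.2 h0
      rw [inner_self_eq_norm_sq_to_K] at h1
      simp only [Complex.coe_algebraMap, norm_pow, Complex.norm_real, norm_norm] at h1
      rw [sq] at h1
      exact le_of_mul_le_mul_right h1 hn

end L2Dual

end TemperedHilbert

/-! ### Schatten-von Neumann classes -/

section Schatten

variable {H₁ : Type*} [NormedAddCommGroup H₁] [InnerProductSpace ℂ H₁]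
  {H₂ : Type*} [NormedAddCommGroup H₂] [InnerProductSpace ℂ H₂]

/-- The Schatten-von Neumann norm: the supremum of `(∑ |(T fⱼ, gⱼ)|ᵖ)^{1/p}` (of
`sup |(T fⱼ, gⱼ)|` for `p = ∞`) over all finite or infinite orthonormal sequences `(fⱼ)` in `H₁`
and `(gⱼ)` in `H₂`. -/
def schattenNorm (p : ℝ≥0∞) (T : H₁ →L[ℂ] H₂) : ℝ≥0∞ :=
  ⨆ (J : Set ℕ) (f : J → H₁) (g : J → H₂) (_ : Orthonormal ℂ f) (_ : Orthonormal ℂ g),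
    eLpNorm (fun j : J => inner ℂ (g j) (T (f j))) p Measure.count

theorem le_schattenNorm (p : ℝ≥0∞) (T : H₁ →L[ℂ] H₂) {J : Set ℕ} {f : J → H₁} {g : J → H₂}
    (hf : Orthonormal ℂ f) (hg : Orthonormal ℂ g) :
    eLpNorm (fun j : J => inner ℂ (g j) (T (f j))) p Measure.count ≤ schattenNorm p T :=
  le_iSup_of_le J (le_iSup_of_le f (le_iSup_of_le g (le_iSup_of_le hf
    (le_iSup_of_le hg le_rfl))))

theorem schattenNorm_le {p : ℝ≥0∞} {T : H₁ →L[ℂ] H₂} {c : ℝ≥0∞}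
    (h : ∀ (J : Set ℕ) (f : J → H₁) (g : J → H₂), Orthonormal ℂ f → Orthonormal ℂ g →
      eLpNorm (fun j : J => inner ℂ (g j) (T (f j))) p Measure.count ≤ c) :
    schattenNorm p T ≤ c :=
  iSup_le fun J => iSup_le fun f => iSup_le fun g => iSup_le fun hf => iSup_le fun hg =>
    h J f g hf hg

theorem schattenNorm_zero (p : ℝ≥0∞) : schattenNorm p (0 : H₁ →L[ℂ] H₂) = 0 := by
  refine le_antisymm (schattenNorm_le fun J f g _ _ => ?_) bot_le
  simp

theorem schattenNorm_add_le {p : ℝ≥0∞} (hp : 1 ≤ p) (T S : H₁ →L[ℂ] H₂) :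
    schattenNorm p (T + S) ≤ schattenNorm p T + schattenNorm p S := by
  refine schattenNorm_le fun J f g hf hg => ?_
  have : (fun j : J => inner ℂ (g j) ((T + S) (f j))) =
      (fun j : J => inner ℂ (g j) (T (f j))) + fun j : J => inner ℂ (g j) (S (f j)) := by
    ext j; simp
  rw [this]
  exact (eLpNorm_add_le (measurable_of_countable _).aestronglyMeasurable
    (measurable_of_countable _).aestronglyMeasurable hp).trans
    (add_le_add (le_schattenNorm p T hf hg) (le_schattenNorm p S hf hg))

theorem schattenNorm_smul_le {p : ℝ≥0∞} (c : ℂ) (T : H₁ →L[ℂ] H₂) :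
    schattenNorm p (c • T) ≤ ‖c‖ₑ * schattenNorm p T := by
  refine schattenNorm_le fun J f g hf hg => ?_
  have : (fun j : J => inner ℂ (g j) ((c • T) (f j))) =
      c • fun j : J => inner ℂ (g j) (T (f j)) := by
    ext j; simp
  rw [this]
  exact eLpNorm_const_smul_le.trans (mul_le_mul_right (le_schattenNorm p T hf hg) _)

end Schatten

/-! ### Symbols of Schatten-von Neumann operators -/

section Symbols

variable {d : ℕ}
  {H₁ : Type*} [NormedAddCommGroup H₁] [InnerProductSpace ℂ H₁]
  {H₂ : Type*} [NormedAddCommGroup H₂] [InnerProductSpace ℂ H₂]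

/-- The operator with distribution kernel `K` (from Schwartz functions to tempered distributions,
`⟨Op φ, ψ⟩ = ⟨K, ψ ⊗ φ⟩`) agrees on the Schwartz functions with `T : H₁ → H₂`. -/
def HasKernel (ι₁ : H₁ →ₗ[ℂ] 𝓢'(Rd d, ℂ)) (ι₂ : H₂ →ₗ[ℂ] 𝓢'(Rd d, ℂ))
    (K : 𝓢'(Rd d × Rd d, ℂ)) (T : H₁ →L[ℂ] H₂) : Prop :=
  ∀ (φ : 𝓢(Rd d, ℂ)) (f : H₁), ι₁ f = ofS φ → ∀ ψ : 𝓢(Rd d, ℂ), ι₂ (T f) ψ = K (tensor ψ φ)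

/-- The Schatten-von Neumann norm of the continuous extension `T : H₁ → H₂` of the operator with
kernel `K`; it is `∞` if there is no such extension. (The extension is unique since the Schwartz
functions are dense in `H₁`.) -/
def kernelNorm (p : ℝ≥0∞) (ι₁ : H₁ →ₗ[ℂ] 𝓢'(Rd d, ℂ)) (ι₂ : H₂ →ₗ[ℂ] 𝓢'(Rd d, ℂ))
    (K : 𝓢'(Rd d × Rd d, ℂ)) : ℝ≥0∞ :=
  ⨅ (T : H₁ →L[ℂ] H₂) (_ : HasKernel ι₁ ι₂ K T), schattenNorm p T

variable (p : ℝ≥0∞) (ι₁ : H₁ →ₗ[ℂ] 𝓢'(Rd d, ℂ)) (ι₂ : H₂ →ₗ[ℂ] 𝓢'(Rd d, ℂ))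

theorem kernelNorm_le {p : ℝ≥0∞} {ι₁ : H₁ →ₗ[ℂ] 𝓢'(Rd d, ℂ)} {ι₂ : H₂ →ₗ[ℂ] 𝓢'(Rd d, ℂ)}
    {K : 𝓢'(Rd d × Rd d, ℂ)} {T : H₁ →L[ℂ] H₂} (h : HasKernel ι₁ ι₂ K T) :
    kernelNorm p ι₁ ι₂ K ≤ schattenNorm p T :=
  iInf₂_le T h

theorem kernelNorm_zero : kernelNorm p ι₁ ι₂ 0 = 0 := by
  refine le_antisymm ((kernelNorm_le (T := 0) ?_).trans (schattenNorm_zero p).le) bot_le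
  intro φ f _ ψ
  simp

theorem HasKernel.add {ι₁ : H₁ →ₗ[ℂ] 𝓢'(Rd d, ℂ)} {ι₂ : H₂ →ₗ[ℂ] 𝓢'(Rd d, ℂ)}
    {K K' : 𝓢'(Rd d × Rd d, ℂ)} {T S : H₁ →L[ℂ] H₂} (hT : HasKernel ι₁ ι₂ K T)
    (hS : HasKernel ι₁ ι₂ K' S) : HasKernel ι₁ ι₂ (K + K') (T + S) := by
  intro φ f h ψ
  have h1 : ι₂ ((T + S) f) = ι₂ (T f) + ι₂ (S f) := map_add ι₂ (T f) (S f)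
  have h2 : (ι₂ (T f) + ι₂ (S f)) ψ = ι₂ (T f) ψ + ι₂ (S f) ψ := rfl
  have h3 : (K + K') (tensor ψ φ) = K (tensor ψ φ) + K' (tensor ψ φ) := rfl
  rw [h1, h2, h3, hT φ f h ψ, hS φ f h ψ]

theorem HasKernel.smul {ι₁ : H₁ →ₗ[ℂ] 𝓢'(Rd d, ℂ)} {ι₂ : H₂ →ₗ[ℂ] 𝓢'(Rd d, ℂ)}
    {K : 𝓢'(Rd d × Rd d, ℂ)} {T : H₁ →L[ℂ] H₂} (c : ℂ) (hT : HasKernel ι₁ ι₂ K T) :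
    HasKernel ι₁ ι₂ (c • K) (c • T) := by
  intro φ f h ψ
  have h1 : ι₂ ((c • T) f) = c • ι₂ (T f) := map_smul ι₂ c (T f)
  have h2 : (c • ι₂ (T f)) ψ = c • ι₂ (T f) ψ := rfl
  have h3 : (c • K) (tensor ψ φ) = c • K (tensor ψ φ) := rfl
  rw [h1, h2, h3, hT φ f h ψ]

theorem le_iInf_add_iInf {α : Type*} {c : ℝ≥0∞} {P P' : α → Prop} {f : α → ℝ≥0∞}
    (h : ∀ T, P T → ∀ S, P' S → c ≤ f T + f S) :
    c ≤ (⨅ (T) (_ : P T), f T) + ⨅ (T) (_ : P' T), f T := by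
  simp only [ENNReal.iInf_add, ENNReal.add_iInf]
  exact le_iInf fun T => le_iInf fun hT => le_iInf fun S => le_iInf fun hS => by
    first | exact h T hT S hS | exact h S hS T hT

theorem kernelNorm_add_le [hp : Fact (1 ≤ p)] (K K' : 𝓢'(Rd d × Rd d, ℂ)) :
    kernelNorm p ι₁ ι₂ (K + K') ≤ kernelNorm p ι₁ ι₂ K + kernelNorm p ι₁ ι₂ K' :=
  le_iInf_add_iInf fun T hT S hS =>
    (kernelNorm_le (hT.add hS)).trans (schattenNorm_add_le hp.out T S)

theorem kernelNorm_smul_le (c : ℂ) (K : 𝓢'(Rd d × Rd d, ℂ)) :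
    kernelNorm p ι₁ ι₂ (c • K) ≤ ‖c‖ₑ * kernelNorm p ι₁ ι₂ K := by
  rcases eq_or_ne c 0 with rfl | hc
  · have h0 : (0 : ℂ) • K = 0 := zero_smul ℂ K
    rw [h0, kernelNorm_zero]; exact bot_le
  conv_rhs => rw [kernelNorm]
  rw [ENNReal.mul_iInf_of_ne (by simpa using hc) enorm_ne_top]
  refine le_iInf fun T => ?_
  rw [ENNReal.mul_iInf_of_ne (by simpa using hc) enorm_ne_top]
  refine le_iInf fun hT => ?_
  exact (kernelNorm_le (hT.smul c)).trans (schattenNorm_smul_le c T)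

variable (Q : 𝓢'(Rd d × Rd d, ℂ) →ₗ[ℂ] 𝓢'(Rd d × Rd d, ℂ)) [Fact (1 ≤ p)]

/-- The symbols `a` such that the operator with kernel `Q a` belongs to the Schatten-von Neumann
class of order `p` from `H₁` to `H₂`. -/
def symbolSubmodule : Submodule ℂ 𝓢'(Rd d × Rd d, ℂ) where
  carrier := {a | kernelNorm p ι₁ ι₂ (Q a) < ⊤}
  zero_mem' := by
    change kernelNorm p ι₁ ι₂ (Q 0) < ⊤
    rw [map_zero, kernelNorm_zero]; exact ENNReal.zero_lt_top
  add_mem' := by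
    intro a b ha hb
    change kernelNorm p ι₁ ι₂ (Q (a + b)) < ⊤
    rw [map_add]
    exact (kernelNorm_add_le p ι₁ ι₂ _ _).trans_lt (ENNReal.add_lt_top.2 ⟨ha, hb⟩)
  smul_mem' := by
    intro c a ha
    change kernelNorm p ι₁ ι₂ (Q (c • a)) < ⊤
    rw [map_smul]
    exact (kernelNorm_smul_le p ι₁ ι₂ c _).trans_lt (ENNReal.mul_lt_top enorm_lt_top ha)

/-- The space of symbols of Schatten-von Neumann operators of order `p` from `H₁` to `H₂` under the
quantization `Q` (which maps a symbol to the kernel of the operator), normed by the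
Schatten-von Neumann norm of the operator. -/
def SymbolSpace : Type := symbolSubmodule p ι₁ ι₂ Q

namespace SymbolSpace

instance : AddCommGroup (SymbolSpace p ι₁ ι₂ Q) :=
  inferInstanceAs (AddCommGroup (symbolSubmodule p ι₁ ι₂ Q))

instance : Module ℂ (SymbolSpace p ι₁ ι₂ Q) :=
  inferInstanceAs (Module ℂ (symbolSubmodule p ι₁ ι₂ Q))

/-- The tempered distribution underlying a symbol. -/
def incl : SymbolSpace p ι₁ ι₂ Q →ₗ[ℂ] 𝓢'(Rd d × Rd d, ℂ) :=
  (symbolSubmodule p ι₁ ι₂ Q).subtype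

theorem kernelNorm_lt_top (a : SymbolSpace p ι₁ ι₂ Q) :
    kernelNorm p ι₁ ι₂ (Q (incl p ι₁ ι₂ Q a)) < ⊤ := a.2

/-- The norm `‖a‖ = ‖Op(a)‖` of a symbol, as a seminorm. -/
def seminorm : Seminorm ℂ (SymbolSpace p ι₁ ι₂ Q) :=
  Seminorm.ofSMulLE (fun a => (kernelNorm p ι₁ ι₂ (Q (incl p ι₁ ι₂ Q a))).toReal)
    (by simp [kernelNorm_zero])
    (fun a b => by
      rw [map_add, map_add, ← ENNReal.toReal_add (kernelNorm_lt_top p ι₁ ι₂ Q a).ne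
        (kernelNorm_lt_top p ι₁ ι₂ Q b).ne]
      exact ENNReal.toReal_mono (ENNReal.add_ne_top.2 ⟨(kernelNorm_lt_top p ι₁ ι₂ Q a).ne,
        (kernelNorm_lt_top p ι₁ ι₂ Q b).ne⟩) (kernelNorm_add_le p ι₁ ι₂ _ _))
    (fun c a => by
      rw [map_smul, map_smul, ← toReal_enorm, ← ENNReal.toReal_mul]
      exact ENNReal.toReal_mono (ENNReal.mul_ne_top enorm_ne_top
        (kernelNorm_lt_top p ι₁ ι₂ Q a).ne) (kernelNorm_smul_le p ι₁ ι₂ c _))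

instance : SeminormedAddCommGroup (SymbolSpace p ι₁ ι₂ Q) :=
  (seminorm p ι₁ ι₂ Q).toAddGroupSeminorm.toSeminormedAddCommGroup

theorem norm_def (a : SymbolSpace p ι₁ ι₂ Q) :
    ‖a‖ = (kernelNorm p ι₁ ι₂ (Q (incl p ι₁ ι₂ Q a))).toReal := rfl

instance : NormedSpace ℂ (SymbolSpace p ι₁ ι₂ Q) where
  norm_smul_le c a := (map_smul_eq_mul (seminorm p ι₁ ι₂ Q) c a).le

end SymbolSpace

end Symbols

/-! ### Dualities through the `L²` form -/

section Duality

variable {d : ℕ}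
  {H₁ : Type*} [NormedAddCommGroup H₁] [InnerProductSpace ℂ H₁]
  {H₂ : Type*} [NormedAddCommGroup H₂] [InnerProductSpace ℂ H₂]
  {H₃ : Type*} [NormedAddCommGroup H₃] [InnerProductSpace ℂ H₃]
  {H₄ : Type*} [NormedAddCommGroup H₄] [InnerProductSpace ℂ H₄]
  {p q : ℝ≥0∞} [Fact (1 ≤ p)] [Fact (1 ≤ q)]
  {ι₁ : H₁ →ₗ[ℂ] 𝓢'(Rd d, ℂ)} {ι₂ : H₂ →ₗ[ℂ] 𝓢'(Rd d, ℂ)}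
  {ι₃ : H₃ →ₗ[ℂ] 𝓢'(Rd d, ℂ)} {ι₄ : H₄ →ₗ[ℂ] 𝓢'(Rd d, ℂ)}
  {Q : 𝓢'(Rd d × Rd d, ℂ) →ₗ[ℂ] 𝓢'(Rd d × Rd d, ℂ)}

/-- The continuous sesquilinear form `B` extends the form `(φ, ψ)_{L²} = ∫ φ conj ψ` of Schwartz
functions on `ℝ²ᵈ`. -/
def ExtendsL2Form
    (B : SymbolSpace q ι₃ ι₄ Q →L[ℂ] SymbolSpace p ι₁ ι₂ Q →L⋆[ℂ] ℂ) : Prop :=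
  ∀ (φ ψ : 𝓢(Rd d × Rd d, ℂ)) (a : SymbolSpace q ι₃ ι₄ Q) (b : SymbolSpace p ι₁ ι₂ Q),
    SymbolSpace.incl q ι₃ ι₄ Q a = ofS φ → SymbolSpace.incl p ι₁ ι₂ Q b = ofS ψ →
      B a b = ∫ z, φ z * conj (ψ z)

end Duality

/-- The Schwartz functions on `ℝ²ᵈ` belong to the symbol spaces `Y` (order `p`, from `H₁` to `H₂`)
and `X` (order `q`, from `H₁'` to `H₂'`), and the `L²` form extends to a continuous sesquilinear
form `B` on `X × Y` which identifies the dual of `Y` with `X`, where the norm of a functional is `c`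
times the norm of the corresponding symbol. The extension is unique among the forms with
`|B(a, b)| ≤ c ‖a‖ ‖b‖`, and for `p > 1` even among all continuous forms. -/
def L2FormIdentifiesDual {d : ℕ}
    {H₁ : Type*} [NormedAddCommGroup H₁] [InnerProductSpace ℂ H₁] [CompleteSpace H₁]
    {H₂ : Type*} [NormedAddCommGroup H₂] [InnerProductSpace ℂ H₂] [CompleteSpace H₂]
    (ι₁ : H₁ →ₗ[ℂ] 𝓢'(Rd d, ℂ)) [IsTempered ι₁] (ι₂ : H₂ →ₗ[ℂ] 𝓢'(Rd d, ℂ)) [IsTempered ι₂]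
    (p q : ℝ≥0∞) [Fact (1 ≤ p)] [Fact (1 ≤ q)]
    (Q : 𝓢'(Rd d × Rd d, ℂ) →ₗ[ℂ] 𝓢'(Rd d × Rd d, ℂ)) (c : ℝ) : Prop :=
  (∀ φ : 𝓢(Rd d × Rd d, ℂ), ofS φ ∈ symbolSubmodule p ι₁ ι₂ Q ∧
    ofS φ ∈ symbolSubmodule q (L2Dual.incl ι₁) (L2Dual.incl ι₂) Q) ∧
  ∃ B : SymbolSpace q (L2Dual.incl ι₁) (L2Dual.incl ι₂) Q →L[ℂ] SymbolSpace p ι₁ ι₂ Q →L⋆[ℂ] ℂ,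
    ExtendsL2Form B ∧
    (∀ B', ExtendsL2Form B' → (∀ a b, ‖B' a b‖ ≤ c * ‖a‖ * ‖b‖) → B' = B) ∧
    (1 < p → ∀ B', ExtendsL2Form B' → B' = B) ∧
    (∀ b, (∀ a, B a b = 0) → b = 0) ∧
    (∀ ℓ : SymbolSpace p ι₁ ι₂ Q →L[ℂ] ℂ, ∃! a, ∀ b, conj (ℓ b) = B a b) ∧
    (∀ (ℓ : SymbolSpace p ι₁ ι₂ Q →L[ℂ] ℂ) (a), (∀ b, conj (ℓ b) = B a b) → ‖ℓ‖ = c * ‖a‖)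

end SchattenSymbol

end

/-! Each quantization is the transpose of an automorphism of the Schwartz space, maps Schwartz
functions onto Schwartz functions and preserves the `L²` form up to a constant. The three cases
therefore reduce to one duality for operator kernels, `KernelSpace.l2FormIdentifiesDual_id`, which
`L2FormIdentifiesDual.of_id` carries over to symbols. With the standard normalization the kernels
gain a factor `(2π)^{-d/2}` and the `L²` form of kernels its square, which accounts for the constant
`(2π)^d`.

For kernels, the Riesz map is a unitary operator from `H'` onto `H`. An operator from `H₁'` to `H₂'`
thus becomes an operator `A` from `H₁` to `H₂` with the same Schatten norm, and the form sought is
`tr(T* A)`. A tensor `ψ ⊗ φ` is the kernel of a rank one operator, and the trace against it is a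
matrix element of `A`, which is the value of the distribution `a` at the conjugate tensor. By
continuity this extends to all Schwartz kernels (`KernelSpace.form_schwartz`), so the trace form
extends the `L²` form. What remains is the duality between Schatten classes of conjugate orders.

The bridge between distributions and operators is `exists_hasKernel_ofS`: a Schwartz kernel gives a
trace class operator, with trace norm bounded by a continuous seminorm of the kernel. A smooth
partition of unity over a lattice and a Fourier series on each cell expand a Schwartz function on
`ℝ²ᵈ` into tensors, with rapidly decreasing coefficients and factors of polynomial growth
(`hasSum_tensor`, `exists_tsum_tensorCoeff_le`). The factors are measured in `H₁` and `H₂` by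
continuous seminorms: the Schwartz space is Baire, hence barrelled, and uniform boundedness yields
`exists_norm_evalAt_le` and `exists_norm_emb_le`.

The Schatten theory uses only orthonormal families. Hölder's inequality for the trace
(`sum_enorm_inner_le_schattenNorm_mul`) follows by diagonalizing `t* t` on a finite-dimensional
space. Finite rank operators are dense for finite `p`: once finite families nearly attain the norm
of `T`, the corner of `T` on their orthogonal complements is small, since families testing the
corner can be appended to them (`schattenNorm_complProj_le`). The norm of a functional is recovered
by the converse of Hölder's inequality (`schattenNorm_le_of_forall_sum`).

For `p > 1` Schwartz kernels are dense on both sides, which gives uniqueness. For `p = 1` they need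
not be dense among bounded operators, and the norm bound takes over
(`KernelSpace.eq_form_of_norm_le`). The discrepancy `δ` of two forms at `(a, b)`, with `b` of rank
one, does not change when `A` is perturbed by finite rank operators. Such a perturbation turns `A`
into a block operator of norm at most `|z|` whose corner in the direction of `b` is a large multiple
`z` of `δ`; the bound then leaves no room for `δ ≠ 0`. -/

namespace SchattenSymbol

/-! ### Completeness of the Schwartz space -/

section SchwartzComplete

variable {E F : Type*} [NormedAddCommGroup E] [NormedSpace ℝ E] [NormedAddCommGroup F]
  [NormedSpace ℝ F] {ι : Type*}

/-- The sum of a series of Schwartz functions that converges absolutely in all seminorms. -/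
noncomputable def schwartzTsum [CompleteSpace F] (x : ι → 𝓢(E, F))
    (h : ∀ k n, Summable fun i => SchwartzMap.seminorm ℝ k n (x i)) : 𝓢(E, F) where
  toFun y := ∑' i, x i y
  smooth' := contDiff_tsum (N := ⊤) (v := fun n i => SchwartzMap.seminorm ℝ 0 n (x i))
    (fun i => (x i).smooth ⊤) (fun n _ => h 0 n)
    (fun n i y _ => (x i).norm_iteratedFDeriv_le_seminorm ℝ n y)
  decay' := by
    intro k n
    refine ⟨∑' i, SchwartzMap.seminorm ℝ k n (x i), fun y => ?_⟩
    rw [iteratedFDeriv_tsum_apply (N := ⊤) (v := fun n i => SchwartzMap.seminorm ℝ 0 n (x i))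
      (fun i => (x i).smooth ⊤) (fun n _ => h 0 n)
      (fun n i y _ => (x i).norm_iteratedFDeriv_le_seminorm ℝ n y) le_top]
    have h1 : Summable fun i => ‖iteratedFDeriv ℝ n (x i) y‖ :=
      (h 0 n).of_nonneg_of_le (fun _ => norm_nonneg _)
        fun i => (x i).norm_iteratedFDeriv_le_seminorm ℝ n y
    refine (mul_le_mul_of_nonneg_left (norm_tsum_le_tsum_norm h1) (by positivity)).trans ?_
    rw [← tsum_mul_left]
    exact (h1.mul_left _).tsum_le_tsum (fun i => (x i).le_seminorm ℝ k n y) (h k n)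

theorem schwartzTsum_apply [CompleteSpace F] (x : ι → 𝓢(E, F))
    (h : ∀ k n, Summable fun i => SchwartzMap.seminorm ℝ k n (x i)) (y : E) :
    schwartzTsum x h y = ∑' i, x i y := rfl

theorem seminorm_schwartzTsum_le [CompleteSpace F] (x : ι → 𝓢(E, F))
    (h : ∀ k n, Summable fun i => SchwartzMap.seminorm ℝ k n (x i)) (k n : ℕ) :
    SchwartzMap.seminorm ℝ k n (schwartzTsum x h) ≤ ∑' i, SchwartzMap.seminorm ℝ k n (x i) := by
  refine SchwartzMap.seminorm_le_bound ℝ k n _ (tsum_nonneg fun i => apply_nonneg _ _) fun y => ?_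
  change ‖y‖ ^ k * ‖iteratedFDeriv ℝ n (fun y => ∑' i, x i y) y‖ ≤ _
  rw [iteratedFDeriv_tsum_apply (N := ⊤) (v := fun n i => SchwartzMap.seminorm ℝ 0 n (x i))
    (fun i => (x i).smooth ⊤) (fun n _ => h 0 n)
    (fun n i y _ => (x i).norm_iteratedFDeriv_le_seminorm ℝ n y) le_top]
  have h1 : Summable fun i => ‖iteratedFDeriv ℝ n (x i) y‖ :=
    (h 0 n).of_nonneg_of_le (fun _ => norm_nonneg _)
      fun i => (x i).norm_iteratedFDeriv_le_seminorm ℝ n y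
  refine (mul_le_mul_of_nonneg_left (norm_tsum_le_tsum_norm h1) (by positivity)).trans ?_
  rw [← tsum_mul_left]
  exact (h1.mul_left _).tsum_le_tsum (fun i => (x i).le_seminorm ℝ k n y) (h k n)

theorem summable_apply_of_summable_seminorm [CompleteSpace F] {x : ι → 𝓢(E, F)}
    (h : ∀ k n, Summable fun i => SchwartzMap.seminorm ℝ k n (x i)) (y : E) :
    Summable fun i => x i y :=
  .of_norm ((h 0 0).of_nonneg_of_le (fun _ => norm_nonneg _)
    fun i => (x i).norm_le_seminorm ℝ y)

/-- The error of a finite partial sum is minus the sum over the complementary indices, and its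
seminorms are at most tails of convergent series. -/
theorem hasSum_schwartzTsum [CompleteSpace F] (x : ι → 𝓢(E, F))
    (h : ∀ k n, Summable fun i => SchwartzMap.seminorm ℝ k n (x i)) :
    HasSum x (schwartzTsum x h) := by
  refine ((schwartz_withSeminorms ℝ E F).tendsto_nhds _ _).2 fun i ε hε => ?_
  have hlim := tendsto_tsum_compl_atTop_zero fun j => SchwartzMap.seminorm ℝ i.1 i.2 (x j)
  filter_upwards [hlim.eventually (gt_mem_nhds hε)] with s hs
  have hs' : ∀ k n, Summable fun j : {j // j ∉ s} => SchwartzMap.seminorm ℝ k n (x j) :=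
    fun k n => (h k n).subtype _
  have e : (∑ j ∈ s, x j) - schwartzTsum x h =
      -schwartzTsum (fun j : {j // j ∉ s} => x j) hs' := by
    ext y
    rw [sub_apply, neg_apply, sum_apply, schwartzTsum_apply,
      schwartzTsum_apply,
      ← (summable_apply_of_summable_seminorm h y).sum_add_tsum_subtype_compl s]
    simp
  rw [e]
  change SchwartzMap.seminorm ℝ i.1 i.2 _ < ε
  rw [map_neg_eq_map]
  exact (seminorm_schwartzTsum_le _ hs' _ _).trans_lt hs

/-- The uniformity is countably generated, so it is enough to treat sequences whose steps from index
`N` on are below `2^{-N}` in the maximum of the seminorms of orders at most `N`. Every fixed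
seminorm of the steps is then eventually dominated by a geometric series, and the telescoping series
converges. -/
instance [CompleteSpace F] : CompleteSpace 𝓢(E, F) := by
  have : (uniformity 𝓢(E, F)).IsCountablyGenerated :=
    IsUniformAddGroup.uniformity_countably_generated
  let U : ℕ → SetRel 𝓢(E, F) 𝓢(E, F) := fun N =>
    {z | (Finset.Iic (N, N)).sup (schwartzSeminormFamily ℝ E F) (z.2 - z.1) < (1 / 2) ^ N}
  refine UniformSpace.complete_of_convergent_controlled_sequences U (fun N => ?_) fun u hu => ?_
  · rw [uniformity_eq_comap_nhds_zero]
    refine ⟨((Finset.Iic (N, N)).sup (schwartzSeminormFamily ℝ E F)).ball 0 ((1 / 2) ^ N),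
      ((schwartz_withSeminorms ℝ E F).mem_nhds_iff _ _).2
        ⟨Finset.Iic (N, N), (1 / 2) ^ N, by positivity, subset_rfl⟩, fun z hz => ?_⟩
    simpa [Seminorm.mem_ball, U] using hz
  · have hsum : ∀ k n, Summable fun j => SchwartzMap.seminorm ℝ k n (u (j + 1) - u j) := by
      intro k n
      rw [← summable_nat_add_iff (max k n)]
      refine (((summable_geometric_of_lt_one (by norm_num : (0 : ℝ) ≤ 1 / 2)
        (by norm_num)).comp_injective (add_left_injective (max k n)))).of_nonneg_of_le
        (fun _ => apply_nonneg _ _) fun j => ?_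
      have h1 := hu (j + max k n) (j + max k n) (j + max k n + 1) le_rfl (Nat.le_succ _)
      refine le_trans ?_ (le_of_lt h1)
      exact Seminorm.le_def.1 (Finset.le_sup (f := schwartzSeminormFamily ℝ E F)
        (b := (k, n)) (by simp; omega)) _
    refine ⟨u 0 + schwartzTsum _ hsum, ?_⟩
    have h2 := (hasSum_schwartzTsum _ hsum).tendsto_sum_nat.const_add (u 0)
    simpa only [Finset.sum_range_sub, add_sub_cancel] using h2

/-- Baire spaces are barrelled, which is what `exists_continuous_seminorm_ge` needs. -/
instance [CompleteSpace F] : BaireSpace 𝓢(E, F) := by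
  have : (uniformity 𝓢(E, F)).IsCountablyGenerated :=
    IsUniformAddGroup.uniformity_countably_generated
  let _ := UniformSpace.pseudoMetricSpace 𝓢(E, F)
  exact BaireSpace.of_completelyPseudoMetrizable

theorem hasSum_of_summable_seminorm [CompleteSpace F] {x : ι → 𝓢(E, F)} {g : 𝓢(E, F)}
    (h : ∀ k n, Summable fun i => SchwartzMap.seminorm ℝ k n (x i))
    (hg : ∀ y, HasSum (fun i => x i y) (g y)) : HasSum x g := by
  convert hasSum_schwartzTsum x h
  ext y
  exact (hg y).tsum_eq.symm

end SchwartzComplete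

end SchattenSymbol

namespace SchattenSymbol

/-! ### Schwartz functions as distributions, and uniform boundedness -/

section OfS

variable {V : Type} [NormedAddCommGroup V] [NormedSpace ℝ V] [MeasureSpace V] [BorelSpace V]
  [FiniteDimensional ℝ V] [(volume : Measure V).IsAddHaarMeasure]

theorem ofS_apply (φ ψ : 𝓢(V, ℂ)) : ofS φ ψ = ∫ x, φ x * ψ x := by
  simp only [ofS, toTemperedDistributionCLM_apply_apply, smul_eq_mul, mul_comm]

theorem ofS_comm (φ ψ : 𝓢(V, ℂ)) : ofS φ ψ = ofS ψ φ := by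
  simp only [ofS_apply, mul_comm]

theorem ofS_add (φ ψ : 𝓢(V, ℂ)) : ofS (φ + ψ) = ofS φ + ofS ψ := map_add _ _ _

theorem ofS_smul (c : ℂ) (φ : 𝓢(V, ℂ)) : ofS (c • φ) = c • ofS φ := map_smul _ _ _

theorem ofS_conjS_conjS (φ ψ : 𝓢(V, ℂ)) : ofS (conjS φ) (conjS ψ) = conj (ofS φ ψ) := by
  rw [ofS_apply, ofS_apply, ← integral_conj]
  simp [conjS_apply]

theorem continuous_conjS : Continuous (conjS (V := V)) :=
  (postcompCLM (𝕜 := ℝ) (E := V) (Complex.conjCLE : ℂ →L[ℝ] ℂ)).continuous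

/-- A tempered distribution from a continuous functional on the Schwartz functions. -/
noncomputable def toDistribution (l : 𝓢(V, ℂ) →L[ℂ] ℂ) : 𝓢'(V, ℂ) :=
  ContinuousLinearMap.toPointwiseConvergenceCLM ℂ (RingHom.id ℂ) 𝓢(V, ℂ) ℂ l

/-- The seminorm `φ ↦ |⟨K, φ⟩|`. -/
noncomputable def absSeminorm (K : 𝓢'(V, ℂ)) : Seminorm ℂ 𝓢(V, ℂ) :=
  Seminorm.of (fun φ => ‖K φ‖) (fun φ ψ => by rw [map_add]; exact norm_add_le _ _)
    (fun c φ => by rw [map_smul, norm_smul])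

theorem continuous_absSeminorm (K : 𝓢'(V, ℂ)) : Continuous (absSeminorm K) :=
  K.continuous.norm

end OfS

/-- The uniform boundedness principle: on a barrelled space the supremum of a pointwise bounded
family of continuous seminorms is continuous. -/
theorem exists_continuous_seminorm_ge {E : Type*} [AddCommGroup E] [Module ℂ E]
    [TopologicalSpace E] [BarrelledSpace ℂ E] {α : Type*} (p : α → Seminorm ℂ E)
    (hp : ∀ i, Continuous (p i)) (b : E → ℝ) (hb : ∀ i x, p i x ≤ b x) :
    ∃ q : Seminorm ℂ E, Continuous q ∧ ∀ i x, p i x ≤ q x := by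
  have bdd : BddAbove (Set.range p) :=
    Seminorm.bddAbove_range_iff.2 fun x => ⟨b x, Set.forall_mem_range.2 fun i => hb i x⟩
  refine ⟨⨆ i, p i, ?_, fun i => Seminorm.le_def.1 (le_ciSup bdd i)⟩
  rw [Seminorm.coe_iSup_eq bdd]
  exact Seminorm.continuous_iSup p hp bdd

theorem continuous_of_norm_le {E F Φ : Type*} [AddCommGroup E] [TopologicalSpace E]
    [IsTopologicalAddGroup E] [SeminormedAddCommGroup F] [FunLike Φ E F] [AddMonoidHomClass Φ E F]
    (f : Φ) {q : E → ℝ} (hq : Continuous q) (hq0 : q 0 = 0) (h : ∀ x, ‖f x‖ ≤ q x) :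
    Continuous f := by
  refine continuous_of_continuousAt_zero f ?_
  rw [ContinuousAt, map_zero, tendsto_zero_iff_norm_tendsto_zero]
  refine squeeze_zero (fun _ => norm_nonneg _) h ?_
  simpa [hq0] using hq.tendsto 0

/-! ### Tempered Hilbert spaces and their `L²`-duals -/

section Tempered

variable {d : ℕ} {H : Type*} [NormedAddCommGroup H] [InnerProductSpace ℂ H]
  (ι : H →ₗ[ℂ] 𝓢'(Rd d, ℂ)) [IsTempered ι]

/-- The Schwartz functions as elements of a tempered Hilbert space. -/
noncomputable def emb : 𝓢(Rd d, ℂ) →ₗ[ℂ] H where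
  toFun φ := (IsTempered.schwartz_mem (ι := ι) φ).choose
  map_add' φ ψ := IsTempered.injective (ι := ι) <| by
    rw [map_add, (IsTempered.schwartz_mem (ι := ι) (φ + ψ)).choose_spec,
      (IsTempered.schwartz_mem (ι := ι) φ).choose_spec,
      (IsTempered.schwartz_mem (ι := ι) ψ).choose_spec, ofS_add]
  map_smul' c φ := IsTempered.injective (ι := ι) <| by
    rw [RingHom.id_apply, map_smul, (IsTempered.schwartz_mem (ι := ι) (c • φ)).choose_spec,
      (IsTempered.schwartz_mem (ι := ι) φ).choose_spec, ofS_smul]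

theorem apply_emb (φ : 𝓢(Rd d, ℂ)) : ι (emb ι φ) = ofS φ :=
  (IsTempered.schwartz_mem (ι := ι) φ).choose_spec

theorem eq_emb {φ : 𝓢(Rd d, ℂ)} {f : H} (h : ι f = ofS φ) : f = emb ι φ :=
  IsTempered.injective (h.trans (apply_emb ι φ).symm)

theorem denseRange_emb : DenseRange (emb ι) := by
  refine (IsTempered.schwartz_dense (ι := ι)).mono ?_
  rintro f ⟨φ, hφ⟩
  exact ⟨φ, (eq_emb ι hφ).symm⟩

/-- The functional `f ↦ ⟨f, φ⟩` on a tempered Hilbert space. -/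
noncomputable def evalAt (φ : 𝓢(Rd d, ℂ)) : H →L[ℂ] ℂ where
  toFun f := ι f φ
  map_add' f g := by rw [map_add]; rfl
  map_smul' c f := by rw [map_smul]; rfl
  cont := ((PointwiseConvergenceCLM.evalCLM (RingHom.id ℂ) ℂ φ).continuous).comp
    (IsTempered.continuous (ι := ι))

theorem evalAt_apply (φ : 𝓢(Rd d, ℂ)) (f : H) : evalAt ι φ f = ι f φ := rfl

/-- The operator norm is the supremum over the unit ball of `H` of the continuous seminorms `φ ↦
|⟨f, φ⟩|`, so uniform boundedness applies. -/
theorem exists_norm_evalAt_le : ∃ q : Seminorm ℂ 𝓢(Rd d, ℂ), Continuous q ∧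
    ∀ φ, ‖evalAt ι φ‖ ≤ q φ := by
  obtain ⟨q, hq, h⟩ := exists_continuous_seminorm_ge
    (fun f : Metric.closedBall (0 : H) 1 => absSeminorm (ι f))
    (fun f => continuous_absSeminorm _) (fun φ => ‖evalAt ι φ‖)
    (fun f φ => (evalAt ι φ).unit_le_opNorm f (mem_closedBall_zero_iff.1 f.2))
  refine ⟨q, hq, fun φ => ?_⟩
  rw [← ContinuousLinearMap.sSup_unitClosedBall_eq_norm]
  refine Real.sSup_le ?_ (apply_nonneg q φ)
  rintro _ ⟨f, hf, rfl⟩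
  exact h ⟨f, hf⟩ φ

variable [CompleteSpace H]

/-- The vector `v` with `(v, f)_H = ⟨f, φ⟩` for all `f`. -/
noncomputable def dualVec (φ : 𝓢(Rd d, ℂ)) : H := (InnerProductSpace.toDual ℂ H).symm (evalAt ι φ)

theorem inner_dualVec (φ : 𝓢(Rd d, ℂ)) (f : H) : inner ℂ (dualVec ι φ) f = ι f φ :=
  InnerProductSpace.toDual_symm_apply

theorem norm_dualVec (φ : 𝓢(Rd d, ℂ)) : ‖dualVec ι φ‖ = ‖evalAt ι φ‖ :=
  LinearIsometryEquiv.norm_map _ _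

theorem dualVec_add (φ ψ : 𝓢(Rd d, ℂ)) : dualVec ι (φ + ψ) = dualVec ι φ + dualVec ι ψ :=
  ext_inner_right ℂ fun f => by simp only [inner_add_left, inner_dualVec, map_add]

theorem dualVec_smul (c : ℂ) (φ : 𝓢(Rd d, ℂ)) : dualVec ι (c • φ) = conj c • dualVec ι φ :=
  ext_inner_right ℂ fun f => by simp [inner_smul_left, inner_dualVec]

/-- A vector orthogonal to all `dualVec ι φ` is zero as a distribution, hence zero. The range is a
subspace although `dualVec` is conjugate linear. -/
theorem denseRange_dualVec : DenseRange (dualVec ι) := by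
  let D : Submodule ℂ H :=
    { carrier := Set.range (dualVec ι)
      zero_mem' := ⟨0, by simpa using dualVec_smul ι 0 0⟩
      add_mem' := by
        rintro _ _ ⟨φ, rfl⟩ ⟨ψ, rfl⟩
        exact ⟨φ + ψ, dualVec_add ι φ ψ⟩
      smul_mem' := by
        rintro c _ ⟨φ, rfl⟩
        exact ⟨conj c • φ, by rw [dualVec_smul, Complex.conj_conj]⟩ }
  have hD : D.topologicalClosure = ⊤ := by
    rw [Submodule.topologicalClosure_eq_top_iff, Submodule.eq_bot_iff]
    intro f hf
    refine IsTempered.injective (ι := ι) ?_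
    rw [map_zero]
    ext φ
    rw [← inner_dualVec]
    exact (Submodule.mem_orthogonal D f).1 hf _ ⟨φ, rfl⟩
  exact Submodule.dense_iff_topologicalClosure_eq_top.2 hD

/-- Continuity of the inclusion of the Schwartz functions in `H` is not part of `IsTempered` and is
recovered by duality: as the vectors `dualVec ι χ` are dense, they suffice to compute the norm of
`emb ι φ`, and each of them contributes the continuous seminorm `φ ↦ |∫ χ φ|`. -/
theorem exists_norm_emb_le : ∃ q : Seminorm ℂ 𝓢(Rd d, ℂ), Continuous q ∧
    ∀ φ, ‖emb ι φ‖ ≤ q φ := by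
  obtain ⟨q, hq, h⟩ := exists_continuous_seminorm_ge
    (fun χ : {χ : 𝓢(Rd d, ℂ) // ‖dualVec ι χ‖ ≤ 1} => absSeminorm (ofS χ.1))
    (fun χ => continuous_absSeminorm _) (fun φ => ‖emb ι φ‖) (by
      intro χ φ
      change ‖ofS χ.1 φ‖ ≤ _
      rw [ofS_comm, ← apply_emb ι φ, ← inner_dualVec]
      exact (norm_inner_le_norm _ _).trans (mul_le_of_le_one_left (norm_nonneg _) χ.2))
  refine ⟨q, hq, fun φ => ?_⟩
  have h1 : ∀ χ, ‖inner ℂ (dualVec ι χ) (emb ι φ)‖ ≤ ‖dualVec ι χ‖ * q φ := by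
    intro χ
    rcases eq_or_ne (dualVec ι χ) 0 with h0 | h0
    · simp [h0]
    have hn : 0 < ‖dualVec ι χ‖ := norm_pos_iff.2 h0
    have h2 := h ⟨(‖dualVec ι χ‖ : ℂ)⁻¹ • χ, by rw [dualVec_smul, norm_smul]; simp [hn.ne']⟩ φ
    change ‖ofS _ φ‖ ≤ _ at h2
    rw [ofS_smul] at h2
    change ‖(‖dualVec ι χ‖ : ℂ)⁻¹ * ofS χ φ‖ ≤ _ at h2
    rw [ofS_comm, ← apply_emb ι φ, ← inner_dualVec, norm_mul] at h2
    simpa [inv_mul_le_iff₀ hn] using h2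
  have h3 : ∀ v : H, ‖inner ℂ v (emb ι φ)‖ ≤ ‖v‖ * q φ := fun v =>
    (isClosed_le (f := fun v => ‖inner ℂ v (emb ι φ)‖) (g := fun v => ‖v‖ * q φ)
      (by fun_prop) (by fun_prop)).closure_subset_iff.2
      (Set.range_subset_iff.2 h1) (denseRange_dualVec ι v)
  have h4 := h3 (emb ι φ)
  rw [inner_self_eq_norm_sq_to_K] at h4
  simp only [Complex.coe_algebraMap, norm_pow, Complex.norm_real, norm_norm] at h4
  rw [sq] at h4
  rcases (norm_nonneg (emb ι φ)).eq_or_lt with h0 | h0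
  · rw [← h0]; exact apply_nonneg _ _
  · exact le_of_mul_le_mul_left h4 h0

namespace L2Dual

theorem inner_emb_riesz (f : L2Dual ι) (φ : 𝓢(Rd d, ℂ)) :
    inner ℂ (emb ι φ) (riesz ι f) = incl ι f (conjS φ) :=
  (riesz_spec ι f φ (emb ι φ) (apply_emb ι φ)).symm

/-- For `h` in `H` the functional `φ ↦ (h, conj φ)_H` is continuous on the Schwartz space by
`exists_norm_emb_le`. It is therefore a tempered distribution, and it lies in `H'` by the
Cauchy–Schwarz inequality. -/
theorem riesz_surjective : Function.Surjective (riesz ι) := by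
  intro h
  obtain ⟨q, hq, hb⟩ := exists_norm_emb_le ι
  let l : 𝓢(Rd d, ℂ) →ₗ[ℂ] ℂ :=
    { toFun := fun φ => inner ℂ (emb ι (conjS φ)) h
      map_add' := fun φ ψ => by rw [conjS_add, map_add, inner_add_left]
      map_smul' := fun c φ => by
        rw [conjS_smul, map_smul, inner_smul_left, Complex.conj_conj]; rfl }
  have hl : Continuous l := by
    refine continuous_of_norm_le l (q := fun φ => q (conjS φ) * ‖h‖)
      ((hq.comp continuous_conjS).mul_const _) ?_ fun φ => ?_
    · have : conjS (0 : 𝓢(Rd d, ℂ)) = 0 := by simpa using conjS_smul 0 (0 : 𝓢(Rd d, ℂ))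
      simp [this]
    · exact (norm_inner_le_norm _ _).trans (mul_le_mul_of_nonneg_right (hb _) (norm_nonneg _))
  let φ : 𝓢'(Rd d, ℂ) := toDistribution ⟨l, hl⟩
  have hφ : ∀ (g : 𝓢(Rd d, ℂ)) (f : H), ι f = ofS g → φ (conjS g) = inner ℂ f h := by
    intro g f hf
    rw [eq_emb ι hf]
    change inner ℂ (emb ι (conjS (conjS g))) h = _
    rw [conjS_conjS]
  let φ' : L2Dual ι := ⟨φ, ‖h‖, fun g f hf => by
    rw [hφ g f hf, mul_comm]; exact norm_inner_le_norm _ _⟩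
  exact ⟨φ', (existsUnique_riesz ι φ').unique (existsUnique_riesz ι φ').choose_spec.1 hφ⟩

/-- The Riesz map as a unitary operator from `H'` to `H`. -/
noncomputable def rieszEquiv : L2Dual ι ≃ₗᵢ[ℂ] H where
  toLinearEquiv := LinearEquiv.ofBijective (riesz ι) ⟨riesz_injective ι, riesz_surjective ι⟩
  norm_map' _ := rfl

theorem rieszEquiv_apply (f : L2Dual ι) : rieszEquiv ι f = riesz ι f := rfl

instance : CompleteSpace (L2Dual ι) :=
  (completeSpace_congr (rieszEquiv ι).isometry.isUniformEmbedding (e := (rieszEquiv ι).toEquiv)).2 inferInstance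

theorem ofS_mem (φ : 𝓢(Rd d, ℂ)) : ofS φ ∈ l2DualSubmodule ι := by
  refine ⟨‖evalAt ι (conjS φ)‖, fun g f hf => ?_⟩
  have h := (evalAt ι (conjS φ)).le_opNorm f
  rwa [evalAt_apply, hf, ofS_comm, ← conjS_conjS g, ofS_conjS_conjS, RCLike.norm_conj] at h

/-- A Schwartz function as an element of `H'`. -/
noncomputable def mkOfS (φ : 𝓢(Rd d, ℂ)) : L2Dual ι := ⟨ofS φ, ofS_mem ι φ⟩

theorem incl_mkOfS (φ : 𝓢(Rd d, ℂ)) : incl ι (mkOfS ι φ) = ofS φ := rfl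

/-- Tested against the dense Schwartz functions, both vectors give the same integral. Together with
`denseRange_dualVec` this makes Schwartz functions dense in `H'`. -/
theorem riesz_mkOfS (φ : 𝓢(Rd d, ℂ)) : riesz ι (mkOfS ι φ) = dualVec ι (conjS φ) := by
  refine Dense.eq_of_inner_right (𝕜 := ℂ) (denseRange_emb ι) ?_
  rintro _ ⟨g, rfl⟩
  rw [inner_emb_riesz, ← inner_conj_symm, inner_dualVec, apply_emb, ← ofS_conjS_conjS,
    conjS_conjS, ofS_comm, incl_mkOfS]

/-- Everything proved for tempered Hilbert spaces applies to the duals as well, in particular to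
Schwartz kernels acting from `H₁'` to `H₂'`. -/
instance : IsTempered (incl ι) where
  injective := incl_injective ι
  continuous := PointwiseConvergenceCLM.continuous_of_continuous_eval fun φ => by
    have : ∀ f : L2Dual ι, incl ι f φ = inner ℂ (emb ι (conjS φ)) (rieszEquiv ι f) := fun f => by
      rw [rieszEquiv_apply, inner_emb_riesz, conjS_conjS]
    simp only [this]
    fun_prop
  schwartz_mem φ := ⟨mkOfS ι φ, rfl⟩
  schwartz_dense := by
    have h := (rieszEquiv ι).symm.surjective.denseRange.comp (denseRange_dualVec ι)
      (rieszEquiv ι).symm.continuous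
    refine Dense.mono ?_ h
    rintro _ ⟨φ, rfl⟩
    refine ⟨conjS φ, ?_⟩
    have e : (rieszEquiv ι).symm (dualVec ι φ) = mkOfS ι (conjS φ) := by
      rw [LinearIsometryEquiv.symm_apply_eq, rieszEquiv_apply, riesz_mkOfS, conjS_conjS]
    rw [Function.comp_apply, e, incl_mkOfS]

theorem riesz_emb (φ : 𝓢(Rd d, ℂ)) : riesz ι (emb (incl ι) φ) = dualVec ι (conjS φ) := by
  rw [← riesz_mkOfS]
  exact congrArg _ (eq_emb (incl ι) (incl_mkOfS ι φ)).symm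

end L2Dual
end Tempered
end SchattenSymbol

namespace SchattenSymbol

/-! ### Schwartz norms under translation and cut-off -/

section SchwartzNorm

variable {E F : Type*} [NormedAddCommGroup E] [NormedSpace ℝ E] [NormedAddCommGroup F]
  [NormedSpace ℂ F]

/-- The maximum of the Schwartz seminorms of orders at most `N`. -/
noncomputable def schwartzNorm (N : ℕ) : Seminorm ℂ 𝓢(E, F) :=
  (Finset.Iic (N, N)).sup (schwartzSeminormFamily ℂ E F)

theorem continuous_schwartzNorm (N : ℕ) : Continuous (schwartzNorm (E := E) (F := F) N) :=
  Seminorm.continuous_finsetSup fun i _ => (schwartz_withSeminorms ℂ E F).continuous_seminorm i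

theorem schwartzNorm_le {N : ℕ} {f : 𝓢(E, F)} {M : ℝ} (hM : 0 ≤ M)
    (h : ∀ k ≤ N, ∀ n ≤ N, ∀ x, ‖x‖ ^ k * ‖iteratedFDeriv ℝ n f x‖ ≤ M) :
    schwartzNorm N f ≤ M :=
  Seminorm.finset_sup_apply_le hM fun i hi => by
    have := Prod.mk_le_mk.1 (Finset.mem_Iic.1 hi)
    exact SchwartzMap.seminorm_le_bound ℂ _ _ _ hM fun x => h _ this.1 _ this.2 x

theorem le_schwartzNorm {N k n : ℕ} (hk : k ≤ N) (hn : n ≤ N) (f : 𝓢(E, F)) (x : E) :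
    (1 + ‖x‖) ^ k * ‖iteratedFDeriv ℝ n f x‖ ≤ 2 ^ N * schwartzNorm N f :=
  one_add_le_sup_seminorm_apply (m := (N, N)) hk hn f x

theorem seminorm_le_schwartzNorm {N k n : ℕ} (hk : k ≤ N) (hn : n ≤ N) (f : 𝓢(E, F)) :
    SchwartzMap.seminorm ℝ k n f ≤ schwartzNorm N f :=
  Seminorm.le_def.1 (Finset.le_sup (f := schwartzSeminormFamily ℂ E F) (b := (k, n))
    (Finset.mem_Iic.2 (Prod.mk_le_mk.2 ⟨hk, hn⟩))) f

theorem exists_le_schwartzNorm {q : Seminorm ℂ 𝓢(E, F)} (hq : Continuous q) :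
    ∃ (N : ℕ) (C : ℝ), 0 ≤ C ∧ ∀ f, q f ≤ C * schwartzNorm N f := by
  obtain ⟨s, C, -, h⟩ := Seminorm.bound_of_continuous (schwartz_withSeminorms ℂ E F) q hq
  refine ⟨s.sup fun i => max i.1 i.2, C, C.2, fun f => (h f).trans ?_⟩
  refine mul_le_mul_of_nonneg_left ?_ C.2
  refine Seminorm.finset_sup_apply_le (apply_nonneg _ _) fun i hi => ?_
  have hi' := Finset.le_sup (f := fun i : ℕ × ℕ => max i.1 i.2) hi
  exact Seminorm.le_def.1 (Finset.le_sup (f := schwartzSeminormFamily ℂ E F) (b := i)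
    (Finset.mem_Iic.2 (Prod.mk_le_mk.2 ⟨(le_max_left _ _).trans hi', (le_max_right _ _).trans hi'⟩))) f

theorem schwartzNorm_comp_le {E' F' : Type*} [NormedAddCommGroup E'] [NormedSpace ℝ E']
    [NormedAddCommGroup F'] [NormedSpace ℂ F'] (T : 𝓢(E, F) →L[ℂ] 𝓢(E', F')) (N : ℕ) :
    ∃ (N' : ℕ) (C : ℝ), 0 ≤ C ∧ ∀ f, schwartzNorm N (T f) ≤ C * schwartzNorm N' f := by
  obtain ⟨N', C, hC, h⟩ := exists_le_schwartzNorm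
    (q := (schwartzNorm (E := E') (F := F') N).comp T.toLinearMap)
    ((continuous_schwartzNorm N).comp T.continuous)
  exact ⟨N', C, hC, h⟩

/-- The inequality `‖x‖ ≤ (1 + ‖a‖) (1 + ‖x - a‖)` trades the weight at `x` for the weight at `x -
a`, at the cost of polynomial growth in `a`. -/
theorem schwartzNorm_compSubConst_le (N : ℕ) (a : E) (f : 𝓢(E, F)) :
    schwartzNorm N (compSubConstCLM ℂ a f) ≤ 2 ^ N * (1 + ‖a‖) ^ N * schwartzNorm N f := by
  refine schwartzNorm_le (by positivity) fun k hk n hn x => ?_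
  have e : iteratedFDeriv ℝ n (compSubConstCLM ℂ a f) x = iteratedFDeriv ℝ n f (x - a) :=
    iteratedFDeriv_comp_sub n a x
  have hx : ‖x‖ ≤ (1 + ‖a‖) * (1 + ‖x - a‖) := by
    have := norm_le_norm_add_norm_sub' x a
    nlinarith [norm_nonneg a, norm_nonneg (x - a), mul_nonneg (norm_nonneg a) (norm_nonneg (x - a))]
  rw [e]
  calc ‖x‖ ^ k * ‖iteratedFDeriv ℝ n f (x - a)‖
      ≤ ((1 + ‖a‖) * (1 + ‖x - a‖)) ^ k * ‖iteratedFDeriv ℝ n f (x - a)‖ := by gcongr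
    _ = (1 + ‖a‖) ^ k * ((1 + ‖x - a‖) ^ k * ‖iteratedFDeriv ℝ n f (x - a)‖) := by
        rw [mul_pow, mul_assoc]
    _ ≤ (1 + ‖a‖) ^ N * (2 ^ N * schwartzNorm N f) := by
        refine mul_le_mul (pow_le_pow_right₀ ?_ hk) (le_schwartzNorm hk hn f _) (by positivity)
          (by positivity)
        linarith [norm_nonneg a]
    _ = _ := by ring

/-- A translate of a Schwartz function, cut off by a fixed Schwartz function, decays rapidly
in the translation parameter. -/
theorem exists_schwartzNorm_cutoff_le (χ : 𝓢(E, ℂ)) (N M : ℕ) :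
    ∃ C : ℝ, 0 ≤ C ∧ ∀ (a : E) (f : 𝓢(E, ℂ)), (1 + ‖a‖) ^ M *
      schwartzNorm N (smulLeftCLM ℂ χ (compSubConstCLM ℂ (-a) f)) ≤ C * schwartzNorm (N + M) f := by
  refine ⟨2 ^ N * (2 ^ (N + M) * schwartzNorm (N + M) χ) * 2 ^ (N + M), by positivity, fun a f => ?_⟩
  rw [mul_comm, ← le_div_iff₀ (by positivity)]
  refine schwartzNorm_le (by positivity) fun k hk n hn x => ?_
  rw [le_div_iff₀ (by positivity)]
  set g := compSubConstCLM ℂ (-a) f with hg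
  have e : ∀ j, iteratedFDeriv ℝ j g x = iteratedFDeriv ℝ j f (x + a) := fun j => by
    have := iteratedFDeriv_comp_sub (f := f) (𝕜 := ℝ) j (-a) x
    rwa [sub_neg_eq_add] at this
  have e2 : (smulLeftCLM ℂ χ g : E → ℂ) = fun y => χ y * g y := by
    ext y
    exact smulLeftCLM_apply_apply χ.hasTemperateGrowth g y
  have hmul := norm_iteratedFDeriv_mul_le (𝕜 := ℝ) (N := ∞) (n := n) (f := χ) (g := g)
    χ.smooth' g.smooth' x (by exact_mod_cast le_top)
  -- The power of `1 + ‖a‖` is shared between the decay of `χ` at `x` and that of `f` at `x + a`;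
  -- this is why both need norms of order `N + M`.
  have ha : 1 + ‖a‖ ≤ (1 + ‖x‖) * (1 + ‖x + a‖) := by
    have := norm_sub_le (x + a) x
    rw [add_sub_cancel_left] at this
    nlinarith [norm_nonneg x, norm_nonneg (x + a), mul_nonneg (norm_nonneg x) (norm_nonneg (x + a))]
  rw [e2]
  have hterm : ∀ i ∈ Finset.range (n + 1), ‖x‖ ^ k * (1 + ‖a‖) ^ M *
      ((n.choose i : ℝ) * ‖iteratedFDeriv ℝ i χ x‖ * ‖iteratedFDeriv ℝ (n - i) g x‖) ≤
      (n.choose i : ℝ) * ((2 ^ (N + M) * schwartzNorm (N + M) χ) *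
        (2 ^ (N + M) * schwartzNorm (N + M) f)) := by
    intro i hi
    have hi' := Finset.mem_range_succ_iff.1 hi
    have h1 := le_schwartzNorm (N := N + M) (k := k + M) (n := i) (by omega) (by omega) χ x
    have h2 := le_schwartzNorm (N := N + M) (k := M) (n := n - i) (by omega) (by omega) f (x + a)
    rw [e]
    calc _ ≤ (1 + ‖x‖) ^ k * ((1 + ‖x‖) * (1 + ‖x + a‖)) ^ M *
          ((n.choose i : ℝ) * ‖iteratedFDeriv ℝ i χ x‖ * ‖iteratedFDeriv ℝ (n - i) f (x + a)‖) := by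
          gcongr
          linarith [norm_nonneg x]
      _ = (n.choose i : ℝ) * (((1 + ‖x‖) ^ (k + M) * ‖iteratedFDeriv ℝ i χ x‖) *
          ((1 + ‖x + a‖) ^ M * ‖iteratedFDeriv ℝ (n - i) f (x + a)‖)) := by
          rw [mul_pow, pow_add]; ring
      _ ≤ _ := by gcongr
  calc _ ≤ ‖x‖ ^ k * (∑ i ∈ Finset.range (n + 1), (n.choose i : ℝ) * ‖iteratedFDeriv ℝ i χ x‖ *
        ‖iteratedFDeriv ℝ (n - i) g x‖) * (1 + ‖a‖) ^ M := by gcongr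
    _ = ∑ i ∈ Finset.range (n + 1), ‖x‖ ^ k * (1 + ‖a‖) ^ M *
      ((n.choose i : ℝ) * ‖iteratedFDeriv ℝ i χ x‖ * ‖iteratedFDeriv ℝ (n - i) g x‖) := by
        rw [Finset.mul_sum, Finset.sum_mul]
        exact Finset.sum_congr rfl fun i _ => by ring
    _ ≤ ∑ i ∈ Finset.range (n + 1), (n.choose i : ℝ) * ((2 ^ (N + M) * schwartzNorm (N + M) χ) *
        (2 ^ (N + M) * schwartzNorm (N + M) f)) := Finset.sum_le_sum hterm
    _ = 2 ^ n * ((2 ^ (N + M) * schwartzNorm (N + M) χ) *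
        (2 ^ (N + M) * schwartzNorm (N + M) f)) := by
        rw [← Finset.sum_mul]
        congr 1
        exact_mod_cast Nat.sum_range_choose n
    _ ≤ 2 ^ N * ((2 ^ (N + M) * schwartzNorm (N + M) χ) *
        (2 ^ (N + M) * schwartzNorm (N + M) f)) := by
        gcongr
        norm_num
    _ = _ := by ring

end SchwartzNorm

end SchattenSymbol

namespace SchattenSymbol

/-! ### A smooth partition of unity over a lattice -/

section Cutoff

/-- A smooth partition function on the line, supported in `[-1/4, 1/4]`. -/
noncomputable def bump (x : ℝ) : ℝ := Real.smoothTransition (4 * x + 1) - Real.smoothTransition (4 * x)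

/-- A smooth function on the line, equal to `1` on `[-1/4, 1/4]` and supported in `[-1/2, 1/2]`. -/
noncomputable def plateau (x : ℝ) : ℝ :=
  Real.smoothTransition (4 * x + 2) * Real.smoothTransition (2 - 4 * x)

theorem contDiff_bump : ContDiff ℝ ∞ bump :=
  (Real.smoothTransition.contDiff.comp (by fun_prop)).sub
    (Real.smoothTransition.contDiff.comp (by fun_prop))

theorem contDiff_plateau : ContDiff ℝ ∞ plateau :=
  (Real.smoothTransition.contDiff.comp (by fun_prop)).mul
    (Real.smoothTransition.contDiff.comp (by fun_prop))

theorem bump_eq_zero {x : ℝ} (h : 1 / 4 ≤ |x|) : bump x = 0 := by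
  rcases le_abs.1 h with h | h
  · rw [bump, Real.smoothTransition.one_of_one_le (by linarith),
      Real.smoothTransition.one_of_one_le (by linarith), sub_self]
  · rw [bump, Real.smoothTransition.zero_of_nonpos (by linarith),
      Real.smoothTransition.zero_of_nonpos (by linarith), sub_self]

theorem plateau_eq_one {x : ℝ} (h : |x| ≤ 1 / 4) : plateau x = 1 := by
  obtain ⟨h1, h2⟩ := abs_le.1 h
  rw [plateau, Real.smoothTransition.one_of_one_le (by linarith),
    Real.smoothTransition.one_of_one_le (by linarith), one_mul]

theorem plateau_eq_zero {x : ℝ} (h : 1 / 2 ≤ |x|) : plateau x = 0 := by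
  rcases le_abs.1 h with h | h
  · rw [plateau, Real.smoothTransition.zero_of_nonpos (x := 2 - 4 * x) (by linarith), mul_zero]
  · rw [plateau, Real.smoothTransition.zero_of_nonpos (x := 4 * x + 2) (by linarith), zero_mul]

theorem bump_sub_eq_zero {x : ℝ} {k : ℤ} (hk : k ∉ ({⌊4 * x⌋, ⌊4 * x⌋ + 1} : Finset ℤ)) :
    bump (x - k / 4) = 0 := by
  refine bump_eq_zero ?_
  simp only [Finset.mem_insert, Finset.mem_singleton, not_or] at hk
  have h1 := Int.floor_le (4 * x)
  have h2 := Int.lt_floor_add_one (4 * x)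
  rcases lt_or_ge k ⌊4 * x⌋ with h | h
  · have : (k : ℝ) + 1 ≤ ⌊4 * x⌋ := by exact_mod_cast h
    exact (by linarith : 1 / 4 ≤ x - k / 4).trans (le_abs_self _)
  · have h3 : ⌊4 * x⌋ + 2 ≤ k := by omega
    have : (⌊4 * x⌋ : ℝ) + 2 ≤ k := by exact_mod_cast h3
    exact (by linarith : 1 / 4 ≤ -(x - k / 4)).trans (neg_le_abs _)

/-- `bump (x - k / 4)` is the difference of the smooth steps at `4x - k + 1` and at `4x - k`, so the
sum over `k` telescopes. -/
theorem sum_bump (x : ℝ) : ∑ k ∈ ({⌊4 * x⌋, ⌊4 * x⌋ + 1} : Finset ℤ), bump (x - k / 4) = 1 := by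
  have h1 := Int.floor_le (4 * x)
  have h2 := Int.lt_floor_add_one (4 * x)
  rw [Finset.sum_pair (by omega), bump, bump]
  push_cast
  rw [Real.smoothTransition.one_of_one_le (by linarith),
    Real.smoothTransition.zero_of_nonpos (x := 4 * (x - (⌊4 * x⌋ + 1) / 4)) (by linarith),
    show 4 * (x - ((⌊4 * x⌋ : ℝ) + 1) / 4) + 1 = 4 * (x - ⌊4 * x⌋ / 4) by ring]
  ring

variable {κ : Type} [Fintype κ]

theorem hasSum_prod_bump (x : κ → ℝ) : HasSum (fun k : κ → ℤ => ∏ i, bump (x i - k i / 4)) 1 := by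
  classical
  have h : ∑ k ∈ Fintype.piFinset fun i => ({⌊4 * x i⌋, ⌊4 * x i⌋ + 1} : Finset ℤ),
      ∏ i, bump (x i - k i / 4) = 1 := by
    rw [← Finset.prod_univ_sum (f := fun i (k : ℤ) => bump (x i - k / 4))]
    exact Finset.prod_eq_one fun i _ => sum_bump (x i)
  rw [← h]
  refine hasSum_sum_of_ne_finset_zero fun k hk => ?_
  rw [Fintype.mem_piFinset, not_forall] at hk
  obtain ⟨i, hi⟩ := hk
  exact Finset.prod_eq_zero (Finset.mem_univ i) (bump_sub_eq_zero hi)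

theorem hasCompactSupport_of_coord {f : EuclideanSpace ℝ κ → ℂ}
    (h : ∀ x i, 1 / 2 ≤ |x i| → f x = 0) : HasCompactSupport f := by
  refine HasCompactSupport.intro
    ((isCompact_univ_pi fun _ : κ => isCompact_Icc (a := -(1 / 2 : ℝ)) (b := 1 / 2)).image
      (PiLp.continuous_toLp 2 fun _ : κ => ℝ)) fun x hx => ?_
  by_contra h0
  refine hx ⟨x.ofLp, fun i _ => ?_, rfl⟩
  by_contra hi
  refine h0 (h x i ?_)
  rw [Set.mem_Icc, ← abs_le, not_le] at hi
  exact hi.le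

variable (κ) in
/-- The function `∏ bump (x i)` on Euclidean space. -/
noncomputable def bumpS : 𝓢(EuclideanSpace ℝ κ, ℂ) :=
  HasCompactSupport.toSchwartzMap (f := fun x : EuclideanSpace ℝ κ => ((∏ i, bump (x i) : ℝ) : ℂ))
    (hasCompactSupport_of_coord fun x i hi => by
      rw [Finset.prod_eq_zero (Finset.mem_univ i) (bump_eq_zero (by linarith)), Complex.ofReal_zero])
    (Complex.ofRealCLM.contDiff.comp (contDiff_prod fun i _ => contDiff_bump.comp (by fun_prop)))

variable (κ) in
/-- The function `∏ plateau (x i)` on Euclidean space. -/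
noncomputable def plateauS : 𝓢(EuclideanSpace ℝ κ, ℂ) :=
  HasCompactSupport.toSchwartzMap (f := fun x : EuclideanSpace ℝ κ => ((∏ i, plateau (x i) : ℝ) : ℂ))
    (hasCompactSupport_of_coord fun x i hi => by
      rw [Finset.prod_eq_zero (Finset.mem_univ i) (plateau_eq_zero hi), Complex.ofReal_zero])
    (Complex.ofRealCLM.contDiff.comp (contDiff_prod fun i _ => contDiff_plateau.comp (by fun_prop)))

theorem bumpS_apply (x : EuclideanSpace ℝ κ) : bumpS κ x = ((∏ i, bump (x i) : ℝ) : ℂ) := rfl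

theorem plateauS_apply (x : EuclideanSpace ℝ κ) :
    plateauS κ x = ((∏ i, plateau (x i) : ℝ) : ℂ) := rfl

end Cutoff

/-! ### Fourier series of localized Schwartz functions -/

section FourierSeries

variable {κ : Type} [Fintype κ]

/-- An integer vector as a point of Euclidean space. -/
noncomputable def intVec (m : κ → ℤ) : EuclideanSpace ℝ κ := WithLp.toLp 2 fun i => (m i : ℝ)

/-- The exponential `e^{2πi⟨m, x⟩}`. -/
noncomputable def expVec (m : κ → ℤ) (x : EuclideanSpace ℝ κ) : ℂ :=
  Complex.exp (2 * Real.pi * Complex.I * ((inner ℝ x (intVec m) : ℝ) : ℂ))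

theorem mFourier_coe (m : κ → ℤ) (x : EuclideanSpace ℝ κ) :
    UnitAddTorus.mFourier m (fun i => (x i : UnitAddCircle)) = expVec m x := by
  simp only [UnitAddTorus.mFourier, ContinuousMap.coe_mk, fourier_coe_apply]
  rw [← Complex.exp_sum, expVec]
  congr 1
  simp only [intVec, PiLp.inner_apply, RCLike.inner_apply, conj_trivial, Complex.ofReal_sum,
    Finset.mul_sum]
  refine Finset.sum_congr rfl fun i _ => ?_
  push_cast
  ring

theorem liftIco_coe_of_abs_le {B : Type*} {f : ℝ → B} (hf : f (-(1 / 2)) = f (1 / 2)) {y : ℝ}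
    (hy : |y| ≤ 1 / 2) : AddCircle.liftIco (1 : ℝ) (-(1 / 2)) f (y : UnitAddCircle) = f y := by
  obtain ⟨h1, h2⟩ := abs_le.1 hy
  rcases h2.lt_or_eq with h | rfl
  · exact AddCircle.liftIco_coe_apply ⟨h1, by linarith⟩
  · have : ((1 / 2 : ℝ) : UnitAddCircle) = ((-(1 / 2) : ℝ) : UnitAddCircle) := by
      rw [← AddCircle.coe_add_period (1 : ℝ) (-(1 / 2))]
      norm_num
    rw [this, AddCircle.liftIco_coe_apply ⟨le_rfl, by norm_num⟩, hf]

theorem continuous_liftIco_of_eq {B : Type*} [TopologicalSpace B] {f : ℝ → B}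
    (hf : f (-(1 / 2)) = f (1 / 2)) (hc : Continuous f) :
    Continuous (AddCircle.liftIco (1 : ℝ) (-(1 / 2)) f) :=
  AddCircle.liftIco_continuous (by rw [hf]; norm_num) hc.continuousOn

/-- The plateau is one wherever the bump is nonzero. It can thus be inserted in a Fourier series of
the localized function to make the single terms Schwartz functions. -/
theorem bumpS_mul_plateauS (x : EuclideanSpace ℝ κ) : bumpS κ x * plateauS κ x = bumpS κ x := by
  rw [bumpS_apply, plateauS_apply]
  by_cases h : ∃ i, 1 / 4 ≤ |x i|
  · obtain ⟨i, hi⟩ := h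
    rw [Finset.prod_eq_zero (Finset.mem_univ i) (bump_eq_zero hi), Complex.ofReal_zero, zero_mul]
  · push Not at h
    rw [Finset.prod_eq_one fun i _ => plateau_eq_one (h i).le, Complex.ofReal_one, mul_one]

/-- The periodization of `bumpS * H`. -/
theorem exists_periodization (H : 𝓢(EuclideanSpace ℝ κ, ℂ)) : ∃ F : C(UnitAddTorus κ, ℂ),
    ∀ x : κ → ℝ, (∀ i, |x i| ≤ 1 / 2) →
      F (fun i => (x i : UnitAddCircle)) = bumpS κ (WithLp.toLp 2 x) * H (WithLp.toLp 2 x) := by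
  have hb : bump (-(1 / 2)) = bump (1 / 2) := by
    rw [bump_eq_zero (by norm_num), bump_eq_zero (by norm_num)]
  -- The coordinate `y` itself is not continuous on the circle. Its replacement `y * plateau y` is,
  -- and it agrees with `y` on the support of the bump, so that `H` can be evaluated along it.
  have hp : -(1 / 2) * plateau (-(1 / 2)) = 1 / 2 * plateau (1 / 2) := by
    rw [plateau_eq_zero (by norm_num), plateau_eq_zero (by norm_num)]; norm_num
  have hc := continuous_liftIco_of_eq hb contDiff_bump.continuous
  have hc' := continuous_liftIco_of_eq (f := fun y => y * plateau y) hp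
    (continuous_id.mul contDiff_plateau.continuous)
  refine ⟨⟨fun θ => ((∏ i, AddCircle.liftIco (1 : ℝ) (-(1 / 2)) bump (θ i) : ℝ) : ℂ) *
    H (WithLp.toLp 2 fun i => AddCircle.liftIco (1 : ℝ) (-(1 / 2)) (fun y => y * plateau y) (θ i)),
    ?_⟩, fun x hx => ?_⟩
  · refine Continuous.mul (Complex.continuous_ofReal.comp (continuous_finsetProd _ fun i _ =>
      hc.comp (continuous_apply i))) (H.continuous.comp ((PiLp.continuous_toLp 2 _).comp
      (continuous_pi fun i => hc'.comp (continuous_apply i))))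
  · simp only [ContinuousMap.coe_mk, liftIco_coe_of_abs_le hb (hx _),
      liftIco_coe_of_abs_le (f := fun y => y * plateau y) hp (hx _), bumpS_apply]
    by_cases h : ∃ i, 1 / 4 ≤ |x i|
    · obtain ⟨i, hi⟩ := h
      rw [Finset.prod_eq_zero (Finset.mem_univ i) (bump_eq_zero hi), Complex.ofReal_zero, zero_mul,
        zero_mul]
    · push Not at h
      simp only [plateau_eq_one (h _).le, mul_one]

/-- The support of the bump lies inside one fundamental cube, so the Fourier integral over the whole
space, taken at an integer vector, is the integral over that cube, which is a Fourier coefficient of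
the periodization. -/
theorem fourier_bumpS_mul (H : 𝓢(EuclideanSpace ℝ κ, ℂ)) {F : C(UnitAddTorus κ, ℂ)}
    (hF : ∀ x : κ → ℝ, (∀ i, |x i| ≤ 1 / 2) →
      F (fun i => (x i : UnitAddCircle)) = bumpS κ (WithLp.toLp 2 x) * H (WithLp.toLp 2 x))
    (m : κ → ℤ) : FourierTransform.fourier (smulLeftCLM ℂ (bumpS κ) H) (intVec m) =
      UnitAddTorus.mFourierCoeff F m := by
  rw [UnitAddTorus.mFourierCoeff_eq_integral F m fun _ => -(1 / 2), SchwartzMap.fourier_coe,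
    Real.fourier_eq']
  have h1 : ∀ x : κ → ℝ, UnitAddTorus.mFourier (-m) (fun i => (x i : UnitAddCircle)) =
      Complex.exp (((-2 * Real.pi * inner ℝ (WithLp.toLp 2 x) (intVec m) : ℝ) : ℂ) * Complex.I) := by
    intro x
    have h2 := mFourier_coe (-m) (WithLp.toLp 2 x)
    refine h2.trans ?_
    have h3 : intVec (-m) = -intVec m := by ext i; simp [intVec]
    rw [expVec, h3, inner_neg_right]
    congr 1
    push_cast
    ring
  rw [← (EuclideanSpace.volume_preserving_symm_measurableEquiv_toLp κ).symm.integral_comp']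
  rw [setIntegral_congr_fun (g := fun x : κ → ℝ =>
    Complex.exp (((-2 * Real.pi * inner ℝ (WithLp.toLp 2 x) (intVec m) : ℝ) : ℂ) * Complex.I) •
      (bumpS κ (WithLp.toLp 2 x) * H (WithLp.toLp 2 x)))
    (MeasurableSet.univ_pi' fun i => measurableSet_Ioc), setIntegral_eq_integral_of_forall_compl_eq_zero]
  · refine integral_congr_ae (.of_forall fun x => ?_)
    change _ • (smulLeftCLM ℂ (bumpS κ) H) (WithLp.toLp 2 x) = _
    rw [smulLeftCLM_apply_apply (bumpS κ).hasTemperateGrowth]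
    rfl
  · intro x hx
    simp only [Set.mem_ofPred_eq, not_forall] at hx
    obtain ⟨i, hi⟩ := hx
    have hi' : 1 / 4 ≤ |x i| := by
      by_contra h0
      obtain ⟨h3, h4⟩ := abs_lt.1 (not_le.1 h0)
      exact hi ⟨by linarith, by linarith⟩
    have : bumpS κ (WithLp.toLp 2 x) = 0 := by
      rw [bumpS_apply, Finset.prod_eq_zero (Finset.mem_univ i) (bump_eq_zero hi'),
        Complex.ofReal_zero]
    rw [this, zero_mul, smul_zero]
  · intro x hx
    have hx' : ∀ i, |x i| ≤ 1 / 2 := fun i => abs_le.2 ⟨(hx i).1.le, by linarith [(hx i).2]⟩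
    simp only [h1, hF x hx']

/-- The Fourier series of `bumpS * H`, cut off outside the unit cube. -/
theorem hasSum_fourier_bumpS_mul (H : 𝓢(EuclideanSpace ℝ κ, ℂ))
    (hs : Summable fun m : κ → ℤ => FourierTransform.fourier (smulLeftCLM ℂ (bumpS κ) H) (intVec m))
    (x : EuclideanSpace ℝ κ) :
    HasSum (fun m : κ → ℤ => FourierTransform.fourier (smulLeftCLM ℂ (bumpS κ) H) (intVec m) *
      (expVec m x * plateauS κ x)) (bumpS κ x * H x) := by
  obtain ⟨F, hF⟩ := exists_periodization H
  simp only [fourier_bumpS_mul H hF] at hs ⊢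
  -- Outside the open unit cube the plateau kills every term and the bump kills the sum; inside, the
  -- series is the Fourier series on the torus.
  by_cases h : ∃ i, 1 / 2 ≤ |x i|
  · obtain ⟨i, hi⟩ := h
    have h1 : plateauS κ x = 0 := by
      rw [plateauS_apply, Finset.prod_eq_zero (Finset.mem_univ i) (plateau_eq_zero hi),
        Complex.ofReal_zero]
    rw [← bumpS_mul_plateauS]
    simp only [h1, mul_zero, zero_mul]
    exact hasSum_zero
  · push Not at h
    have h1 := (UnitAddTorus.hasSum_mFourier_series_apply_of_summable hs
      (fun i => (x i : UnitAddCircle))).mul_right (plateauS κ x)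
    rw [hF _ fun i => (h i).le, mul_right_comm] at h1
    simpa only [mFourier_coe, smul_eq_mul, mul_assoc, bumpS_mul_plateauS] using! h1

end FourierSeries

end SchattenSymbol

namespace SchattenSymbol

/-! ### Expansion of Schwartz functions into localized exponentials -/

section Expansion

variable {κ : Type} [Fintype κ]

theorem norm_comp_le_of_injective {κ' : Type} [Fintype κ'] {f : κ' → κ}
    (hf : Function.Injective f) (m : κ → ℤ) : ‖intVec (m ∘ f)‖ ≤ ‖intVec m‖ := by
  rw [EuclideanSpace.norm_eq, EuclideanSpace.norm_eq]
  refine Real.sqrt_le_sqrt ?_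
  have h : ∑ i, ‖(intVec (m ∘ f)) i‖ ^ 2 =
      ∑ i ∈ Finset.univ.map ⟨f, hf⟩, ‖(intVec m) i‖ ^ 2 := by
    rw [Finset.sum_map]; rfl
  rw [h]
  exact Finset.sum_le_sum_of_subset_of_nonneg (Finset.subset_univ _) fun _ _ _ => by positivity

/-- The integer vectors form a lattice, over which `‖m‖^{-M}` is summable as soon as `M` exceeds the
rank. -/
theorem exists_summable_intVec (κ : Type) [Fintype κ] :
    ∃ M : ℕ, Summable fun m : κ → ℤ => ((1 + ‖intVec m‖) ^ M)⁻¹ := by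
  classical
  let b := (EuclideanSpace.basisFun κ ℝ).toBasis
  let L := Submodule.span ℤ (Set.range b)
  obtain ⟨M, hM⟩ := exists_nat_gt (Module.finrank ℤ L : ℝ)
  have h1 := ZLattice.summable_norm_rpow L (-(M : ℝ)) (by linarith)
  have hmem : ∀ m : κ → ℤ, intVec m ∈ L := fun m => by
    have : intVec m = ∑ i, m i • b i := by
      ext j
      simp [b, intVec, Pi.single_apply]
    rw [this]
    exact Submodule.sum_mem _ fun i _ => Submodule.smul_mem _ _ (Submodule.subset_span ⟨i, rfl⟩)
  have hinj : Function.Injective fun m : κ → ℤ => (⟨intVec m, hmem m⟩ : L) := by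
    intro m m' h
    have h2 : intVec m = intVec m' := congrArg Subtype.val h
    funext i
    have h3 := congrArg (fun x : EuclideanSpace ℝ κ => x i) h2
    simpa [intVec] using h3
  have h2 := h1.comp_injective hinj
  refine ⟨M, Summable.of_norm_bounded_eventually h2 ?_⟩
  -- The comparison with `‖m‖^{-M}` is made off the origin only; a single term does not affect
  -- summability.
  refine (Set.finite_singleton (0 : κ → ℤ)).subset fun m hm => ?_
  by_contra h0
  refine hm ?_
  have h3 : intVec m ≠ 0 := fun h => h0 (hinj (Subtype.ext (by
    change intVec m = intVec 0
    rw [h]; ext i; simp [intVec])))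
  have h4 : 0 < ‖intVec m‖ := norm_pos_iff.2 h3
  change ‖((1 + ‖intVec m‖) ^ M)⁻¹‖ ≤ ‖intVec m‖ ^ (-(M : ℝ))
  rw [Real.norm_of_nonneg (by positivity), Real.rpow_neg h4.le, Real.rpow_natCast]
  gcongr
  linarith

/-- Multiplication by `e^{2πi⟨a, x⟩}` on Schwartz functions, as conjugation of a translation by the
Fourier transform. -/
noncomputable def modulate (a : EuclideanSpace ℝ κ) (f : 𝓢(EuclideanSpace ℝ κ, ℂ)) :
    𝓢(EuclideanSpace ℝ κ, ℂ) :=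
  FourierTransform.fourierInv (compSubConstCLM ℂ a (FourierTransform.fourier f))

theorem modulate_apply (m : κ → ℤ) (f : 𝓢(EuclideanSpace ℝ κ, ℂ)) (x : EuclideanSpace ℝ κ) :
    modulate (intVec m) f x = expVec m x * f x := by
  have h : f = FourierTransform.fourierInv (FourierTransform.fourier f) :=
    (FourierTransform.fourierInv_fourier_eq f).symm
  conv_rhs => rw [h]
  rw [modulate, SchwartzMap.fourierInv_coe, SchwartzMap.fourierInv_coe, Real.fourierInv_eq',
    Real.fourierInv_eq', ← integral_const_mul]
  refine Eq.trans ?_ (integral_sub_right_eq_self (fun v => expVec m x *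
    (Complex.exp (((2 * Real.pi * inner ℝ v x : ℝ) : ℂ) * Complex.I) •
      (FourierTransform.fourier f : EuclideanSpace ℝ κ → ℂ) v)) (intVec m))
  refine integral_congr_ae (.of_forall fun v => ?_)
  simp only [compSubConstCLM_apply, smul_eq_mul, expVec, ← mul_assoc]
  rw [← Complex.exp_add, inner_sub_left, real_inner_comm x (intVec m)]
  congr 2
  push_cast
  ring

/-- A modulation is a translation on the Fourier side. The inverse Fourier transform is continuous,
and translations cost only a power of `1 + ‖a‖`. -/
theorem exists_schwartzNorm_modulate_le (N : ℕ) (f : 𝓢(EuclideanSpace ℝ κ, ℂ)) :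
    ∃ (M : ℕ) (C : ℝ), 0 ≤ C ∧ ∀ a, schwartzNorm N (modulate a f) ≤ C * (1 + ‖a‖) ^ M := by
  obtain ⟨M, C, hC, h⟩ := schwartzNorm_comp_le
    (FourierTransform.fourierCLE ℂ 𝓢(EuclideanSpace ℝ κ, ℂ)).symm.toContinuousLinearMap N
  refine ⟨M, C * (2 ^ M * schwartzNorm M (FourierTransform.fourier f)), by positivity, fun a => ?_⟩
  refine (h _).trans ?_
  have := schwartzNorm_compSubConst_le M a (FourierTransform.fourier f)
  calc _ ≤ C * (2 ^ M * (1 + ‖a‖) ^ M * schwartzNorm M (FourierTransform.fourier f)) := by gcongr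
    _ = _ := by ring

/-- The lattice point `k / 4`. -/
noncomputable def shift (k : κ → ℤ) : EuclideanSpace ℝ κ := (1 / 4 : ℝ) • intVec k

theorem norm_shift (k : κ → ℤ) : ‖shift k‖ = 1 / 4 * ‖intVec k‖ := by
  rw [shift, norm_smul]; norm_num

/-- The building blocks `e^{2πi⟨m, x - k / 4⟩} plateau(x - k / 4)`. -/
noncomputable def atom (j : (κ → ℤ) × (κ → ℤ)) : 𝓢(EuclideanSpace ℝ κ, ℂ) :=
  compSubConstCLM ℂ (shift j.1) (modulate (intVec j.2) (plateauS κ))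

theorem atom_apply (j : (κ → ℤ) × (κ → ℤ)) (x : EuclideanSpace ℝ κ) :
    atom j x = expVec j.2 (x - shift j.1) * plateauS κ (x - shift j.1) := by
  rw [atom, compSubConstCLM_apply, modulate_apply]

/-- The coefficients of a Schwartz function with respect to the functions `atom j`. -/
noncomputable def atomCoeff (j : (κ → ℤ) × (κ → ℤ)) (G : 𝓢(EuclideanSpace ℝ κ, ℂ)) : ℂ :=
  FourierTransform.fourier (smulLeftCLM ℂ (bumpS κ) (compSubConstCLM ℂ (-shift j.1) G)) (intVec j.2)

/-- A weight on the index set of the functions `atom j`. -/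
noncomputable def atomWeight (j : (κ → ℤ) × (κ → ℤ)) : ℝ :=
  (1 + ‖intVec j.1‖) * (1 + ‖intVec j.2‖)

theorem one_le_atomWeight (j : (κ → ℤ) × (κ → ℤ)) : 1 ≤ atomWeight j :=
  one_le_mul_of_one_le_of_one_le (by linarith [norm_nonneg (intVec j.1)])
    (by linarith [norm_nonneg (intVec j.2)])

theorem exists_summable_atomWeight (κ : Type) [Fintype κ] :
    ∃ M : ℕ, Summable fun j : (κ → ℤ) × (κ → ℤ) => (atomWeight j ^ M)⁻¹ := by
  obtain ⟨M, h⟩ := exists_summable_intVec κ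
  refine ⟨M, (h.mul_of_nonneg h (fun _ => by positivity) fun _ => by positivity).congr fun j => ?_⟩
  rw [atomWeight, mul_pow, mul_inv]

theorem exists_schwartzNorm_atom_le (κ : Type) [Fintype κ] (N : ℕ) :
    ∃ (M : ℕ) (C : ℝ), 0 ≤ C ∧ ∀ j : (κ → ℤ) × (κ → ℤ),
      schwartzNorm N (atom j) ≤ C * atomWeight j ^ M := by
  obtain ⟨M, C, hC, h⟩ := exists_schwartzNorm_modulate_le N (plateauS κ)
  refine ⟨N + M, 2 ^ N * C, by positivity, fun j => ?_⟩
  refine (schwartzNorm_compSubConst_le N _ _).trans ?_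
  have h1 : (1 + ‖shift j.1‖) ^ N ≤ atomWeight j ^ N := by
    gcongr
    rw [norm_shift, atomWeight]
    nlinarith [norm_nonneg (intVec j.1), norm_nonneg (intVec j.2),
      mul_nonneg (norm_nonneg (intVec j.1)) (norm_nonneg (intVec j.2))]
  have h2 : (1 + ‖intVec j.2‖) ^ M ≤ atomWeight j ^ M := by
    gcongr
    rw [atomWeight]
    nlinarith [norm_nonneg (intVec j.1), norm_nonneg (intVec j.2),
      mul_nonneg (norm_nonneg (intVec j.1)) (norm_nonneg (intVec j.2))]
  have h3 := one_le_atomWeight j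
  calc _ ≤ 2 ^ N * atomWeight j ^ N * (C * atomWeight j ^ M) := by
        gcongr
        exact (h _).trans (by gcongr)
    _ = _ := by rw [pow_add]; ring

/-- Decay in the frequency `j.2` comes from the weights in the Schwartz norm of the Fourier
transform, decay in the cell `j.1` from `exists_schwartzNorm_cutoff_le`. -/
theorem exists_norm_atomCoeff_le (κ : Type) [Fintype κ] (M : ℕ) :
    ∃ (N : ℕ) (C : ℝ), 0 ≤ C ∧ ∀ (j : (κ → ℤ) × (κ → ℤ)) (G : 𝓢(EuclideanSpace ℝ κ, ℂ)),
      atomWeight j ^ M * ‖atomCoeff j G‖ ≤ C * schwartzNorm N G := by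
  obtain ⟨N, C, hC, h⟩ := schwartzNorm_comp_le
    (FourierTransform.fourierCLM ℂ 𝓢(EuclideanSpace ℝ κ, ℂ)) M
  obtain ⟨C', hC', h'⟩ := exists_schwartzNorm_cutoff_le (bumpS κ) N M
  refine ⟨N + M, 4 ^ M * (2 ^ M * (C * C')), by positivity, fun j G => ?_⟩
  set f := smulLeftCLM ℂ (bumpS κ) (compSubConstCLM ℂ (-shift j.1) G) with hf
  have h1 := le_schwartzNorm (N := M) (k := M) (n := 0) le_rfl (Nat.zero_le _)
    (FourierTransform.fourier f) (intVec j.2)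
  rw [norm_iteratedFDeriv_zero] at h1
  have h2 : schwartzNorm M (FourierTransform.fourier f) ≤ C * schwartzNorm N f := h f
  have h3 := h' (shift j.1) G
  -- The lattice has spacing `1 / 4`, whence the factor `4`.
  have h4 : 1 + ‖intVec j.1‖ ≤ 4 * (1 + ‖shift j.1‖) := by rw [norm_shift]; linarith
  calc atomWeight j ^ M * ‖atomCoeff j G‖
      = (1 + ‖intVec j.1‖) ^ M * ((1 + ‖intVec j.2‖) ^ M * ‖atomCoeff j G‖) := by
        rw [atomWeight, mul_pow, mul_assoc]
    _ ≤ (4 * (1 + ‖shift j.1‖)) ^ M * (2 ^ M * (C * schwartzNorm N f)) := by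
        refine mul_le_mul (by gcongr) (h1.trans (by gcongr)) (by positivity) (by positivity)
    _ = 4 ^ M * 2 ^ M * C * ((1 + ‖shift j.1‖) ^ M * schwartzNorm N f) := by rw [mul_pow]; ring
    _ ≤ 4 ^ M * 2 ^ M * C * (C' * schwartzNorm (N + M) G) := by gcongr
    _ = _ := by ring

/-- Summability of the coefficients against any power of the weight. -/
theorem exists_tsum_atomCoeff_le (κ : Type) [Fintype κ] (M : ℕ) :
    ∃ (N : ℕ) (C : ℝ), 0 ≤ C ∧ ∀ G : 𝓢(EuclideanSpace ℝ κ, ℂ),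
      Summable (fun j : (κ → ℤ) × (κ → ℤ) => ‖atomCoeff j G‖ * atomWeight j ^ M) ∧
      ∑' j : (κ → ℤ) × (κ → ℤ), ‖atomCoeff j G‖ * atomWeight j ^ M ≤ C * schwartzNorm N G := by
  obtain ⟨M', hM'⟩ := exists_summable_atomWeight κ
  obtain ⟨N, C, hC, h⟩ := exists_norm_atomCoeff_le κ (M + M')
  have hw : ∀ j : (κ → ℤ) × (κ → ℤ), 0 < atomWeight j := fun j =>
    zero_lt_one.trans_le (one_le_atomWeight j)
  have key : ∀ (G : 𝓢(EuclideanSpace ℝ κ, ℂ)) (j : (κ → ℤ) × (κ → ℤ)),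
      ‖atomCoeff j G‖ * atomWeight j ^ M ≤ C * schwartzNorm N G * (atomWeight j ^ M')⁻¹ := by
    intro G j
    rw [← div_eq_mul_inv, le_div_iff₀ (pow_pos (hw j) _)]
    refine le_trans (le_of_eq ?_) (h j G)
    rw [pow_add]; ring
  refine ⟨N, C * ∑' j : (κ → ℤ) × (κ → ℤ), (atomWeight j ^ M')⁻¹,
    mul_nonneg hC (tsum_nonneg fun j => by have := hw j; positivity), fun G => ?_⟩
  have hs := (hM'.mul_left (C * schwartzNorm N G)).of_nonneg_of_le
    (fun j => by have := hw j; positivity) (key G)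
  refine ⟨hs, (hs.tsum_le_tsum (key G) (hM'.mul_left _)).trans (le_of_eq ?_)⟩
  rw [tsum_mul_left]; ring

/-- For a fixed cell the sum over frequencies is the Fourier series of a translate of `G` times the
bump, and the sum over cells is the partition of unity. Absolute convergence in every seminorm
reduces the claim to this pointwise computation. -/
theorem hasSum_atom (G : 𝓢(EuclideanSpace ℝ κ, ℂ)) :
    HasSum (fun j : (κ → ℤ) × (κ → ℤ) => atomCoeff j G • atom j) G := by
  have hs : ∀ k n, Summable fun j : (κ → ℤ) × (κ → ℤ) =>
      SchwartzMap.seminorm ℝ k n (atomCoeff j G • atom j) := by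
    intro k n
    obtain ⟨M, C, hC, h⟩ := exists_schwartzNorm_atom_le κ (max k n)
    obtain ⟨N, C', hC', h'⟩ := exists_tsum_atomCoeff_le κ M
    refine ((h' G).1.mul_left C).of_nonneg_of_le (fun _ => apply_nonneg _ _) fun j => ?_
    refine (seminorm_le_schwartzNorm (le_max_left k n) (le_max_right k n) _).trans ?_
    rw [map_smul_eq_mul]
    calc _ ≤ ‖atomCoeff j G‖ * (C * atomWeight j ^ M) := by gcongr; exact h j
      _ = _ := by ring
  refine hasSum_of_summable_seminorm hs fun x => ?_
  have h1 := summable_apply_of_summable_seminorm hs x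
  have h2 : ∀ k : κ → ℤ, HasSum (fun m : κ → ℤ => (atomCoeff (k, m) G • atom (k, m)) x)
      (bumpS κ (x - shift k) * G x) := by
    intro k
    obtain ⟨N, C', hC', h'⟩ := exists_tsum_atomCoeff_le κ 0
    have h3 : Summable fun m : κ → ℤ => atomCoeff (k, m) G := by
      have := (h' G).1
      simp only [pow_zero, mul_one] at this
      exact this.of_norm.prod_factor k
    have h4 := hasSum_fourier_bumpS_mul (compSubConstCLM ℂ (-shift k) G) h3 (x - shift k)
    rw [compSubConstCLM_apply, sub_neg_eq_add, sub_add_cancel] at h4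
    convert! h4 using 2 with m
    rw [smul_apply, atom_apply, smul_eq_mul, atomCoeff]
  have h5 := h1.hasSum.prod_fiberwise h2
  have h6 : HasSum (fun k : κ → ℤ => bumpS κ (x - shift k) * G x) (1 * G x) := by
    refine HasSum.mul_right _ ?_
    have := (Complex.ofRealCLM.hasSum (hasSum_prod_bump x.ofLp))
    simp only [Complex.ofRealCLM_apply, Complex.ofReal_one] at this
    convert! this using 2 with k
    rw [bumpS_apply]
    simp [shift, intVec, div_eq_inv_mul]
  rw [one_mul] at h6
  rw [← h5.unique h6]
  exact h1.hasSum

end Expansion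

end SchattenSymbol

namespace SchattenSymbol

/-! ### Expansion into tensor products -/

section TensorExpansion

variable {d : ℕ}

/-- The index set of the tensor expansion of a Schwartz function on `ℝ²ᵈ`. -/
abbrev TensorIndex (d : ℕ) : Type := (Fin d ⊕ Fin d → ℤ) × (Fin d ⊕ Fin d → ℤ)

/-- The first factors of the tensor expansion. -/
noncomputable def leftAtom (j : TensorIndex d) : 𝓢(Rd d, ℂ) := atom (j.1 ∘ Sum.inl, j.2 ∘ Sum.inl)

/-- The second factors of the tensor expansion. -/
noncomputable def rightAtom (j : TensorIndex d) : 𝓢(Rd d, ℂ) := atom (j.1 ∘ Sum.inr, j.2 ∘ Sum.inr)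

/-- The coefficients of the tensor expansion. -/
noncomputable def tensorCoeff (j : TensorIndex d) (G : 𝓢(Rd d × Rd d, ℂ)) : ℂ :=
  atomCoeff j (compCLMOfContinuousLinearEquiv ℂ EuclideanSpace.sumEquivProd G)

/-- Exponentials and plateaus are products over coordinates, so they split along the two halves of
the coordinates of `ℝ²ᵈ`. -/
theorem tensor_atom (j : TensorIndex d) : tensor (leftAtom j) (rightAtom j) =
    compCLMOfContinuousLinearEquiv ℂ EuclideanSpace.sumEquivProd.symm (atom j) := by
  ext ⟨x, y⟩
  rw [tensor_apply, compCLMOfContinuousLinearEquiv_apply, Function.comp_apply, leftAtom, rightAtom,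
    atom_apply, atom_apply, atom_apply, plateauS_apply, plateauS_apply, plateauS_apply]
  have h : ∀ m : Fin d ⊕ Fin d → ℤ, ∀ z : EuclideanSpace ℝ (Fin d ⊕ Fin d), expVec m z =
      expVec (m ∘ Sum.inl) (WithLp.toLp 2 fun i => z (Sum.inl i)) *
      expVec (m ∘ Sum.inr) (WithLp.toLp 2 fun i => z (Sum.inr i)) := by
    intro m z
    rw [expVec, expVec, expVec, ← Complex.exp_add, ← mul_add, ← Complex.ofReal_add]
    simp [PiLp.inner_apply, Fintype.sum_sum_type, intVec]
  rw [h, Fintype.prod_sum_type, Complex.ofReal_mul, mul_mul_mul_comm]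
  congr 1

theorem hasSum_tensor (G : 𝓢(Rd d × Rd d, ℂ)) :
    HasSum (fun j => tensorCoeff j G • tensor (leftAtom j) (rightAtom j)) G := by
  let T := compCLMOfContinuousLinearEquiv (F := ℂ) ℂ
    (EuclideanSpace.sumEquivProd (𝕜 := ℝ) (ι := Fin d) (κ := Fin d)).symm
  have h := (hasSum_atom (compCLMOfContinuousLinearEquiv ℂ EuclideanSpace.sumEquivProd G)).map T
    T.continuous
  convert! h using 1
  · funext j
    rw [Function.comp_apply, map_smul, tensor_atom]
    rfl

/-- The tensor expansion converges absolutely in all seminorms. -/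
theorem exists_tsum_tensorCoeff_le {p q : Seminorm ℂ 𝓢(Rd d, ℂ)} (hp : Continuous p)
    (hq : Continuous q) : ∃ r : Seminorm ℂ 𝓢(Rd d × Rd d, ℂ), Continuous r ∧ ∀ G,
      Summable (fun j => ‖tensorCoeff j G‖ * (p (leftAtom j) * q (rightAtom j))) ∧
      ∑' j, ‖tensorCoeff j G‖ * (p (leftAtom j) * q (rightAtom j)) ≤ r G := by
  have hbd : ∀ {p : Seminorm ℂ 𝓢(Rd d, ℂ)}, Continuous p → ∀ f : Fin d → Fin d ⊕ Fin d,
      Function.Injective f → ∃ (M : ℕ) (C : ℝ), 0 ≤ C ∧ ∀ j : TensorIndex d,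
        p (atom (j.1 ∘ f, j.2 ∘ f)) ≤ C * atomWeight j ^ M := by
    intro p hp f hf
    obtain ⟨N, C, hC, h⟩ := exists_le_schwartzNorm hp
    obtain ⟨M, C', hC', h'⟩ := exists_schwartzNorm_atom_le (Fin d) N
    refine ⟨M, C * C', by positivity, fun j => ?_⟩
    -- Dropping coordinates only shortens integer vectors, so both factors are controlled by the
    -- weight of the full index.
    have h1 : atomWeight (j.1 ∘ f, j.2 ∘ f) ≤ atomWeight j := by
      rw [atomWeight, atomWeight]
      gcongr <;> exact norm_comp_le_of_injective hf _
    have h0 := zero_le_one.trans (one_le_atomWeight (j.1 ∘ f, j.2 ∘ f))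
    calc _ ≤ C * (C' * atomWeight (j.1 ∘ f, j.2 ∘ f) ^ M) := (h _).trans (by gcongr; exact h' _)
      _ ≤ C * (C' * atomWeight j ^ M) := by gcongr
      _ = _ := by ring
  obtain ⟨M, C, hC, h⟩ := hbd hp Sum.inl Sum.inl_injective
  obtain ⟨M', C', hC', h'⟩ := hbd hq Sum.inr Sum.inr_injective
  obtain ⟨N, D, hD, hN⟩ := exists_tsum_atomCoeff_le (Fin d ⊕ Fin d) (M + M')
  have key : ∀ (G : 𝓢(Rd d × Rd d, ℂ)) (j : TensorIndex d),
      ‖tensorCoeff j G‖ * (p (leftAtom j) * q (rightAtom j)) ≤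
        C * C' * (‖tensorCoeff j G‖ * atomWeight j ^ (M + M')) := by
    intro G j
    have h0 := zero_le_one.trans (one_le_atomWeight j)
    calc _ ≤ ‖tensorCoeff j G‖ * ((C * atomWeight j ^ M) * (C' * atomWeight j ^ M')) := by
          gcongr
          · exact h j
          · exact h' j
      _ = _ := by rw [pow_add]; ring
  let T := compCLMOfContinuousLinearEquiv (F := ℂ) ℂ
    (EuclideanSpace.sumEquivProd (𝕜 := ℝ) (ι := Fin d) (κ := Fin d))
  let c : NNReal := ⟨C * C' * D, by positivity⟩
  refine ⟨c • (schwartzNorm N).comp T.toLinearMap,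
    ((continuous_schwartzNorm N).comp T.continuous).const_smul c, fun G => ?_⟩
  obtain ⟨hs, ht⟩ := hN (T G)
  have hs' := (hs.mul_left (C * C')).of_nonneg_of_le
    (fun j => mul_nonneg (norm_nonneg _) (mul_nonneg (apply_nonneg _ _) (apply_nonneg _ _))) (key G)
  refine ⟨hs', (hs'.tsum_le_tsum (key G) (hs.mul_left _)).trans ?_⟩
  rw [tsum_mul_left]
  calc _ ≤ C * C' * (D * schwartzNorm N (T G)) := by gcongr; exact ht
    _ = C * C' * D * schwartzNorm N (T G) := by ring

/-- A tempered distribution on `ℝ²ᵈ` is determined by its values at tensors. -/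
theorem distribution_ext_tensor {K K' : 𝓢'(Rd d × Rd d, ℂ)}
    (h : ∀ ψ φ : 𝓢(Rd d, ℂ), K (tensor ψ φ) = K' (tensor ψ φ)) : K = K' := by
  ext G
  have h1 := (hasSum_tensor G).map K K.continuous
  have h2 := (hasSum_tensor G).map K' K'.continuous
  simp only [Function.comp_def, map_smul, h] at h1 h2
  exact h1.unique h2

end TensorExpansion

end SchattenSymbol

namespace SchattenSymbol

/-! ### Schatten norms through finite orthonormal families -/

section SchattenTheory

variable {H₁ : Type*} [NormedAddCommGroup H₁] [InnerProductSpace ℂ H₁]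
  {H₂ : Type*} [NormedAddCommGroup H₂] [InnerProductSpace ℂ H₂]

theorem eLpNorm_count_eq {α : Type*} [MeasurableSpace α] [MeasurableSingletonClass α] {p : ℝ≥0∞}
    (h1 : 1 ≤ p) (hp : p ≠ ⊤) (x : α → ℂ) :
    eLpNorm x p Measure.count = (∑' i, ‖x i‖ₑ ^ p.toReal) ^ (1 / p.toReal) := by
  rw [eLpNorm_eq_lintegral_rpow_enorm_toReal (zero_lt_one.trans_le h1).ne' hp, lintegral_count]

theorem eLpNorm_top_count_eq {α : Type*} [MeasurableSpace α] [MeasurableSingletonClass α]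
    (x : α → ℂ) : eLpNorm x ⊤ Measure.count = ⨆ i, ‖x i‖ₑ := by
  rw [eLpNorm_exponent_top, eLpNormEssSup, essSup_count]

theorem one_le_toReal {p : ℝ≥0∞} (h1 : 1 ≤ p) (hp : p ≠ ⊤) : 1 ≤ p.toReal :=
  ENNReal.toReal_mono hp h1

/-- A finite type is equivalent to a set of natural numbers. -/
theorem exists_equiv_set_nat (α : Type*) [Finite α] : ∃ J : Set ℕ, Nonempty (J ≃ α) := by
  obtain ⟨n, ⟨e⟩⟩ := Finite.exists_equiv_fin α
  exact ⟨Set.range fun i : Fin n => (i : ℕ),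
    ⟨(Equiv.ofInjective _ Fin.val_injective).symm.trans e.symm⟩⟩

theorem sum_enorm_rpow_le_schattenNorm {p : ℝ≥0∞} (h1 : 1 ≤ p) (hp : p ≠ ⊤) (T : H₁ →L[ℂ] H₂)
    {α : Type*} [Fintype α] {f : α → H₁} {g : α → H₂} (hf : Orthonormal ℂ f)
    (hg : Orthonormal ℂ g) :
    ∑ i, ‖(inner ℂ (g i) (T (f i)) : ℂ)‖ₑ ^ p.toReal ≤ schattenNorm p T ^ p.toReal := by
  obtain ⟨J, ⟨e⟩⟩ := exists_equiv_set_nat α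
  have h0 : 0 < p.toReal := zero_lt_one.trans_le (one_le_toReal h1 hp)
  have h := le_schattenNorm p T (hf.comp e e.injective) (hg.comp e e.injective)
  rw [eLpNorm_count_eq h1 hp, one_div, ENNReal.rpow_inv_le_iff h0] at h
  simp only [Function.comp_apply] at h
  rwa [Equiv.tsum_eq e fun i => ‖(inner ℂ (g i) (T (f i)) : ℂ)‖ₑ ^ p.toReal, tsum_fintype] at h

theorem enorm_inner_le_schattenNorm_top (T : H₁ →L[ℂ] H₂) {f : H₁} {g : H₂} (hf : ‖f‖ = 1)
    (hg : ‖g‖ = 1) : ‖(inner ℂ g (T f) : ℂ)‖ₑ ≤ schattenNorm ⊤ T := by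
  have h := le_schattenNorm ⊤ T (J := {0}) (f := fun _ => f) (g := fun _ => g)
    ⟨fun _ => hf, fun i j hij => (hij (Subsingleton.elim i j)).elim⟩
    ⟨fun _ => hg, fun i j hij => (hij (Subsingleton.elim i j)).elim⟩
  rw [eLpNorm_top_count_eq] at h
  exact (le_iSup (fun _ : ({0} : Set ℕ) => ‖(inner ℂ g (T f) : ℂ)‖ₑ) ⟨0, rfl⟩).trans h

/-- A series of nonnegative terms is the supremum of its finite partial sums, so for finite `p` only
finite families need testing. -/
theorem schattenNorm_le_of_sum {p : ℝ≥0∞} (h1 : 1 ≤ p) (hp : p ≠ ⊤) {T : H₁ →L[ℂ] H₂} {c : ℝ≥0∞}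
    (h : ∀ (α : Type) [Fintype α] (f : α → H₁) (g : α → H₂), Orthonormal ℂ f → Orthonormal ℂ g →
      ∑ i, ‖(inner ℂ (g i) (T (f i)) : ℂ)‖ₑ ^ p.toReal ≤ c ^ p.toReal) :
    schattenNorm p T ≤ c := by
  have h0 : 0 < p.toReal := zero_lt_one.trans_le (one_le_toReal h1 hp)
  refine schattenNorm_le fun J f g hf hg => ?_
  rw [eLpNorm_count_eq h1 hp, one_div, ENNReal.rpow_inv_le_iff h0,
    ENNReal.tsum_eq_iSup_sum]
  refine iSup_le fun s => ?_
  have := h s (fun i => f i) (fun i => g i) (hf.comp _ Subtype.val_injective)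
    (hg.comp _ Subtype.val_injective)
  rwa [Finset.sum_coe_sort s fun i => ‖(inner ℂ (g i) (T (f i)) : ℂ)‖ₑ ^ p.toReal] at this

theorem schattenNorm_top_le {T : H₁ →L[ℂ] H₂} {c : ℝ≥0∞}
    (h : ∀ (f : H₁) (g : H₂), ‖f‖ = 1 → ‖g‖ = 1 → ‖(inner ℂ g (T f) : ℂ)‖ₑ ≤ c) :
    schattenNorm ⊤ T ≤ c := by
  refine schattenNorm_le fun J f g hf hg => ?_
  rw [eLpNorm_top_count_eq]
  exact iSup_le fun i => h _ _ (hf.1 i) (hg.1 i)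

theorem schattenNorm_top_le_opNorm (T : H₁ →L[ℂ] H₂) : schattenNorm ⊤ T ≤ ‖T‖ₑ := by
  refine schattenNorm_top_le fun f g hf hg => ?_
  rw [enorm_le_iff_norm_le]
  refine (norm_inner_le_norm _ _).trans ?_
  rw [hg, one_mul]
  simpa [hf] using T.le_opNorm f

/-- The `ℓᵖ` norm is at most the `ℓ¹` norm: with `S` the sum of the `x i`, one has `x i ^ p ≤ x i *
S ^ (p - 1)`. Estimates are later made in trace norm for this reason, which also covers `p = ∞`. -/
theorem schattenNorm_le_schattenNorm_one {p : ℝ≥0∞} (h1 : 1 ≤ p) (T : H₁ →L[ℂ] H₂) :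
    schattenNorm p T ≤ schattenNorm 1 T := by
  have hone : ∀ (α : Type) [Fintype α] (f : α → H₁) (g : α → H₂), Orthonormal ℂ f →
      Orthonormal ℂ g → ∑ i, ‖(inner ℂ (g i) (T (f i)) : ℂ)‖ₑ ≤ schattenNorm 1 T := by
    intro α _ f g hf hg
    simpa using sum_enorm_rpow_le_schattenNorm le_rfl ENNReal.one_ne_top T hf hg
  rcases eq_or_ne p ⊤ with rfl | hp
  · refine schattenNorm_top_le fun f g hf hg => ?_
    simpa using hone Unit (fun _ => f) (fun _ => g)
      ⟨fun _ => hf, fun i j hij => (hij (Subsingleton.elim i j)).elim⟩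
      ⟨fun _ => hg, fun i j hij => (hij (Subsingleton.elim i j)).elim⟩
  · refine schattenNorm_le_of_sum h1 hp fun α _ f g hf hg => ?_
    have hr := one_le_toReal h1 hp
    refine le_trans ?_ (ENNReal.rpow_le_rpow (hone α f g hf hg) (by linarith))
    set x := fun i => ‖(inner ℂ (g i) (T (f i)) : ℂ)‖ₑ
    set S := ∑ i, x i with hS
    have hsplit : ∀ a : ℝ≥0∞, a ^ p.toReal = a * a ^ (p.toReal - 1) := fun a => by
      conv_lhs => rw [show p.toReal = 1 + (p.toReal - 1) by ring]
      rw [ENNReal.rpow_add_of_nonneg _ _ zero_le_one (by linarith), ENNReal.rpow_one]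
    calc ∑ i, x i ^ p.toReal = ∑ i, x i * x i ^ (p.toReal - 1) :=
          Finset.sum_congr rfl fun i _ => hsplit _
      _ ≤ ∑ i, x i * S ^ (p.toReal - 1) := by
          gcongr with i
          exact Finset.single_le_sum (f := x) (fun _ _ => bot_le) (Finset.mem_univ i)
      _ = S ^ p.toReal := by rw [← Finset.sum_mul, ← hS, ← hsplit]

/-- Hölder's inequality for the diagonal elements of two operators. -/
theorem sum_mul_le_schattenNorm_mul {p q : ℝ≥0∞} (h1 : 1 ≤ p) (hq1 : 1 ≤ q) (hp : p ≠ ⊤)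
    (hpq : ENNReal.HolderConjugate p q) (T A : H₁ →L[ℂ] H₂) {α : Type*} [Fintype α]
    {f f' : α → H₁} {g : α → H₂} (hf : Orthonormal ℂ f) (hf' : Orthonormal ℂ f')
    (hg : Orthonormal ℂ g) :
    ∑ i, ‖(inner ℂ (g i) (T (f i)) : ℂ)‖ₑ * ‖(inner ℂ (g i) (A (f' i)) : ℂ)‖ₑ ≤
      schattenNorm p T * schattenNorm q A := by
  rcases eq_or_ne q ⊤ with rfl | hq
  · have hp1 : p = 1 := (ENNReal.HolderConjugate.eq_top_iff_eq_one ⊤ p).1 rfl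
    subst hp1
    calc _ ≤ ∑ i, ‖(inner ℂ (g i) (T (f i)) : ℂ)‖ₑ * schattenNorm ⊤ A := by
          gcongr with i
          exact enorm_inner_le_schattenNorm_top A (hf'.1 i) (hg.1 i)
      _ = (∑ i, ‖(inner ℂ (g i) (T (f i)) : ℂ)‖ₑ) * schattenNorm ⊤ A := (Finset.sum_mul ..).symm
      _ ≤ _ := by
          gcongr
          simpa using sum_enorm_rpow_le_schattenNorm le_rfl ENNReal.one_ne_top T hf hg
  · have hc := ENNReal.HolderConjugate.toReal_of_ne_top (p := p) (q := q) hp hq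
    refine (ENNReal.inner_le_Lp_mul_Lq _ _ _ hc).trans ?_
    gcongr
    · rw [one_div, ENNReal.rpow_inv_le_iff (zero_lt_one.trans_le (one_le_toReal h1 hp))]
      exact sum_enorm_rpow_le_schattenNorm h1 hp T hf hg
    · rw [one_div, ENNReal.rpow_inv_le_iff (zero_lt_one.trans_le (one_le_toReal hq1 hq))]
      exact sum_enorm_rpow_le_schattenNorm hq1 hq A hf' hg

theorem sum_enorm_mul_le_one {γ : Type*} [Fintype γ] (a b : γ → ℂ) (ha : ∑ i, ‖a i‖ ^ 2 ≤ 1)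
    (hb : ∑ i, ‖b i‖ ^ 2 ≤ 1) : ∑ i, ‖a i * b i‖ₑ ≤ 1 := by
  have h1 : ∑ i, ‖a i * b i‖ ≤ 1 := by
    have h2 : ∑ i, ‖a i * b i‖ ≤ ∑ i, (‖a i‖ ^ 2 + ‖b i‖ ^ 2) / 2 :=
      Finset.sum_le_sum fun i _ => by rw [norm_mul]; nlinarith [sq_nonneg (‖a i‖ - ‖b i‖)]
    rw [← Finset.sum_div, Finset.sum_add_distrib] at h2
    linarith
  simp only [← ofReal_norm]
  rw [← ENNReal.ofReal_sum_of_nonneg fun _ _ => norm_nonneg _]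
  exact ENNReal.ofReal_le_one.2 h1

theorem sum_norm_inner_sq_le_one {H : Type*} [NormedAddCommGroup H] [InnerProductSpace ℂ H]
    {α : Type*} [Fintype α] {f : α → H} (hf : Orthonormal ℂ f) {x : H} (hx : ‖x‖ = 1) :
    ∑ i, ‖(inner ℂ (f i) x : ℂ)‖ ^ 2 ≤ 1 := by
  simpa [hx] using hf.sum_inner_products_le (s := Finset.univ) x

/-- Schur's test for a diagonal operator seen in other orthonormal families. -/
theorem sum_enorm_rpow_le_of_diagonal {r : ℝ} (hr : 1 ≤ r) {α β : Type*} [Fintype α] [Fintype β]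
    {u : α → H₁} {v : α → H₂} {f : β → H₁} {g : β → H₂} (hu : Orthonormal ℂ u)
    (hv : Orthonormal ℂ v) (hf : Orthonormal ℂ f) (hg : Orthonormal ℂ g) (c : β → ℂ) :
    ∑ i, ‖∑ k, c k * (inner ℂ (f k) (u i) * inner ℂ (v i) (g k))‖ₑ ^ r ≤ ∑ k, ‖c k‖ₑ ^ r := by
  have hr0 : 0 < r := zero_lt_one.trans_le hr
  set w : α → β → ℝ≥0∞ := fun i k => ‖(inner ℂ (f k) (u i) * inner ℂ (v i) (g k) : ℂ)‖ₑ with hw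
  -- Rows and columns of `w` have sum at most one by Bessel's inequality for the two families and
  -- `2ab ≤ a² + b²`.
  have hrow : ∀ i, ∑ k, w i k ≤ 1 := fun i => by
    refine sum_enorm_mul_le_one _ _ (sum_norm_inner_sq_le_one hf (hu.1 i)) ?_
    simp only [norm_inner_symm (v i)]
    exact sum_norm_inner_sq_le_one hg (hv.1 i)
  have hcol : ∀ k, ∑ i, w i k ≤ 1 := fun k => by
    refine sum_enorm_mul_le_one _ _ ?_ (sum_norm_inner_sq_le_one hv (hg.1 k))
    simp only [norm_inner_symm (f k)]
    exact sum_norm_inner_sq_le_one hu (hf.1 k)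
  have hi : ∀ i, ‖∑ k, c k * (inner ℂ (f k) (u i) * inner ℂ (v i) (g k))‖ₑ ^ r ≤
      ∑ k, w i k * ‖c k‖ₑ ^ r := by
    intro i
    have h1 : ‖∑ k, c k * (inner ℂ (f k) (u i) * inner ℂ (v i) (g k))‖ₑ ≤ ∑ k, w i k * ‖c k‖ₑ := by
      refine (enorm_sum_le _ _).trans (Finset.sum_le_sum fun k _ => ?_)
      rw [enorm_mul, mul_comm]
    -- Hölder's inequality with weights of total mass at most one, so the mass factor can be
    -- dropped.
    have h2 := ENNReal.inner_le_weight_mul_Lp_of_nonneg Finset.univ hr (w i) fun k => ‖c k‖ₑ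
    have h3 : (∑ k, w i k) ^ (1 - r⁻¹) ≤ 1 :=
      ENNReal.rpow_le_one (hrow i) (sub_nonneg.2 (inv_le_one_of_one_le₀ hr))
    rw [← ENNReal.le_rpow_inv_iff hr0]
    exact h1.trans (h2.trans (mul_le_of_le_one_left' h3))
  calc _ ≤ ∑ i, ∑ k, w i k * ‖c k‖ₑ ^ r := Finset.sum_le_sum fun i _ => hi i
    _ = ∑ k, (∑ i, w i k) * ‖c k‖ₑ ^ r := by rw [Finset.sum_comm]; simp only [Finset.sum_mul]
    _ ≤ _ := Finset.sum_le_sum fun k _ => mul_le_of_le_one_left' (hcol k)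

end SchattenTheory

end SchattenSymbol

namespace SchattenSymbol

/-! ### Hölder's inequality for the trace and the trace form -/

section Trace

variable {H₁ : Type*} [NormedAddCommGroup H₁] [InnerProductSpace ℂ H₁]
  {H₂ : Type*} [NormedAddCommGroup H₂] [InnerProductSpace ℂ H₂] [CompleteSpace H₂]

/-- The singular value decomposition: the vectors of some orthonormal basis have orthogonal
images. -/
theorem exists_orthonormalBasis_orthogonal_image {E : Type*} [NormedAddCommGroup E]
    [InnerProductSpace ℂ E] [FiniteDimensional ℂ E] (t : E →L[ℂ] H₂) :
    ∃ b : OrthonormalBasis (Fin (Module.finrank ℂ E)) ℂ E,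
      ∀ i j, i ≠ j → (inner ℂ (t (b i)) (t (b j)) : ℂ) = 0 := by
  have := FiniteDimensional.complete ℂ E
  -- An eigenbasis of `t* t` will do: the inner product of `t (b i)` and `t (b j)` is an eigenvalue
  -- times that of `b i` and `b j`.
  have hS : ((ContinuousLinearMap.adjoint t ∘L t : E →L[ℂ] E) : E →ₗ[ℂ] E).IsSymmetric := by
    intro x y
    simp [ContinuousLinearMap.adjoint_inner_left, ContinuousLinearMap.adjoint_inner_right]
  refine ⟨hS.eigenvectorBasis rfl, fun i j hij => ?_⟩
  rw [← ContinuousLinearMap.adjoint_inner_right]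
  have h := hS.apply_eigenvectorBasis rfl j
  simp only [ContinuousLinearMap.coe_coe, ContinuousLinearMap.comp_apply] at h
  rw [h, inner_smul_right, (hS.eigenvectorBasis rfl).orthonormal.2 hij, mul_zero]

/-- The normalized nonzero vectors among pairwise orthogonal ones are orthonormal. -/
theorem orthonormal_normalize {α : Type*} {v : α → H₂}
    (h : ∀ i j, i ≠ j → (inner ℂ (v i) (v j) : ℂ) = 0) :
    Orthonormal ℂ fun i : {i // v i ≠ 0} => ((‖v i‖⁻¹ : ℝ) : ℂ) • v i := by
  refine ⟨fun i => ?_, fun i j hij => ?_⟩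
  · rw [norm_smul, Complex.norm_real, norm_inv, norm_norm,
      inv_mul_cancel₀ (norm_ne_zero_iff.2 i.2)]
  · beta_reduce
    rw [inner_smul_left, inner_smul_right, h _ _ fun e => hij (Subtype.ext e), mul_zero, mul_zero]

/-- The isometry of `ℂⁿ` onto the span of an orthonormal family. -/
noncomputable def isometryOfFamily {α : Type*} [Fintype α] {e : α → H₁} (he : Orthonormal ℂ e) :
    EuclideanSpace ℂ α →ₗᵢ[ℂ] H₁ :=
  ((EuclideanSpace.basisFun α ℂ).toBasis.constr ℂ e).isometryOfOrthonormal
    (v := (EuclideanSpace.basisFun α ℂ).toBasis)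
    (by simp)
    (by
      have : (((EuclideanSpace.basisFun α ℂ).toBasis.constr ℂ) e) ∘
          (EuclideanSpace.basisFun α ℂ).toBasis = e :=
        funext fun i => (EuclideanSpace.basisFun α ℂ).toBasis.constr_basis ℂ e i
      rwa [this])

theorem isometryOfFamily_basisFun {α : Type*} [Fintype α] {e : α → H₁} (he : Orthonormal ℂ e)
    (i : α) : isometryOfFamily he (EuclideanSpace.basisFun α ℂ i) = e i := by
  have := (EuclideanSpace.basisFun α ℂ).toBasis.constr_basis ℂ e i
  rwa [OrthonormalBasis.coe_toBasis] at this

/-- Both sums are the trace of `t* a`. -/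
theorem sum_inner_eq_sum_inner {E : Type*} [NormedAddCommGroup E] [InnerProductSpace ℂ E]
    [FiniteDimensional ℂ E] {α β : Type*} [Fintype α] [Fintype β] (b : OrthonormalBasis α ℂ E)
    (b' : OrthonormalBasis β ℂ E) (t a : E →L[ℂ] H₂) :
    ∑ i, (inner ℂ (t (b i)) (a (b i)) : ℂ) = ∑ i, inner ℂ (t (b' i)) (a (b' i)) := by
  have := FiniteDimensional.complete ℂ E
  have h1 := LinearMap.trace_eq_sum_inner (𝕜 := ℂ)
    ((ContinuousLinearMap.adjoint t ∘L a : E →L[ℂ] E) : E →ₗ[ℂ] E) b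
  have h2 := LinearMap.trace_eq_sum_inner (𝕜 := ℂ)
    ((ContinuousLinearMap.adjoint t ∘L a : E →L[ℂ] E) : E →ₗ[ℂ] E) b'
  rw [h1] at h2
  simpa [ContinuousLinearMap.adjoint_inner_right] using h2

/-- Hölder's inequality for the trace. -/
theorem sum_enorm_inner_le_schattenNorm_mul {p q : ℝ≥0∞} (h1 : 1 ≤ p) (hq1 : 1 ≤ q) (hp : p ≠ ⊤)
    (hpq : ENNReal.HolderConjugate p q) (T A : H₁ →L[ℂ] H₂) {α : Type*} [Fintype α]
    {e : α → H₁} (he : Orthonormal ℂ e) :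
    ∑ i, ‖(inner ℂ (T (e i)) (A (e i)) : ℂ)‖ₑ ≤ schattenNorm p T * schattenNorm q A := by
  classical
  -- Phases are put on the vectors fed to `T` but not on those fed to `A`. The trace of `t* a`
  -- becomes the sum of absolute values, so absolute convergence comes with the bound.
  have hθ : ∀ z : ℂ, ∃ θ : ℂ, ‖θ‖ = 1 ∧ θ * z = ‖z‖ := by
    intro z
    rcases eq_or_ne z 0 with rfl | hz
    · exact ⟨1, by simp⟩
    · have hz' : (‖z‖ : ℂ) ≠ 0 := by simpa using hz
      refine ⟨conj z / ‖z‖, by simp [hz], ?_⟩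
      rw [div_mul_eq_mul_div, Complex.conj_mul', sq, mul_div_assoc, div_self hz', mul_one]
  choose θ hθ1 hθ2 using hθ
  set z : α → ℂ := fun i => inner ℂ (T (e i)) (A (e i)) with hz
  have he' : Orthonormal ℂ fun i => conj (θ (z i)) • e i :=
    ⟨fun i => by rw [norm_smul, RCLike.norm_conj, hθ1, he.1, one_mul],
      fun i j hij => by beta_reduce; rw [inner_smul_left, inner_smul_right, he.2 hij, mul_zero, mul_zero]⟩
  set I' := isometryOfFamily he' with hI'
  set I := isometryOfFamily he with hI
  let t : EuclideanSpace ℂ α →L[ℂ] H₂ := T ∘L I'.toContinuousLinearMap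
  let a : EuclideanSpace ℂ α →L[ℂ] H₂ := A ∘L I.toContinuousLinearMap
  obtain ⟨b, hb⟩ := exists_orthonormalBasis_orthogonal_image t
  have hsum : ((∑ i, ‖z i‖ : ℝ) : ℂ) = ∑ k, inner ℂ (t (b k)) (a (b k)) := by
    rw [← sum_inner_eq_sum_inner (EuclideanSpace.basisFun α ℂ) b t a, Complex.ofReal_sum]
    refine Finset.sum_congr rfl fun i _ => ?_
    have e1 : t (EuclideanSpace.basisFun α ℂ i) = conj (θ (z i)) • T (e i) := by
      rw [← map_smul]; exact congrArg T (isometryOfFamily_basisFun he' i)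
    have e2 : a (EuclideanSpace.basisFun α ℂ i) = A (e i) :=
      congrArg A (isometryOfFamily_basisFun he i)
    rw [e1, e2, inner_smul_left, Complex.conj_conj, ← hθ2]
  have hg := orthonormal_normalize hb
  have hf : Orthonormal ℂ fun k : {k // t (b k) ≠ 0} => I' (b k) :=
    (b.orthonormal.comp_linearIsometry I').comp _ Subtype.val_injective
  have hf' : Orthonormal ℂ fun k : {k // t (b k) ≠ 0} => I (b k) :=
    (b.orthonormal.comp_linearIsometry I).comp _ Subtype.val_injective
  refine le_trans ?_ (sum_mul_le_schattenNorm_mul h1 hq1 hp hpq T A hf hf' hg)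
  -- Against the normalized vector `t (b k)`, the element of `T` is `‖t (b k)‖`, which cancels the
  -- normalization in the element of `A`.
  have hterm : ∀ k : {k // t (b k) ≠ 0},
      ‖(inner ℂ (((‖t (b k)‖⁻¹ : ℝ) : ℂ) • t (b k)) (T (I' (b k))) : ℂ)‖ₑ *
        ‖(inner ℂ (((‖t (b k)‖⁻¹ : ℝ) : ℂ) • t (b k)) (A (I (b k))) : ℂ)‖ₑ =
      ‖(inner ℂ (t (b k)) (a (b k)) : ℂ)‖ₑ := by
    intro k
    have hk : (‖t (b k)‖ : ℂ) ≠ 0 := by simpa using k.2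
    have e1 : (inner ℂ (((‖t (b k)‖⁻¹ : ℝ) : ℂ) • t (b k)) (T (I' (b k))) : ℂ) = ‖t (b k)‖ := by
      rw [inner_smul_left]
      change _ * inner ℂ (t (b k)) (t (b k)) = _
      rw [inner_self_eq_norm_sq_to_K, Complex.conj_ofReal, Complex.ofReal_inv]
      change _ * (‖t (b k)‖ : ℂ) ^ 2 = _
      field_simp
    rw [e1, ← enorm_mul, inner_smul_left, Complex.conj_ofReal, ← mul_assoc, Complex.ofReal_inv,
      mul_inv_cancel₀ hk, one_mul]
    rfl
  rw [Finset.sum_congr rfl fun k _ => hterm k]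
  have e0 : ∑ k : {k // t (b k) ≠ 0}, ‖(inner ℂ (t (b k)) (a (b k)) : ℂ)‖ₑ =
      ∑ k, ‖(inner ℂ (t (b k)) (a (b k)) : ℂ)‖ₑ := by
    rw [← Finset.sum_subtype (Finset.univ.filter fun k => t (b k) ≠ 0) (by simp)
      fun k => ‖(inner ℂ (t (b k)) (a (b k)) : ℂ)‖ₑ]
    refine Finset.sum_filter_of_ne fun k _ hk h0 => hk ?_
    rw [h0, inner_zero_left, enorm_zero]
  rw [e0]
  calc ∑ i, ‖z i‖ₑ = ‖((∑ i, ‖z i‖ : ℝ) : ℂ)‖ₑ := by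
        rw [← ofReal_norm, Complex.norm_real, Real.norm_of_nonneg
          (Finset.sum_nonneg fun _ _ => norm_nonneg _),
          ENNReal.ofReal_sum_of_nonneg fun _ _ => norm_nonneg _]
        simp only [ofReal_norm]
    _ ≤ _ := by
        rw [hsum]; exact enorm_sum_le _ _

variable [CompleteSpace H₁]

/-- The trace form `tr(T* A)`. -/
noncomputable def tracePair (A T : H₁ →L[ℂ] H₂) : ℂ :=
  ∑' i, inner ℂ (T ((exists_hilbertBasis ℂ H₁).choose_spec.choose i))
    (A ((exists_hilbertBasis ℂ H₁).choose_spec.choose i))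

/-- Hölder's inequality on every finite part of the Hilbert basis bounds the partial sums of
absolute values; the basis need not be countable. -/
theorem hasSum_tracePair {p q : ℝ≥0∞} (h1 : 1 ≤ p) (hq1 : 1 ≤ q) (hp : p ≠ ⊤)
    (hpq : ENNReal.HolderConjugate p q) {T A : H₁ →L[ℂ] H₂} (hT : schattenNorm p T ≠ ⊤)
    (hA : schattenNorm q A ≠ ⊤) :
    HasSum (fun i => inner ℂ (T ((exists_hilbertBasis ℂ H₁).choose_spec.choose i))
      (A ((exists_hilbertBasis ℂ H₁).choose_spec.choose i))) (tracePair A T) ∧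
      ‖tracePair A T‖ ≤ (schattenNorm q A).toReal * (schattenNorm p T).toReal := by
  set b := (exists_hilbertBasis ℂ H₁).choose_spec.choose with hb
  have hbd : ∀ s : Finset _, ∑ i ∈ s, ‖(inner ℂ (T (b i)) (A (b i)) : ℂ)‖ ≤
      (schattenNorm q A).toReal * (schattenNorm p T).toReal := by
    intro s
    have h := sum_enorm_inner_le_schattenNorm_mul h1 hq1 hp hpq T A
      (b.orthonormal.comp (fun i : s => (i : _)) Subtype.val_injective)
    simp only [Function.comp_apply] at h
    rw [Finset.sum_coe_sort s fun i => ‖(inner ℂ (T (b i)) (A (b i)) : ℂ)‖ₑ] at h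
    have h2 := ENNReal.toReal_mono (ENNReal.mul_ne_top hT hA) h
    rw [ENNReal.toReal_sum fun _ _ => enorm_ne_top, ENNReal.toReal_mul, mul_comm] at h2
    simpa using h2
  have hs : Summable fun i => ‖(inner ℂ (T (b i)) (A (b i)) : ℂ)‖ :=
    summable_of_sum_le (fun _ => norm_nonneg _) hbd
  exact ⟨hs.of_norm.hasSum, (norm_tsum_le_tsum_norm hs).trans (hs.tsum_le_of_sum_le hbd)⟩

/-- Parseval's identity for `A* u` and `v`. No Schatten condition on `A` enters. -/
theorem tracePair_rankOne (A : H₁ →L[ℂ] H₂) (u : H₂) (v : H₁) :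
    tracePair A (InnerProductSpace.rankOne ℂ u v) = inner ℂ u (A v) := by
  rw [tracePair, ← ContinuousLinearMap.adjoint_inner_left,
    ← (exists_hilbertBasis ℂ H₁).choose_spec.choose.tsum_inner_mul_inner]
  refine tsum_congr fun i => ?_
  rw [InnerProductSpace.rankOne_apply, inner_smul_left, inner_conj_symm,
    ContinuousLinearMap.adjoint_inner_left, mul_comm]

end Trace

end SchattenSymbol

open InnerProductSpace (rankOne rankOne_apply)

namespace SchattenSymbol

/-! ### Density of finite rank operators -/

section FiniteRank

variable {H₁ : Type*} [NormedAddCommGroup H₁] [InnerProductSpace ℂ H₁]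
  {H₂ : Type*} [NormedAddCommGroup H₂] [InnerProductSpace ℂ H₂]

/-- The matrix of a diagonal operator in other orthonormal families is controlled by Schur's test,
`sum_enorm_rpow_le_of_diagonal`. -/
theorem schattenNorm_sum_rankOne_le {p : ℝ≥0∞} (h1 : 1 ≤ p) (hp : p ≠ ⊤) {β : Type*} [Fintype β]
    {f : β → H₁} {g : β → H₂} (hf : Orthonormal ℂ f) (hg : Orthonormal ℂ g) (c : β → ℂ) :
    schattenNorm p (∑ k, c k • rankOne ℂ (g k) (f k)) ≤
      (∑ k, ‖c k‖ₑ ^ p.toReal) ^ (1 / p.toReal) := by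
  have hr := one_le_toReal h1 hp
  refine schattenNorm_le_of_sum h1 hp fun α _ u v hu hv => ?_
  rw [← ENNReal.rpow_mul, one_div, inv_mul_cancel₀ (by linarith), ENNReal.rpow_one]
  refine le_trans (le_of_eq ?_) (sum_enorm_rpow_le_of_diagonal hr hu hv hf hg c)
  refine Finset.sum_congr rfl fun i _ => ?_
  simp [sum_apply]

theorem schattenNorm_rankOne_le {p : ℝ≥0∞} (h1 : 1 ≤ p) (u : H₂) (v : H₁) :
    schattenNorm p (rankOne ℂ u v) ≤ ‖u‖ₑ * ‖v‖ₑ := by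
  refine (schattenNorm_le_schattenNorm_one h1 _).trans ?_
  rcases eq_or_ne u 0 with rfl | hu
  · simp [schattenNorm_zero]
  rcases eq_or_ne v 0 with rfl | hv
  · simp [schattenNorm_zero]
  have h := schattenNorm_sum_rankOne_le (p := 1) le_rfl ENNReal.one_ne_top
    (f := fun _ : Unit => ((‖v‖⁻¹ : ℝ) : ℂ) • v) (g := fun _ : Unit => ((‖u‖⁻¹ : ℝ) : ℂ) • u)
    ⟨fun _ => by simp [norm_smul, hv], fun i j hij => (hij rfl).elim⟩
    ⟨fun _ => by simp [norm_smul, hu], fun i j hij => (hij rfl).elim⟩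
    (fun _ => (‖u‖ * ‖v‖ : ℝ))
  have e : rankOne ℂ u v = ∑ k : Unit, (((‖u‖ * ‖v‖ : ℝ) : ℝ) : ℂ) •
      rankOne ℂ (((‖u‖⁻¹ : ℝ) : ℂ) • u) (((‖v‖⁻¹ : ℝ) : ℂ) • v) := by
    have hu' : (‖u‖ : ℂ) ≠ 0 := by simpa using hu
    have hv' : (‖v‖ : ℂ) ≠ 0 := by simpa using hv
    ext x
    simp only [Finset.univ_unique, Finset.sum_const, Finset.card_singleton, one_smul,
      smul_apply, rankOne_apply, inner_smul_left, smul_smul, Complex.conj_ofReal]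
    congr 1
    push_cast
    field_simp
  rw [e]
  refine h.trans (le_of_eq ?_)
  simp [← ofReal_norm]

/-- The orthogonal projection onto the complement of an orthonormal family. -/
noncomputable def complProj {α : Type*} [Fintype α] (f : α → H₁) : H₁ →L[ℂ] H₁ :=
  1 - ∑ j, rankOne ℂ (f j) (f j)

section complProj

variable {α : Type*} [Fintype α] {f : α → H₁}

theorem complProj_apply (f : α → H₁) (x : H₁) :
    complProj f x = x - ∑ j, (inner ℂ (f j) x : ℂ) • f j := by
  simp [complProj, sum_apply]

theorem inner_complProj_right (hf : Orthonormal ℂ f) (j : α) (x : H₁) :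
    (inner ℂ (f j) (complProj f x) : ℂ) = 0 := by
  rw [complProj_apply, inner_sub_right, hf.inner_right_fintype, sub_self]

theorem complProj_of_forall {x : H₁} (h : ∀ j, (inner ℂ (f j) x : ℂ) = 0) : complProj f x = x := by
  simp [complProj_apply, h]

theorem inner_complProj_left (f : α → H₁) (x y : H₁) :
    (inner ℂ (complProj f x) y : ℂ) = inner ℂ x (complProj f y) := by
  simp only [complProj_apply, inner_sub_left, inner_sub_right, sum_inner, inner_sum,
    inner_smul_left, inner_smul_right, inner_conj_symm]
  congr 1
  exact Finset.sum_congr rfl fun i _ => mul_comm _ _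

end complProj

theorem exists_finite_near_schattenNorm {p : ℝ≥0∞} (h1 : 1 ≤ p) (hp : p ≠ ⊤) (T : H₁ →L[ℂ] H₂)
    (hT : schattenNorm p T ≠ ⊤) {ε : ℝ≥0∞} (hε : ε ≠ 0) :
    ∃ (α : Type) (_ : Fintype α) (f : α → H₁) (g : α → H₂), Orthonormal ℂ f ∧ Orthonormal ℂ g ∧
      schattenNorm p T ^ p.toReal ≤ ∑ i, ‖(inner ℂ (g i) (T (f i)) : ℂ)‖ₑ ^ p.toReal +
        ε ^ p.toReal := by
  by_contra! hcon
  have hr : 0 < p.toReal := zero_lt_one.trans_le (one_le_toReal h1 hp)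
  have hS : schattenNorm p T ^ p.toReal ≠ ⊤ := ENNReal.rpow_ne_top_of_nonneg hr.le hT
  have hε' : ε ^ p.toReal ≠ 0 := by simpa [hr.le, hr.not_gt, hr] using hε
  -- The negated claim for the empty family already excludes norm zero, which the strict inequality
  -- at the end requires.
  have h0 : schattenNorm p T ^ p.toReal ≠ 0 :=
    (bot_le.trans_lt (hcon Empty inferInstance Empty.elim Empty.elim
      ⟨fun i => i.elim, fun i => i.elim⟩ ⟨fun i => i.elim, fun i => i.elim⟩)).ne'
  have h := schattenNorm_le_of_sum h1 hp (T := T)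
    (c := (schattenNorm p T ^ p.toReal - ε ^ p.toReal) ^ p.toReal⁻¹) fun α _ f g hf hg => by
      rw [← ENNReal.rpow_mul, inv_mul_cancel₀ hr.ne', ENNReal.rpow_one]
      have h := hcon α inferInstance f g hf hg
      exact ENNReal.le_sub_of_add_le_right (ne_top_of_le_ne_top hS (le_add_self.trans h.le)) h.le
  rw [ENNReal.le_rpow_inv_iff hr] at h
  exact absurd h (not_le.2 (ENNReal.sub_lt_self hS h0 hε'))

variable [CompleteSpace H₁] [CompleteSpace H₂]

/-- Left and right singular vectors of the corner are orthogonal to `g` and `f`, so appending them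
to these families keeps orthonormality. As `f` and `g` carry all but `ε^p` of the `p`-th power of
the norm of `T`, at most `ε^p` is left for the singular values. Arbitrary test families are then
compared with the singular vectors by Schur's test. -/
theorem schattenNorm_complProj_le {p : ℝ≥0∞} (h1 : 1 ≤ p) (hp : p ≠ ⊤) (T : H₁ →L[ℂ] H₂)
    (hT : schattenNorm p T ≠ ⊤) {ε : ℝ≥0∞} {α : Type*} [Fintype α] {f : α → H₁} {g : α → H₂}
    (hf : Orthonormal ℂ f) (hg : Orthonormal ℂ g)
    (hε : schattenNorm p T ^ p.toReal ≤ ∑ i, ‖(inner ℂ (g i) (T (f i)) : ℂ)‖ₑ ^ p.toReal +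
        ε ^ p.toReal) :
    schattenNorm p (complProj g ∘L T ∘L complProj f) ≤ ε := by
  classical
  have hr := one_le_toReal h1 hp
  refine schattenNorm_le_of_sum h1 hp fun β _ u v hu hv => ?_
  -- The corner sees the `u i` only through their projections, so it is enough to diagonalize it on
  -- their finite-dimensional span.
  let U := Submodule.span ℂ (Set.range fun i => complProj f (u i))
  have hU : ∀ x ∈ U, complProj f x = x := by
    intro x hx
    refine complProj_of_forall fun j => ?_
    have hle : U ≤ LinearMap.ker (innerSL ℂ (f j)).toLinearMap := by
      refine Submodule.span_le.2 ?_
      rintro _ ⟨i, rfl⟩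
      exact inner_complProj_right hf j (u i)
    exact hle hx
  have : FiniteDimensional ℂ U := FiniteDimensional.span_of_finite ℂ (Set.finite_range _)
  let S : U →L[ℂ] H₂ := (complProj g ∘L T) ∘L U.subtypeL
  obtain ⟨b, hb⟩ := exists_orthonormalBasis_orthogonal_image S
  have hγ := orthonormal_normalize hb
  set γ : {k // S (b k) ≠ 0} → H₂ := fun k => ((‖S (b k)‖⁻¹ : ℝ) : ℂ) • S (b k) with hγ_def
  let b' : {k // S (b k) ≠ 0} → H₁ := fun k => (b k : U)
  have hb' : Orthonormal ℂ b' :=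
    (b.orthonormal.comp_linearIsometry U.subtypeₗᵢ).comp _ Subtype.val_injective
  have hSγ : ∀ k, S (b k.1) = (‖S (b k.1)‖ : ℂ) • γ k := by
    intro k
    have hk : (‖S (b k)‖ : ℂ) ≠ 0 := by simpa using k.2
    simp only [hγ_def, smul_smul, Complex.ofReal_inv, mul_inv_cancel₀ hk, one_smul]
  have hNγ : ∀ k, complProj g (γ k) = γ k := by
    intro k
    have : complProj g (S (b k)) = S (b k) :=
      complProj_of_forall fun j => inner_complProj_right hg j _
    simp only [hγ_def, map_smul, this]
  have hdiag : ∀ k, (inner ℂ (γ k) (T (b' k)) : ℂ) = ‖S (b k.1)‖ := by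
    intro k
    rw [← hNγ k, inner_complProj_left]
    change inner ℂ (γ k) (S (b k.1)) = _
    conv_lhs => rw [hSγ k]
    rw [inner_smul_right, inner_self_eq_norm_sq_to_K, hγ.1 k]
    simp
  have hfb : Orthonormal ℂ (Sum.elim f b') := by
    refine ⟨fun i => by cases i <;> simp [hf.1, hb'.1], fun i j hij => ?_⟩
    have hx : ∀ i k, (inner ℂ (f i) (b' k) : ℂ) = 0 := fun i k => by
      rw [← hU (b' k) (b k.1).2]; exact inner_complProj_right hf i _
    rcases i with i | i <;> rcases j with j | j
    · exact hf.2 fun e => hij (congrArg _ e)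
    · exact hx i j
    · exact inner_eq_zero_symm.1 (hx j i)
    · exact hb'.2 fun e => hij (congrArg _ e)
  have hgγ : Orthonormal ℂ (Sum.elim g γ) := by
    refine ⟨fun i => by cases i <;> simp [hg.1, hγ.1], fun i j hij => ?_⟩
    have hx : ∀ i k, (inner ℂ (g i) (γ k) : ℂ) = 0 := fun i k => by
      rw [← hNγ k]; exact inner_complProj_right hg i _
    rcases i with i | i <;> rcases j with j | j
    · exact hg.2 fun e => hij (congrArg _ e)
    · exact hx i j
    · exact inner_eq_zero_symm.1 (hx j i)
    · exact hγ.2 fun e => hij (congrArg _ e)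
  have hsmall : ∑ k : {k // S (b k) ≠ 0}, ‖(‖S (b k)‖ : ℂ)‖ₑ ^ p.toReal ≤ ε ^ p.toReal := by
    have h := (sum_enorm_rpow_le_schattenNorm h1 hp T hfb hgγ).trans hε
    rw [Fintype.sum_sum_type] at h
    simp only [Sum.elim_inl, Sum.elim_inr, hdiag] at h
    refine (ENNReal.add_le_add_iff_left ?_).1 h
    exact ne_top_of_le_ne_top (ENNReal.rpow_ne_top_of_nonneg (by linarith) hT)
      (sum_enorm_rpow_le_schattenNorm h1 hp T hf hg)
  refine le_trans (le_of_eq (Finset.sum_congr rfl fun i _ => ?_))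
    ((sum_enorm_rpow_le_of_diagonal hr hu hv hb' hγ fun k => (‖S (b k.1)‖ : ℂ)).trans hsmall)
  congr 2
  let x : U := ⟨complProj f (u i), Submodule.subset_span ⟨i, rfl⟩⟩
  change inner ℂ (v i) (S x) = _
  conv_lhs => rw [← b.sum_repr' x]
  rw [map_sum, inner_sum]
  have hx : ∀ k, (inner ℂ (b k) x : ℂ) = inner ℂ (b k : H₁) (u i) := fun k => by
    rw [← hU (b k) (b k).2, inner_complProj_left]; rfl
  have e0 : ∑ k, (inner ℂ (v i) (S ((inner ℂ (b k) x : ℂ) • b k)) : ℂ) =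
      ∑ k : {k // S (b k) ≠ 0}, inner ℂ (v i) (S ((inner ℂ (b k) x : ℂ) • b k)) := by
    rw [← Finset.sum_subtype (Finset.univ.filter fun k => S (b k) ≠ 0) (by simp)
      fun k => (inner ℂ (v i) (S ((inner ℂ (b k) x : ℂ) • b k)) : ℂ)]
    refine (Finset.sum_filter_of_ne (p := fun k => S (b k) ≠ 0) fun k _ hk h0 => hk ?_).symm
    rw [map_smul, h0, smul_zero, inner_zero_right]
  rw [e0]
  refine Finset.sum_congr rfl fun k _ => ?_
  conv_lhs => rw [map_smul, hSγ k, inner_smul_right, inner_smul_right, hx]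
  ring

/-- With `M` and `N` the complementary projections of `f` and `g`, this is `T - N T M = (1 - N) T +
N T (1 - M)`, and `1 - M` and `1 - N` have finite rank. -/
theorem sub_complProj_comp {α β : Type*} [Fintype α] [Fintype β] (T : H₁ →L[ℂ] H₂) (f : α → H₁)
    (g : β → H₂) : T - complProj g ∘L T ∘L complProj f =
      ∑ j, rankOne ℂ (g j) (ContinuousLinearMap.adjoint T (g j)) +
        ∑ i, rankOne ℂ (complProj g (T (f i))) (f i) := by
  ext x
  have e : T (complProj f x) = T x - ∑ i, (inner ℂ (f i) x : ℂ) • T (f i) := by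
    rw [complProj_apply, map_sub, map_sum]
    simp only [map_smul]
  change T x - complProj g (T (complProj f x)) = _
  rw [e, map_sub, map_sum, complProj_apply g (T x)]
  simp only [add_apply, sum_apply, rankOne_apply, map_smul,
    ContinuousLinearMap.adjoint_inner_left]
  abel

/-- The operators of finite rank with ranges and coranges spanned by given dense sets are dense in
the Schatten-von Neumann classes of finite order. -/
theorem exists_schattenNorm_sub_le {p : ℝ≥0∞} (h1 : 1 ≤ p) (hp : p ≠ ⊤) (T : H₁ →L[ℂ] H₂)
    (hT : schattenNorm p T ≠ ⊤) {D₁ : Set H₁} {D₂ : Set H₂} (hD₁ : Dense D₁) (hD₂ : Dense D₂)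
    {ε : ℝ≥0∞} (hε : ε ≠ 0) :
    ∃ F ∈ Submodule.span ℂ {F : H₁ →L[ℂ] H₂ | ∃ u ∈ D₂, ∃ v ∈ D₁, F = rankOne ℂ u v},
      schattenNorm p (T - F) ≤ ε := by
  set V := Submodule.span ℂ {F : H₁ →L[ℂ] H₂ | ∃ u ∈ D₂, ∃ v ∈ D₁, F = rankOne ℂ u v}
  have hadd : ∀ T S : H₁ →L[ℂ] H₂, (∀ ε : ℝ≥0∞, ε ≠ 0 → ∃ F ∈ V, schattenNorm p (T - F) ≤ ε) →
      (∀ ε : ℝ≥0∞, ε ≠ 0 → ∃ F ∈ V, schattenNorm p (S - F) ≤ ε) →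
      ∀ ε : ℝ≥0∞, ε ≠ 0 → ∃ F ∈ V, schattenNorm p (T + S - F) ≤ ε := by
    intro T S hT hS ε hε
    obtain ⟨F, hF, hF'⟩ := hT (ε / 2) (by simpa using hε)
    obtain ⟨G, hG, hG'⟩ := hS (ε / 2) (by simpa using hε)
    refine ⟨F + G, V.add_mem hF hG, ?_⟩
    rw [add_sub_add_comm]
    exact (schattenNorm_add_le h1 _ _).trans ((add_le_add hF' hG').trans (ENNReal.add_halves ε).le)
  have hrank : ∀ (u : H₂) (v : H₁) (ε : ℝ≥0∞), ε ≠ 0 →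
      ∃ F ∈ V, schattenNorm p (rankOne ℂ u v - F) ≤ ε := by
    intro u v ε hε
    have hc : Continuous fun w : H₂ × H₁ => ‖u - w.1‖ₑ * ‖v‖ₑ + ‖w.1‖ₑ * ‖v - w.2‖ₑ := by
      -- Multiplication of extended nonnegative reals is not jointly continuous, so the error bound
      -- is rewritten through a real function.
      have e : (fun w : H₂ × H₁ => ‖u - w.1‖ₑ * ‖v‖ₑ + ‖w.1‖ₑ * ‖v - w.2‖ₑ) = fun w =>
          ENNReal.ofReal (‖u - w.1‖ * ‖v‖ + ‖w.1‖ * ‖v - w.2‖) := by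
        ext w
        rw [ENNReal.ofReal_add (by positivity) (by positivity), ENNReal.ofReal_mul (by positivity),
          ENNReal.ofReal_mul (by positivity)]
        simp only [ofReal_norm]
      rw [e]
      exact ENNReal.continuous_ofReal.comp (by fun_prop)
    have hopen := isOpen_Iio (a := ε).preimage hc
    obtain ⟨w, hw, hw'⟩ := (hD₂.prod hD₁).inter_open_nonempty _ hopen
      ⟨(u, v), by simpa using pos_iff_ne_zero.2 hε⟩
    refine ⟨rankOne ℂ w.1 w.2, Submodule.subset_span ⟨_, hw'.1, _, hw'.2, rfl⟩, ?_⟩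
    have e : rankOne ℂ u v - rankOne ℂ w.1 w.2 =
        rankOne ℂ (u - w.1) v + rankOne ℂ w.1 (v - w.2) := by
      simp
    rw [e]
    exact (schattenNorm_add_le h1 _ _).trans ((add_le_add (schattenNorm_rankOne_le h1 _ _)
      (schattenNorm_rankOne_le h1 _ _)).trans (le_of_lt hw))
  obtain ⟨α, _, f, g, hf, hg, hfg⟩ := exists_finite_near_schattenNorm h1 hp T hT
    (ε := ε / 2) (by simpa using hε)
  have hN := schattenNorm_complProj_le h1 hp T hT hf hg hfg
  have hsum : ∀ {β : Type} [Fintype β] (F : β → H₁ →L[ℂ] H₂),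
      (∀ i, ∀ ε : ℝ≥0∞, ε ≠ 0 → ∃ G ∈ V, schattenNorm p (F i - G) ≤ ε) →
      ∀ ε : ℝ≥0∞, ε ≠ 0 → ∃ G ∈ V, schattenNorm p (∑ i, F i - G) ≤ ε := by
    intro β _ F hF
    refine Finset.sum_induction F
      (fun T => ∀ ε : ℝ≥0∞, ε ≠ 0 → ∃ G ∈ V, schattenNorm p (T - G) ≤ ε) hadd ?_ fun i _ => hF i
    exact fun ε _ => ⟨0, V.zero_mem, by simp [schattenNorm_zero]⟩
  obtain ⟨F, hF, hF'⟩ := hadd _ _ (hsum _ fun j => hrank (g j) (ContinuousLinearMap.adjoint T (g j)))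
    (hsum _ fun i => hrank (complProj g (T (f i))) (f i)) (ε / 2) (by simpa using hε)
  refine ⟨F, hF, ?_⟩
  rw [← sub_complProj_comp] at hF'
  have e : T - F = complProj g ∘L T ∘L complProj f +
      (T - complProj g ∘L T ∘L complProj f - F) := by abel
  rw [e]
  exact (schattenNorm_add_le h1 _ _).trans ((add_le_add hN hF').trans (ENNReal.add_halves ε).le)

end FiniteRank

end SchattenSymbol

namespace SchattenSymbol

/-! ### Converse of Hölder's inequality, series, and unitary transport -/

section SchattenDuality

variable {H₁ : Type*} [NormedAddCommGroup H₁] [InnerProductSpace ℂ H₁]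
  {H₂ : Type*} [NormedAddCommGroup H₂] [InnerProductSpace ℂ H₂]

/-- The converse of Hölder's inequality. -/
theorem schattenNorm_le_of_forall_sum {p q : ℝ≥0∞} (hq1 : 1 ≤ q) (hp : p ≠ ⊤)
    (hpq : ENNReal.HolderConjugate p q) {A : H₁ →L[ℂ] H₂} {M : ℝ≥0∞}
    (h : ∀ (α : Type) [Fintype α] (f : α → H₁) (g : α → H₂) (c : α → ℂ), Orthonormal ℂ f →
      Orthonormal ℂ g → ‖∑ i, c i * inner ℂ (g i) (A (f i))‖ₑ ≤
        M * (∑ i, ‖c i‖ₑ ^ p.toReal) ^ (1 / p.toReal)) : schattenNorm q A ≤ M := by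
  rcases eq_or_ne q ⊤ with rfl | hq
  · refine schattenNorm_top_le fun f g hf hg => ?_
    simpa using h Unit (fun _ => f) (fun _ => g) (fun _ => 1)
      ⟨fun _ => hf, fun i j hij => (hij rfl).elim⟩ ⟨fun _ => hg, fun i j hij => (hij rfl).elim⟩
  · have hc := ENNReal.HolderConjugate.toReal_of_ne_top (p := p) (q := q) hp hq
    have hq0 : 0 < q.toReal := hc.symm.pos
    have hp0 : 0 < p.toReal := hc.pos
    refine schattenNorm_le_of_sum hq1 hq fun α _ f g hf hg => ?_
    set z : α → ℂ := fun i => inner ℂ (g i) (A (f i)) with hz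
    -- The extremal coefficient in Hölder's inequality is `c = conj w |w|^{q-2}`, with `c w = |w|^q`
    -- and, as `(q - 1) p = q`, also `|c|^p = |w|^q`.
    have hc1 : ∀ w : ℂ, ∃ c : ℂ, c * w = (‖w‖ ^ q.toReal : ℝ) ∧
        ‖c‖ₑ ^ p.toReal = ‖w‖ₑ ^ q.toReal := by
      intro w
      rcases eq_or_ne w 0 with rfl | hw
      · exact ⟨0, by simp [hq0.ne', hq0, hp0]⟩
      · have hw' : 0 < ‖w‖ := norm_pos_iff.2 hw
        refine ⟨conj w * (‖w‖ ^ (q.toReal - 2) : ℝ), ?_, ?_⟩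
        · rw [mul_right_comm, Complex.conj_mul', ← Complex.ofReal_pow, ← Complex.ofReal_mul,
            ← Real.rpow_natCast, ← Real.rpow_add hw']
          congr 2
          push_cast; ring
        · rw [← ofReal_norm, ← ofReal_norm, ENNReal.ofReal_rpow_of_nonneg (norm_nonneg _) hp0.le,
            ENNReal.ofReal_rpow_of_nonneg (norm_nonneg _) hq0.le, norm_mul, RCLike.norm_conj,
            Complex.norm_real, Real.norm_of_nonneg (by positivity)]
          congr 1
          conv_lhs => enter [1, 1]; rw [← Real.rpow_one ‖w‖]
          rw [← Real.rpow_add hw', ← Real.rpow_mul hw'.le]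
          congr 1
          have := hc.symm.sub_one_mul_conj
          linarith
    choose c hc2 hc3 using hc1
    have h' := h α f g (fun i => c (z i)) hf hg
    set S := ∑ i, ‖z i‖ₑ ^ q.toReal with hS
    have hSt : S ≠ ⊤ := ENNReal.sum_ne_top.2 fun i _ =>
      ENNReal.rpow_ne_top_of_nonneg hq0.le enorm_ne_top
    have e1 : ‖∑ i, c (z i) * (inner ℂ (g i) (A (f i)) : ℂ)‖ₑ = S := by
      have : ∑ i, c (z i) * (inner ℂ (g i) (A (f i)) : ℂ) = ((∑ i, ‖z i‖ ^ q.toReal : ℝ) : ℂ) := by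
        rw [Complex.ofReal_sum]
        exact Finset.sum_congr rfl fun i _ => hc2 (z i)
      rw [this, ← ofReal_norm, Complex.norm_real, Real.norm_of_nonneg
        (Finset.sum_nonneg fun i _ => by positivity),
        ENNReal.ofReal_sum_of_nonneg fun i _ => by positivity]
      refine Finset.sum_congr rfl fun i _ => ?_
      rw [← ENNReal.ofReal_rpow_of_nonneg (norm_nonneg _) hq0.le, ofReal_norm]
    simp only [hc3] at h'
    rw [e1, ← hS] at h'
    rcases eq_or_ne S 0 with h0 | h0
    · rw [h0]; exact bot_le
    -- The hypothesis reads `S ≤ M S^{1/p}`; dividing by `S^{1/p}`, which is finite and nonzero,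
    -- leaves `S^{1/q} ≤ M`.
    have e2 : S = S ^ (1 / q.toReal) * S ^ (1 / p.toReal) := by
      rw [← ENNReal.rpow_add _ _ h0 hSt, one_div, one_div, add_comm, hc.inv_add_inv_eq_one,
        ENNReal.rpow_one]
    have h3 : S ^ (1 / q.toReal) ≤ M := by
      refine (ENNReal.mul_le_mul_iff_left (c := S ^ (1 / p.toReal)) ?_ ?_).1 (e2 ▸ h')
      · simp [h0, hSt]
      · exact ENNReal.rpow_ne_top_of_nonneg (by positivity) hSt
    rwa [one_div, ENNReal.rpow_inv_le_iff hq0] at h3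

theorem enorm_inner_le_schattenNorm_one {α : Type*} [Fintype α] (T : H₁ →L[ℂ] H₂) {f : α → H₁}
    {g : α → H₂} (hf : Orthonormal ℂ f) (hg : Orthonormal ℂ g) :
    ∑ i, ‖(inner ℂ (g i) (T (f i)) : ℂ)‖ₑ ≤ schattenNorm 1 T := by
  simpa using sum_enorm_rpow_le_schattenNorm le_rfl ENNReal.one_ne_top T hf hg

/-- Matrix elements are continuous for the operator norm, so they may be summed termwise, and the
finite sum over a test family can be exchanged with the series. -/
theorem schattenNorm_one_le_tsum {J : Type*} {T : H₁ →L[ℂ] H₂} {S : J → H₁ →L[ℂ] H₂}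
    (h : HasSum S T) : schattenNorm 1 T ≤ ∑' j, schattenNorm 1 (S j) := by
  refine schattenNorm_le_of_sum le_rfl ENNReal.one_ne_top fun α _ f g hf hg => ?_
  simp only [ENNReal.toReal_one, ENNReal.rpow_one]
  have h1 : ∀ i, ‖(inner ℂ (g i) (T (f i)) : ℂ)‖ₑ ≤ ∑' j, ‖(inner ℂ (g i) (S j (f i)) : ℂ)‖ₑ := by
    intro i
    have h2 := ((ContinuousLinearMap.apply ℂ H₂ (f i)).hasSum h).mapL (innerSL ℂ (g i))
    have h3 : (inner ℂ (g i) (T (f i)) : ℂ) = ∑' j, inner ℂ (g i) (S j (f i)) := h2.tsum_eq.symm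
    rw [h3]
    exact enorm_tsum_le_tsum_enorm
  calc _ ≤ ∑ i, ∑' j, ‖(inner ℂ (g i) (S j (f i)) : ℂ)‖ₑ := Finset.sum_le_sum fun i _ => h1 i
    _ = ∑' j, ∑ i, ‖(inner ℂ (g i) (S j (f i)) : ℂ)‖ₑ :=
        (Summable.tsum_finsetSum fun _ _ => ENNReal.summable).symm
    _ ≤ _ := ENNReal.tsum_le_tsum fun j => enorm_inner_le_schattenNorm_one (S j) hf hg

variable {K₁ : Type*} [NormedAddCommGroup K₁] [InnerProductSpace ℂ K₁]
  {K₂ : Type*} [NormedAddCommGroup K₂] [InnerProductSpace ℂ K₂]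

/-- The operator transported by isometries of the Hilbert spaces. -/
noncomputable def transport (e₁ : K₁ ≃ₗᵢ[ℂ] H₁) (e₂ : K₂ ≃ₗᵢ[ℂ] H₂) :
    (K₁ →L[ℂ] K₂) ≃ₗ[ℂ] (H₁ →L[ℂ] H₂) where
  toFun T := (e₂ : K₂ →L[ℂ] H₂) ∘L T ∘L (e₁.symm : H₁ →L[ℂ] K₁)
  invFun T := (e₂.symm : H₂ →L[ℂ] K₂) ∘L T ∘L (e₁ : K₁ →L[ℂ] H₁)
  map_add' T S := by ext; simp
  map_smul' c T := by ext; simp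
  left_inv T := by ext; simp
  right_inv T := by ext; simp

theorem transport_apply (e₁ : K₁ ≃ₗᵢ[ℂ] H₁) (e₂ : K₂ ≃ₗᵢ[ℂ] H₂) (T : K₁ →L[ℂ] K₂) (x : H₁) :
    transport e₁ e₂ T x = e₂ (T (e₁.symm x)) := rfl

theorem transport_symm_apply (e₁ : K₁ ≃ₗᵢ[ℂ] H₁) (e₂ : K₂ ≃ₗᵢ[ℂ] H₂) (T : H₁ →L[ℂ] H₂) (x : K₁) :
    (transport e₁ e₂).symm T x = e₂.symm (T (e₁ x)) := rfl

theorem schattenNorm_transport_le (p : ℝ≥0∞) (e₁ : K₁ ≃ₗᵢ[ℂ] H₁) (e₂ : K₂ ≃ₗᵢ[ℂ] H₂)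
    (T : K₁ →L[ℂ] K₂) : schattenNorm p (transport e₁ e₂ T) ≤ schattenNorm p T := by
  refine schattenNorm_le fun J f g hf hg => ?_
  refine le_trans (le_of_eq ?_) (le_schattenNorm p T (hf.comp_linearIsometry e₁.symm.toLinearIsometry)
    (hg.comp_linearIsometry e₂.symm.toLinearIsometry))
  congr 1
  ext j
  rw [transport_apply, ← e₂.symm.inner_map_map, e₂.symm_apply_apply]
  rfl

theorem schattenNorm_transport (p : ℝ≥0∞) (e₁ : K₁ ≃ₗᵢ[ℂ] H₁) (e₂ : K₂ ≃ₗᵢ[ℂ] H₂)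
    (T : K₁ →L[ℂ] K₂) : schattenNorm p (transport e₁ e₂ T) = schattenNorm p T := by
  refine le_antisymm (schattenNorm_transport_le p e₁ e₂ T) ?_
  have h := schattenNorm_transport_le p e₁.symm e₂.symm (transport e₁ e₂ T)
  rwa [show transport e₁.symm e₂.symm (transport e₁ e₂ T) = T from
    (transport e₁ e₂).symm_apply_apply T] at h

end SchattenDuality

end SchattenSymbol

namespace SchattenSymbol

/-! ### Operators with Schwartz kernels -/

theorem ofS_tensor_tensor {d : ℕ} (ψ φ ψ' φ' : 𝓢(Rd d, ℂ)) :
    ofS (tensor ψ φ) (tensor ψ' φ') = ofS ψ ψ' * ofS φ φ' := by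
  rw [ofS_apply, ofS_apply, ofS_apply, ← integral_prod_mul]
  refine integral_congr_ae (.of_forall fun z => ?_)
  change ψ z.1 * φ z.2 * (ψ' z.1 * φ' z.2) = _
  ring

theorem conjS_tensor {d : ℕ} (ψ φ : 𝓢(Rd d, ℂ)) :
    conjS (tensor ψ φ) = tensor (conjS ψ) (conjS φ) := by
  ext z
  exact map_mul (starRingEnd ℂ) _ _

section OpOf

variable {d : ℕ}
  {H₁ : Type*} [NormedAddCommGroup H₁] [InnerProductSpace ℂ H₁] [CompleteSpace H₁]
  {H₂ : Type*} [NormedAddCommGroup H₂] [InnerProductSpace ℂ H₂] [CompleteSpace H₂]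
  {ι₁ : H₁ →ₗ[ℂ] 𝓢'(Rd d, ℂ)} [IsTempered ι₁] {ι₂ : H₂ →ₗ[ℂ] 𝓢'(Rd d, ℂ)} [IsTempered ι₂]

theorem hasKernel_iff {K : 𝓢'(Rd d × Rd d, ℂ)} {T : H₁ →L[ℂ] H₂} :
    HasKernel ι₁ ι₂ K T ↔ ∀ φ ψ, ι₂ (T (emb ι₁ φ)) ψ = K (tensor ψ φ) := by
  refine ⟨fun h φ ψ => h φ _ (apply_emb ι₁ φ) ψ, fun h φ f hf ψ => ?_⟩
  rw [eq_emb ι₁ hf, h]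

theorem HasKernel.unique {K : 𝓢'(Rd d × Rd d, ℂ)} {T S : H₁ →L[ℂ] H₂}
    (hT : HasKernel ι₁ ι₂ K T) (hS : HasKernel ι₁ ι₂ K S) : T = S := by
  refine ContinuousLinearMap.coeFn_injective
    ((denseRange_emb ι₁).equalizer T.continuous S.continuous (funext fun φ => ?_))
  refine IsTempered.injective (ι := ι₂) ?_
  ext ψ
  exact (hasKernel_iff.1 hT φ ψ).trans (hasKernel_iff.1 hS φ ψ).symm

theorem HasKernel.kernelNorm_eq (p : ℝ≥0∞) {K : 𝓢'(Rd d × Rd d, ℂ)} {T : H₁ →L[ℂ] H₂}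
    (hT : HasKernel ι₁ ι₂ K T) : kernelNorm p ι₁ ι₂ K = schattenNorm p T :=
  le_antisymm (kernelNorm_le hT) (le_iInf₂ fun S hS => by rw [hT.unique hS])

theorem HasKernel.kernel_unique {K K' : 𝓢'(Rd d × Rd d, ℂ)} {T : H₁ →L[ℂ] H₂}
    (h : HasKernel ι₁ ι₂ K T) (h' : HasKernel ι₁ ι₂ K' T) : K = K' :=
  distribution_ext_tensor fun ψ φ =>
    (hasKernel_iff.1 h φ ψ).symm.trans (hasKernel_iff.1 h' φ ψ)

/-- Pairing with `φ` is the inner product with `dualVec ι₁ φ`, so a tensor kernel is an operator of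
rank one. -/
theorem hasKernel_tensor (ψ φ : 𝓢(Rd d, ℂ)) :
    HasKernel ι₁ ι₂ (ofS (tensor ψ φ)) (rankOne ℂ (emb ι₂ ψ) (dualVec ι₁ φ)) := by
  refine hasKernel_iff.2 fun φ' ψ' => ?_
  rw [rankOne_apply, inner_dualVec, map_smul, apply_emb, apply_emb, ofS_tensor_tensor,
    ofS_comm φ φ', mul_comm]
  rfl

variable (ι₁ ι₂) in
/-- The kernel of a Schwartz function defines a trace class operator. -/
theorem exists_hasKernel_ofS : ∃ r : Seminorm ℂ 𝓢(Rd d × Rd d, ℂ), Continuous r ∧ ∀ G,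
    ∃ T : H₁ →L[ℂ] H₂, HasKernel ι₁ ι₂ (ofS G) T ∧ schattenNorm 1 T ≤ ENNReal.ofReal (r G) := by
  obtain ⟨q₁, hq₁, hq₁'⟩ := exists_norm_evalAt_le ι₁
  obtain ⟨q₂, hq₂, hq₂'⟩ := exists_norm_emb_le ι₂
  obtain ⟨r, hr, hr'⟩ := exists_tsum_tensorCoeff_le hq₂ hq₁
  refine ⟨r, hr, fun G => ?_⟩
  obtain ⟨hs, hle⟩ := hr' G
  -- The tensor expansion of `G` read as a series of rank one operators. Their trace norms are at
  -- most the coefficients times the seminorms `q₂` and `q₁` of the factors, a summable family.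
  let S : TensorIndex d → H₁ →L[ℂ] H₂ := fun j =>
    tensorCoeff j G • rankOne ℂ (emb ι₂ (leftAtom j)) (dualVec ι₁ (rightAtom j))
  have hbd : ∀ j, ‖emb ι₂ (leftAtom j)‖ * ‖dualVec ι₁ (rightAtom j)‖ ≤
      q₂ (leftAtom j) * q₁ (rightAtom j) := fun j => by
    rw [norm_dualVec]
    exact mul_le_mul (hq₂' _) (hq₁' _) (norm_nonneg _) (apply_nonneg _ _)
  have hS : Summable S := by
    refine Summable.of_norm_bounded hs fun j => ?_
    rw [norm_smul, InnerProductSpace.norm_rankOne]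
    exact mul_le_mul_of_nonneg_left (hbd j) (norm_nonneg _)
  refine ⟨∑' j, S j, hasKernel_iff.2 fun φ ψ => ?_, ?_⟩
  · have h1 := ((ContinuousLinearMap.apply ℂ H₂ (emb ι₁ φ)).hasSum hS.hasSum).mapL (evalAt ι₂ ψ)
    have h3 := (hasSum_tensor G).map (ofS (tensor ψ φ)) (ofS (tensor ψ φ)).continuous
    rw [ofS_comm]
    refine h1.unique ?_
    convert h3 using 1
    ext j
    have h4 := hasKernel_iff.1 (hasKernel_tensor (ι₁ := ι₁) (ι₂ := ι₂) (leftAtom j) (rightAtom j)) φ ψ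
    simp only [Function.comp_apply, map_smul]
    rw [ofS_comm, ← h4]
    simp [S, evalAt_apply]
  · refine (schattenNorm_one_le_tsum hS.hasSum).trans ?_
    calc ∑' j, schattenNorm 1 (S j) ≤
        ∑' j, ENNReal.ofReal (‖tensorCoeff j G‖ * (q₂ (leftAtom j) * q₁ (rightAtom j))) := by
          refine ENNReal.tsum_le_tsum fun j => (schattenNorm_smul_le _ _).trans ?_
          rw [ENNReal.ofReal_mul (norm_nonneg _), ofReal_norm]
          gcongr
          refine (schattenNorm_rankOne_le le_rfl _ _).trans ?_
          rw [← ofReal_norm, ← ofReal_norm, ← ENNReal.ofReal_mul (norm_nonneg _)]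
          exact ENNReal.ofReal_le_ofReal (hbd j)
      _ = ENNReal.ofReal (∑' j, ‖tensorCoeff j G‖ * (q₂ (leftAtom j) * q₁ (rightAtom j))) :=
          (ENNReal.ofReal_tsum_of_nonneg (fun j => by
            have := apply_nonneg q₂ (leftAtom j); have := apply_nonneg q₁ (rightAtom j)
            positivity) hs).symm
      _ ≤ _ := ENNReal.ofReal_le_ofReal hle

end OpOf

/-- The kernels of Schatten-von Neumann operators of order `p`. -/
abbrev KernelSpace {d : ℕ}
    {H₁ : Type*} [NormedAddCommGroup H₁] [InnerProductSpace ℂ H₁]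
    {H₂ : Type*} [NormedAddCommGroup H₂] [InnerProductSpace ℂ H₂]
    (p : ℝ≥0∞) [Fact (1 ≤ p)] (ι₁ : H₁ →ₗ[ℂ] 𝓢'(Rd d, ℂ)) (ι₂ : H₂ →ₗ[ℂ] 𝓢'(Rd d, ℂ)) : Type :=
  SymbolSpace p ι₁ ι₂ LinearMap.id

/-! ### Kernel spaces and density of the Schwartz kernels -/

namespace KernelSpace

variable {d : ℕ}
  {H₁ : Type*} [NormedAddCommGroup H₁] [InnerProductSpace ℂ H₁] [CompleteSpace H₁]
  {H₂ : Type*} [NormedAddCommGroup H₂] [InnerProductSpace ℂ H₂] [CompleteSpace H₂]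
  {p : ℝ≥0∞} [Fact (1 ≤ p)]
  {ι₁ : H₁ →ₗ[ℂ] 𝓢'(Rd d, ℂ)} [IsTempered ι₁] {ι₂ : H₂ →ₗ[ℂ] 𝓢'(Rd d, ℂ)} [IsTempered ι₂]

/-- The distribution underlying an element of the kernel space. -/
noncomputable def ker : KernelSpace p ι₁ ι₂ →ₗ[ℂ] 𝓢'(Rd d × Rd d, ℂ) := SymbolSpace.incl p ι₁ ι₂ LinearMap.id

theorem ker_injective : Function.Injective (ker (p := p) (ι₁ := ι₁) (ι₂ := ι₂)) :=
  Subtype.val_injective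

theorem exists_hasKernel (b : KernelSpace p ι₁ ι₂) :
    ∃ T : H₁ →L[ℂ] H₂, HasKernel ι₁ ι₂ (ker b) T ∧ schattenNorm p T ≠ ⊤ := by
  obtain ⟨T, hT⟩ := iInf_lt_iff.1 (SymbolSpace.kernelNorm_lt_top p ι₁ ι₂ LinearMap.id b)
  obtain ⟨h, hT⟩ := iInf_lt_iff.1 hT
  exact ⟨T, h, hT.ne⟩

/-- The operator of a kernel. -/
noncomputable def op : KernelSpace p ι₁ ι₂ →ₗ[ℂ] H₁ →L[ℂ] H₂ where
  toFun b := (exists_hasKernel b).choose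
  map_add' b c := (exists_hasKernel (b + c)).choose_spec.1.unique (by
    rw [map_add]
    exact (exists_hasKernel b).choose_spec.1.add (exists_hasKernel c).choose_spec.1)
  map_smul' z b := (exists_hasKernel (z • b)).choose_spec.1.unique (by
    rw [map_smul]
    exact (exists_hasKernel b).choose_spec.1.smul z)

theorem hasKernel_op (b : KernelSpace p ι₁ ι₂) : HasKernel ι₁ ι₂ (ker b) (op b) :=
  (exists_hasKernel b).choose_spec.1

theorem schattenNorm_op_ne_top (b : KernelSpace p ι₁ ι₂) : schattenNorm p (op b) ≠ ⊤ :=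
  (exists_hasKernel b).choose_spec.2

theorem norm_eq (b : KernelSpace p ι₁ ι₂) : ‖b‖ = (schattenNorm p (op b)).toReal := by
  rw [← (hasKernel_op b).kernelNorm_eq p]; rfl

theorem enorm_eq (b : KernelSpace p ι₁ ι₂) : ‖b‖ₑ = schattenNorm p (op b) := by
  rw [← ofReal_norm, norm_eq, ENNReal.ofReal_toReal (schattenNorm_op_ne_top b)]

/-- The kernel of an operator of the Schatten-von Neumann class. -/
noncomputable def mk (K : 𝓢'(Rd d × Rd d, ℂ)) (T : H₁ →L[ℂ] H₂) (hK : HasKernel ι₁ ι₂ K T)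
    (hT : schattenNorm p T ≠ ⊤) : KernelSpace p ι₁ ι₂ :=
  ⟨K, (kernelNorm_le hK).trans_lt hT.lt_top⟩

theorem ker_mk {K : 𝓢'(Rd d × Rd d, ℂ)} {T : H₁ →L[ℂ] H₂} (hK : HasKernel ι₁ ι₂ K T)
    (hT : schattenNorm p T ≠ ⊤) : ker (mk K T hK hT) = K := rfl

theorem op_eq {b : KernelSpace p ι₁ ι₂} {T : H₁ →L[ℂ] H₂} (h : HasKernel ι₁ ι₂ (ker b) T) :
    op b = T := (hasKernel_op b).unique h

theorem op_injective : Function.Injective (op (p := p) (ι₁ := ι₁) (ι₂ := ι₂)) := fun b c h =>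
  ker_injective ((hasKernel_op b).kernel_unique (h ▸ hasKernel_op c))

theorem ofS_mem (G : 𝓢(Rd d × Rd d, ℂ)) : ofS G ∈ symbolSubmodule p ι₁ ι₂ LinearMap.id := by
  obtain ⟨r, -, h⟩ := exists_hasKernel_ofS ι₁ ι₂
  obtain ⟨T, hT, hle⟩ := h G
  exact (kernelNorm_le hT).trans_lt (((schattenNorm_le_schattenNorm_one Fact.out T).trans
    hle).trans_lt ENNReal.ofReal_lt_top)

variable (p ι₁ ι₂) in
/-- The Schwartz functions as kernels. -/
noncomputable def schwartz : 𝓢(Rd d × Rd d, ℂ) →ₗ[ℂ] KernelSpace p ι₁ ι₂ where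
  toFun G := ⟨ofS G, ofS_mem G⟩
  map_add' F G := ker_injective (ofS_add F G)
  map_smul' c G := ker_injective (ofS_smul c G)

theorem ker_schwartz (G : 𝓢(Rd d × Rd d, ℂ)) : ker (schwartz p ι₁ ι₂ G) = ofS G := rfl

theorem continuous_schwartz : Continuous (schwartz p ι₁ ι₂) := by
  obtain ⟨r, hr, h⟩ := exists_hasKernel_ofS ι₁ ι₂
  refine continuous_of_norm_le _ hr (map_zero r) fun G => ?_
  obtain ⟨T, hT, hle⟩ := h G
  rw [norm_eq, op_eq (b := schwartz p ι₁ ι₂ G) hT]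
  exact ENNReal.toReal_le_of_le_ofReal (apply_nonneg r G)
    ((schattenNorm_le_schattenNorm_one Fact.out T).trans hle)

theorem op_schwartz_tensor (ψ φ : 𝓢(Rd d, ℂ)) :
    op (schwartz p ι₁ ι₂ (tensor ψ φ)) = rankOne ℂ (emb ι₂ ψ) (dualVec ι₁ φ) :=
  op_eq (hasKernel_tensor ψ φ)

theorem exists_schwartz_op {F : H₁ →L[ℂ] H₂} (hF : F ∈ Submodule.span ℂ {F : H₁ →L[ℂ] H₂ |
      ∃ u ∈ Set.range (emb ι₂), ∃ v ∈ Set.range (dualVec ι₁), F = rankOne ℂ u v}) :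
    ∃ G, op (schwartz p ι₁ ι₂ G) = F := by
  have hle : Submodule.span ℂ {F : H₁ →L[ℂ] H₂ |
      ∃ u ∈ Set.range (emb ι₂), ∃ v ∈ Set.range (dualVec ι₁), F = rankOne ℂ u v} ≤
      LinearMap.range (op (p := p) (ι₁ := ι₁) (ι₂ := ι₂) ∘ₗ schwartz p ι₁ ι₂) := by
    refine Submodule.span_le.2 ?_
    rintro _ ⟨_, ⟨ψ, rfl⟩, _, ⟨φ, rfl⟩, rfl⟩
    exact ⟨tensor ψ φ, op_schwartz_tensor ψ φ⟩
  exact hle hF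

theorem exists_schwartz_sub_le (hp : p ≠ ⊤) {T : H₁ →L[ℂ] H₂} (hT : schattenNorm p T ≠ ⊤)
    {ε : ℝ≥0∞} (hε : ε ≠ 0) : ∃ G, schattenNorm p (T - op (schwartz p ι₁ ι₂ G)) ≤ ε := by
  obtain ⟨F, hF, h⟩ := exists_schattenNorm_sub_le Fact.out hp T hT (denseRange_dualVec ι₁)
    (denseRange_emb ι₂) hε
  obtain ⟨G, rfl⟩ := exists_schwartz_op (p := p) hF
  exact ⟨G, h⟩

/-- The vectors `emb ι₂ ψ` and `dualVec ι₁ φ` are dense, and finite rank operators built from them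
have Schwartz kernels, so the density of finite rank operators transfers. This is where `p ≠ ⊤`
matters. -/
theorem denseRange_schwartz (hp : p ≠ ⊤) : DenseRange (schwartz p ι₁ ι₂) := by
  intro b
  refine EMetric.mem_closure_iff.2 fun ε hε => ?_
  obtain ⟨δ, hδ, hδε⟩ := exists_between hε
  obtain ⟨G, hG⟩ := exists_schwartz_sub_le (ι₁ := ι₁) (ι₂ := ι₂) hp (schattenNorm_op_ne_top b) hδ.ne'
  refine ⟨_, ⟨G, rfl⟩, lt_of_le_of_lt ?_ hδε⟩
  rwa [edist_eq_enorm_sub, enorm_eq, map_sub]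

end KernelSpace

end SchattenSymbol

namespace SchattenSymbol

/-! ### Operators from bounded sesquilinear forms -/

section Representation

variable {H₁ : Type*} [NormedAddCommGroup H₁] [InnerProductSpace ℂ H₁]
  {H₂ : Type*} [NormedAddCommGroup H₂] [InnerProductSpace ℂ H₂] [CompleteSpace H₂]

/-- A bounded sesquilinear form on dense subspaces is given by a bounded operator. -/
theorem exists_operator_of_form {E₁ E₂ : Type*} [AddCommGroup E₁] [Module ℂ E₁] [AddCommGroup E₂]
    [Module ℂ E₂] {e₁ : E₁ →ₗ[ℂ] H₁} {e₂ : E₂ →ₗ[ℂ] H₂} (he₁ : DenseRange e₁)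
    (he₂ : DenseRange e₂) (β : E₁ →ₗ⋆[ℂ] E₂ →ₗ[ℂ] ℂ) {C : ℝ} (hC : 0 ≤ C)
    (hβ : ∀ φ g, ‖β φ g‖ ≤ C * ‖e₁ φ‖ * ‖e₂ g‖) :
    ∃ A : H₁ →L[ℂ] H₂, ∀ φ g, inner ℂ (A (e₁ φ)) (e₂ g) = β φ g := by
  let w : E₁ → H₂ := fun φ => (InnerProductSpace.toDual ℂ H₂).symm ((β φ).extendOfNorm e₂)
  have hw : ∀ φ g, inner ℂ (w φ) (e₂ g) = β φ g := fun φ g => by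
    rw [InnerProductSpace.toDual_symm_apply, LinearMap.extendOfNorm_eq he₂ ⟨_, hβ φ⟩]
  have hw' : ∀ φ, ‖w φ‖ ≤ C * ‖e₁ φ‖ := fun φ => by
    rw [LinearIsometryEquiv.norm_map]
    exact LinearMap.opNorm_extendOfNorm_le he₂ (by positivity) (hβ φ)
  have hext : ∀ x y : H₂, (∀ g, (inner ℂ x (e₂ g) : ℂ) = inner ℂ y (e₂ g)) → x = y := by
    intro x y h
    refine Dense.eq_of_inner_left (𝕜 := ℂ) he₂ ?_
    rintro _ ⟨g, rfl⟩
    exact h g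
  -- `β` is conjugate linear in its first variable and so is the Riesz identification; hence `W` is
  -- linear.
  let W : E₁ →ₗ[ℂ] H₂ :=
    { toFun := w
      map_add' := fun φ ψ => hext _ _ fun g => by
        rw [inner_add_left, hw, hw, hw, map_add]; rfl
      map_smul' := fun c φ => hext _ _ fun g => by
        rw [RingHom.id_apply, inner_smul_left, hw, hw, map_smulₛₗ]; rfl }
  refine ⟨W.extendOfNorm e₁, fun φ g => ?_⟩
  rw [LinearMap.extendOfNorm_eq he₁ ⟨C, hw'⟩]
  exact hw φ g

end Representation

/-! ### Algebra of the trace form -/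

section TraceForm

variable {H₁ : Type*} [NormedAddCommGroup H₁] [InnerProductSpace ℂ H₁] [CompleteSpace H₁]
  {H₂ : Type*} [NormedAddCommGroup H₂] [InnerProductSpace ℂ H₂] [CompleteSpace H₂]

theorem tracePair_conj (A T : H₁ →L[ℂ] H₂) : conj (tracePair A T) = tracePair T A := by
  rw [tracePair, Complex.conj_tsum]
  simp only [inner_conj_symm]
  rfl

theorem tracePair_rankOne_left (T : H₁ →L[ℂ] H₂) (u : H₂) (v : H₁) :
    tracePair (rankOne ℂ u v) T = conj (inner ℂ u (T v)) := by
  rw [← tracePair_rankOne, tracePair_conj]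

variable {p q : ℝ≥0∞} (h1 : 1 ≤ p) (hq1 : 1 ≤ q) (hp : p ≠ ⊤) (hpq : ENNReal.HolderConjugate p q)

include h1 hq1 hp hpq

theorem tracePair_add_left {A A' T : H₁ →L[ℂ] H₂} (hA : schattenNorm q A ≠ ⊤)
    (hA' : schattenNorm q A' ≠ ⊤) (hT : schattenNorm p T ≠ ⊤) :
    tracePair (A + A') T = tracePair A T + tracePair A' T := by
  refine HasSum.tsum_eq ?_
  convert (hasSum_tracePair h1 hq1 hp hpq hT hA).1.add (hasSum_tracePair h1 hq1 hp hpq hT hA').1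
    using 2
  rw [add_apply, inner_add_right]

theorem tracePair_add_right {A T T' : H₁ →L[ℂ] H₂} (hA : schattenNorm q A ≠ ⊤)
    (hT : schattenNorm p T ≠ ⊤) (hT' : schattenNorm p T' ≠ ⊤) :
    tracePair A (T + T') = tracePair A T + tracePair A T' := by
  refine HasSum.tsum_eq ?_
  convert (hasSum_tracePair h1 hq1 hp hpq hT hA).1.add (hasSum_tracePair h1 hq1 hp hpq hT' hA).1
    using 2
  rw [add_apply, inner_add_left]

end TraceForm

section TraceFormSMul

variable {H₁ : Type*} [NormedAddCommGroup H₁] [InnerProductSpace ℂ H₁] [CompleteSpace H₁]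
  {H₂ : Type*} [NormedAddCommGroup H₂] [InnerProductSpace ℂ H₂] [CompleteSpace H₂]

theorem tracePair_smul_left (c : ℂ) (A T : H₁ →L[ℂ] H₂) :
    tracePair (c • A) T = c * tracePair A T := by
  rw [tracePair, tracePair, ← tsum_mul_left]
  simp only [smul_apply, inner_smul_right]

theorem tracePair_smul_right (c : ℂ) (A T : H₁ →L[ℂ] H₂) :
    tracePair A (c • T) = conj c * tracePair A T := by
  rw [tracePair, tracePair, ← tsum_mul_left]
  simp only [smul_apply, inner_smul_left]

end TraceFormSMul

/-! ### The `L²` form on kernels as a trace -/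

namespace KernelSpace

variable {d : ℕ}
  {H₁ : Type*} [NormedAddCommGroup H₁] [InnerProductSpace ℂ H₁] [CompleteSpace H₁]
  {H₂ : Type*} [NormedAddCommGroup H₂] [InnerProductSpace ℂ H₂] [CompleteSpace H₂]
  {p q : ℝ≥0∞} [Fact (1 ≤ p)] [Fact (1 ≤ q)]
  {ι₁ : H₁ →ₗ[ℂ] 𝓢'(Rd d, ℂ)} [IsTempered ι₁] {ι₂ : H₂ →ₗ[ℂ] 𝓢'(Rd d, ℂ)} [IsTempered ι₂]

/-- The operator from `H₁` to `H₂` which corresponds to an operator from `H₁'` to `H₂'`. -/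
noncomputable def dualOp :
    KernelSpace q (L2Dual.incl ι₁) (L2Dual.incl ι₂) →ₗ[ℂ] H₁ →L[ℂ] H₂ :=
  (transport (L2Dual.rieszEquiv ι₁) (L2Dual.rieszEquiv ι₂)).toLinearMap ∘ₗ op

theorem dualOp_def (a : KernelSpace q (L2Dual.incl ι₁) (L2Dual.incl ι₂)) :
    dualOp a = transport (L2Dual.rieszEquiv ι₁) (L2Dual.rieszEquiv ι₂) (op a) := rfl

theorem enorm_eq_dualOp (a : KernelSpace q (L2Dual.incl ι₁) (L2Dual.incl ι₂)) :
    ‖a‖ₑ = schattenNorm q (dualOp a) := by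
  rw [enorm_eq, dualOp_def, schattenNorm_transport]

theorem schattenNorm_dualOp_ne_top (a : KernelSpace q (L2Dual.incl ι₁) (L2Dual.incl ι₂)) :
    schattenNorm q (dualOp a) ≠ ⊤ := by
  rw [← enorm_eq_dualOp]; exact enorm_ne_top

theorem rieszEquiv_emb {H : Type*} [NormedAddCommGroup H] [InnerProductSpace ℂ H] [CompleteSpace H]
    {ι : H →ₗ[ℂ] 𝓢'(Rd d, ℂ)} [IsTempered ι] (φ : 𝓢(Rd d, ℂ)) :
    L2Dual.rieszEquiv ι (emb (L2Dual.incl ι) (conjS φ)) = dualVec ι φ := by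
  rw [L2Dual.rieszEquiv_apply, L2Dual.riesz_emb, conjS_conjS]

theorem rieszEquiv_dualVec {H : Type*} [NormedAddCommGroup H] [InnerProductSpace ℂ H]
    [CompleteSpace H] {ι : H →ₗ[ℂ] 𝓢'(Rd d, ℂ)} [IsTempered ι] (φ : 𝓢(Rd d, ℂ)) :
    L2Dual.rieszEquiv ι (dualVec (L2Dual.incl ι) φ) = emb ι (conjS φ) := by
  refine ext_inner_right ℂ fun y => ?_
  obtain ⟨x, rfl⟩ := (L2Dual.rieszEquiv ι).surjective y
  rw [LinearIsometryEquiv.inner_map_map, inner_dualVec, L2Dual.rieszEquiv_apply,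
    L2Dual.inner_emb_riesz, conjS_conjS]

/-- The kernel of an operator between the `L²`-duals through the corresponding operator. -/
theorem hasKernel_transport_symm_iff {K : 𝓢'(Rd d × Rd d, ℂ)} {A : H₁ →L[ℂ] H₂} :
    HasKernel (L2Dual.incl ι₁) (L2Dual.incl ι₂) K
      ((transport (L2Dual.rieszEquiv ι₁) (L2Dual.rieszEquiv ι₂)).symm A) ↔
    ∀ φ g, inner ℂ (emb ι₂ g) (A (dualVec ι₁ φ)) = K (tensor (conjS g) (conjS φ)) := by
  have h : ∀ φ g, inner ℂ (emb ι₂ g) (A (dualVec ι₁ φ)) =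
      L2Dual.incl ι₂ ((transport (L2Dual.rieszEquiv ι₁) (L2Dual.rieszEquiv ι₂)).symm A
        (emb (L2Dual.incl ι₁) (conjS φ))) (conjS g) := by
    intro φ g
    rw [transport_symm_apply, rieszEquiv_emb, ← L2Dual.inner_emb_riesz, ← L2Dual.rieszEquiv_apply,
      LinearIsometryEquiv.apply_symm_apply]
  rw [hasKernel_iff]
  refine ⟨fun hK φ g => by rw [h, hK], fun hK φ ψ => ?_⟩
  have := (h (conjS φ) (conjS ψ)).symm.trans (hK (conjS φ) (conjS ψ))
  simpa only [conjS_conjS] using this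

theorem inner_dualOp (a : KernelSpace q (L2Dual.incl ι₁) (L2Dual.incl ι₂)) (φ g : 𝓢(Rd d, ℂ)) :
    inner ℂ (emb ι₂ g) (dualOp a (dualVec ι₁ φ)) = ker a (tensor (conjS g) (conjS φ)) := by
  refine hasKernel_transport_symm_iff.1 ?_ φ g
  rw [dualOp_def, LinearEquiv.symm_apply_apply]
  exact hasKernel_op a

/-- The Riesz maps exchange, up to conjugation, the Schwartz functions with the vectors representing
evaluations, hence the two factors of a rank one operator change roles. -/
theorem dualOp_schwartz_tensor (ψ φ : 𝓢(Rd d, ℂ)) :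
    dualOp (schwartz q (L2Dual.incl ι₁) (L2Dual.incl ι₂) (tensor ψ φ)) =
      rankOne ℂ (dualVec ι₂ (conjS ψ)) (emb ι₁ (conjS φ)) := by
  ext x
  rw [dualOp_def, op_schwartz_tensor, transport_apply, rankOne_apply, rankOne_apply, map_smul,
    ← LinearIsometryEquiv.inner_map_map (L2Dual.rieszEquiv ι₁), rieszEquiv_dualVec,
    LinearIsometryEquiv.apply_symm_apply, L2Dual.rieszEquiv_apply, L2Dual.riesz_emb]

variable (hp : p ≠ ⊤) (hpq : ENNReal.HolderConjugate p q)

include hp hpq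

theorem norm_tracePair_le (a : KernelSpace q (L2Dual.incl ι₁) (L2Dual.incl ι₂))
    (b : KernelSpace p ι₁ ι₂) : ‖tracePair (dualOp a) (op b)‖ ≤ 1 * ‖a‖ * ‖b‖ := by
  have h := (hasSum_tracePair Fact.out Fact.out hp hpq (schattenNorm_op_ne_top b)
    (schattenNorm_dualOp_ne_top a)).2
  rwa [← norm_eq, ← enorm_eq_dualOp, toReal_enorm, ← one_mul ‖a‖] at h

omit hp hpq in
/-- The `L²` form on the kernel spaces. -/
noncomputable def form (hp : p ≠ ⊤) (hpq : ENNReal.HolderConjugate p q) :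
    KernelSpace q (L2Dual.incl ι₁) (L2Dual.incl ι₂) →L[ℂ] KernelSpace p ι₁ ι₂ →L⋆[ℂ] ℂ :=
  LinearMap.mkContinuous₂ (LinearMap.mk₂'ₛₗ (RingHom.id ℂ) (starRingEnd ℂ)
    (fun a b => tracePair (dualOp a) (op b))
    (fun a a' b => by
      rw [map_add]
      exact tracePair_add_left Fact.out Fact.out hp hpq (schattenNorm_dualOp_ne_top a)
        (schattenNorm_dualOp_ne_top a') (schattenNorm_op_ne_top b))
    (fun c a b => by rw [map_smul, tracePair_smul_left]; rfl)
    (fun a b b' => by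
      rw [map_add]
      exact tracePair_add_right Fact.out Fact.out hp hpq (schattenNorm_dualOp_ne_top a)
        (schattenNorm_op_ne_top b) (schattenNorm_op_ne_top b'))
    (fun c a b => by rw [map_smul, tracePair_smul_right]; rfl)) 1 (norm_tracePair_le hp hpq)

theorem form_apply (a : KernelSpace q (L2Dual.incl ι₁) (L2Dual.incl ι₂))
    (b : KernelSpace p ι₁ ι₂) : form hp hpq a b = tracePair (dualOp a) (op b) := rfl

omit hp hpq in
/-- Two continuous conjugate linear functionals which agree on tensors agree on Schwartz
functions. -/
theorem eq_of_tensor {l l' : 𝓢(Rd d × Rd d, ℂ) → ℂ} (hl : Continuous l) (hl' : Continuous l')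
    (ha : ∀ F G, l (F + G) = l F + l G) (ha' : ∀ F G, l' (F + G) = l' F + l' G)
    (hs : ∀ (c : ℂ) G, l (c • G) = conj c * l G) (hs' : ∀ (c : ℂ) G, l' (c • G) = conj c * l' G)
    (h : ∀ ψ φ, l (tensor ψ φ) = l' (tensor ψ φ)) (G : 𝓢(Rd d × Rd d, ℂ)) : l G = l' G := by
  let f : 𝓢(Rd d × Rd d, ℂ) →+ ℂ := ⟨⟨l, by simpa using hs 0 0⟩, ha⟩
  let f' : 𝓢(Rd d × Rd d, ℂ) →+ ℂ := ⟨⟨l', by simpa using hs' 0 0⟩, ha'⟩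
  have e1 := (hasSum_tensor G).map f hl
  have e2 := (hasSum_tensor G).map f' hl'
  have e : f ∘ (fun j => tensorCoeff j G • tensor (leftAtom j) (rightAtom j)) =
      f' ∘ fun j => tensorCoeff j G • tensor (leftAtom j) (rightAtom j) := funext fun j => by
    change l _ = l' _
    rw [hs, hs', h]
  rw [e] at e1
  exact e1.unique e2

/-- At a tensor the trace is a matrix element of `dualOp a`, which is the value of the kernel of `a`
at the conjugate tensor. Both sides are continuous and conjugate linear in `G`, so tensors decide.
The trace form thereby depends on `a` only through its distribution. -/
theorem form_schwartz (a : KernelSpace q (L2Dual.incl ι₁) (L2Dual.incl ι₂))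
    (G : 𝓢(Rd d × Rd d, ℂ)) : form hp hpq a (schwartz p ι₁ ι₂ G) = ker a (conjS G) := by
  refine eq_of_tensor (l := fun G => form hp hpq a (schwartz p ι₁ ι₂ G))
    (l' := fun G => ker a (conjS G)) ((form hp hpq a).continuous.comp continuous_schwartz)
    ((ker a).continuous.comp continuous_conjS) (fun F G => by rw [map_add, map_add])
    (fun F G => by rw [conjS_add, map_add]) (fun c G => by rw [map_smul, map_smulₛₗ]; rfl)
    (fun c G => by rw [conjS_smul, map_smul]; rfl) (fun ψ φ => ?_) G
  rw [form_apply, op_schwartz_tensor, tracePair_rankOne, inner_dualOp, conjS_tensor]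

theorem form_schwartz_schwartz (F G : 𝓢(Rd d × Rd d, ℂ)) :
    form hp hpq (schwartz q (L2Dual.incl ι₁) (L2Dual.incl ι₂) F) (schwartz p ι₁ ι₂ G) =
      ∫ z, F z * conj (G z) := by
  rw [form_schwartz, ker_schwartz, ofS_apply]
  rfl

omit hp hpq in
theorem eq_schwartz_of_ker {a : KernelSpace p ι₁ ι₂} {G : 𝓢(Rd d × Rd d, ℂ)} (h : ker a = ofS G) :
    a = schwartz p ι₁ ι₂ G := ker_injective h

theorem extendsL2Form_form : ExtendsL2Form (form (ι₁ := ι₁) (ι₂ := ι₂) hp hpq) := by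
  intro φ ψ a b ha hb
  rw [eq_schwartz_of_ker ha, eq_schwartz_of_ker hb, form_schwartz_schwartz]

omit hp hpq in
theorem extends_iff {B : KernelSpace q (L2Dual.incl ι₁) (L2Dual.incl ι₂) →L[ℂ]
    KernelSpace p ι₁ ι₂ →L⋆[ℂ] ℂ} (hB : ExtendsL2Form B) (F G : 𝓢(Rd d × Rd d, ℂ)) :
    B (schwartz q (L2Dual.incl ι₁) (L2Dual.incl ι₂) F) (schwartz p ι₁ ι₂ G) =
      ∫ z, F z * conj (G z) := hB F G _ _ rfl rfl

/-- A continuous extension of the `L²` form is determined by its values for one Schwartz function. -/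
theorem eq_form_of_schwartz {B : KernelSpace q (L2Dual.incl ι₁) (L2Dual.incl ι₂) →L[ℂ]
    KernelSpace p ι₁ ι₂ →L⋆[ℂ] ℂ} (h : ∀ a G, B a (schwartz p ι₁ ι₂ G) =
      form hp hpq a (schwartz p ι₁ ι₂ G)) : B = form hp hpq := by
  ext a b
  exact congrFun ((denseRange_schwartz hp).equalizer (B a).continuous
    (form hp hpq a).continuous (funext fun G => h a G)) b

/-- For `p > 1` both orders are finite, so the Schwartz kernels are dense on either side. -/
theorem eq_form_of_one_lt (h1 : 1 < p) {B : KernelSpace q (L2Dual.incl ι₁) (L2Dual.incl ι₂) →L[ℂ]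
    KernelSpace p ι₁ ι₂ →L⋆[ℂ] ℂ} (hB : ExtendsL2Form B) : B = form hp hpq := by
  have hq : q ≠ ⊤ := fun h => h1.ne' ((ENNReal.HolderConjugate.eq_top_iff_eq_one q p).1 h)
  refine eq_form_of_schwartz hp hpq fun a G => ?_
  refine congrFun ((denseRange_schwartz hq).equalizer
    (g := fun a => B a (schwartz p ι₁ ι₂ G)) (h := fun a => form hp hpq a (schwartz p ι₁ ι₂ G))
    (by fun_prop) (by fun_prop) (funext fun F => ?_)) a
  exact (extends_iff hB F G).trans (form_schwartz_schwartz hp hpq F G).symm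

/-- Tensor kernels in the first argument recover, up to conjugation, the values of the distribution
`b` at tensors, and these determine it. -/
theorem eq_zero_of_form_eq_zero {b : KernelSpace p ι₁ ι₂} (h : ∀ a, form hp hpq a b = 0) :
    b = 0 := by
  refine ker_injective (distribution_ext_tensor fun ψ φ => ?_)
  have h' := h (schwartz q (L2Dual.incl ι₁) (L2Dual.incl ι₂) (tensor (conjS ψ) (conjS φ)))
  rw [form_apply, dualOp_schwartz_tensor, tracePair_rankOne_left, map_eq_zero, conjS_conjS,
    conjS_conjS, inner_dualVec, hasKernel_iff.1 (hasKernel_op b)] at h'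
  rw [h', map_zero]
  rfl

theorem eq_of_form_eq {a a' : KernelSpace q (L2Dual.incl ι₁) (L2Dual.incl ι₂)}
    (h : ∀ b, form hp hpq a b = form hp hpq a' b) : a = a' := by
  refine ker_injective ?_
  ext G
  have := h (schwartz p ι₁ ι₂ (conjS G))
  rwa [form_schwartz, form_schwartz, conjS_conjS] at this

end KernelSpace

end SchattenSymbol

namespace SchattenSymbol

/-! ### Norms of block operators and finite rank perturbations -/

section Corner

variable {H₁ : Type*} [NormedAddCommGroup H₁] [InnerProductSpace ℂ H₁]
  {H₂ : Type*} [NormedAddCommGroup H₂] [InnerProductSpace ℂ H₂]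

theorem norm_complProj_sq {e : H₁} (he : ‖e‖ = 1) (x : H₁) :
    ‖complProj (fun _ : Unit => e) x‖ ^ 2 + ‖(inner ℂ e x : ℂ)‖ ^ 2 = ‖x‖ ^ 2 := by
  have ho : Orthonormal ℂ fun _ : Unit => e := ⟨fun _ => he, fun i j hij => (hij rfl).elim⟩
  have h : x = complProj (fun _ : Unit => e) x + (inner ℂ e x : ℂ) • e := by
    simp [complProj_apply]
  have h0 : (inner ℂ (complProj (fun _ : Unit => e) x) ((inner ℂ e x : ℂ) • e) : ℂ) = 0 := by
    rw [inner_smul_right, inner_eq_zero_symm.1 (inner_complProj_right ho () x), mul_zero]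
  conv_rhs => rw [h]
  rw [sq, sq, sq, norm_add_sq_eq_norm_sq_add_norm_sq_of_inner_eq_zero _ _ h0, norm_smul, he, mul_one]

/-- The norm of a block operator one of whose blocks has rank one. -/
theorem norm_complProj_comp_add_rankOne_le (A : H₁ →L[ℂ] H₂) {e : H₁} {f : H₂} (he : ‖e‖ = 1)
    (hf : ‖f‖ = 1) {z : ℂ} (hz : ‖A‖ ≤ ‖z‖) :
    ‖complProj (fun _ : Unit => f) ∘L A ∘L complProj (fun _ : Unit => e) + z • rankOne ℂ f e‖ ≤
      ‖z‖ := by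
  have hfo : Orthonormal ℂ fun _ : Unit => f := ⟨fun _ => hf, fun i j hij => (hij rfl).elim⟩
  refine ContinuousLinearMap.opNorm_le_bound _ (norm_nonneg _) fun x => ?_
  set y := complProj (fun _ : Unit => e) x with hy
  set w := complProj (fun _ : Unit => f) (A y) with hw
  have hw1 : ‖w‖ ≤ ‖z‖ * ‖y‖ := by
    have h1 := norm_complProj_sq hf (A y)
    have h2 : ‖w‖ ≤ ‖A y‖ := by
      refine (pow_le_pow_iff_left₀ (norm_nonneg _) (norm_nonneg _) two_ne_zero).1 ?_
      nlinarith [sq_nonneg ‖(inner ℂ f (A y) : ℂ)‖]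
    exact h2.trans ((A.le_opNorm y).trans (by gcongr))
  have h0 : (inner ℂ w ((z * inner ℂ e x : ℂ) • f) : ℂ) = 0 := by
    rw [inner_smul_right, inner_eq_zero_symm.1 (inner_complProj_right hfo () (A y)), mul_zero]
  have happ : (complProj (fun _ : Unit => f) ∘L A ∘L complProj (fun _ : Unit => e) +
      z • rankOne ℂ f e) x = w + (z * inner ℂ e x : ℂ) • f := by
    simp [hw, hy, smul_smul]
  rw [happ]
  refine (pow_le_pow_iff_left₀ (norm_nonneg _) (by positivity) two_ne_zero).1 ?_
  have h3 := norm_add_sq_eq_norm_sq_add_norm_sq_of_inner_eq_zero _ _ h0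
  rw [norm_smul, norm_mul, hf, mul_one] at h3
  have h4 := norm_complProj_sq he x
  have h5 : ‖w‖ * ‖w‖ ≤ (‖z‖ * ‖y‖) * (‖z‖ * ‖y‖) := mul_self_le_mul_self (norm_nonneg _) hw1
  rw [sq, h3, mul_pow, ← h4]
  nlinarith

end Corner

section Sums

variable {H₁ : Type*} [NormedAddCommGroup H₁] [InnerProductSpace ℂ H₁]
  {H₂ : Type*} [NormedAddCommGroup H₂] [InnerProductSpace ℂ H₂]

theorem schattenNorm_neg_le (p : ℝ≥0∞) (T : H₁ →L[ℂ] H₂) :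
    schattenNorm p (-T) ≤ schattenNorm p T := by
  simpa using schattenNorm_smul_le (p := p) (-1) T

/-- By `sub_complProj_comp` the difference has finite rank, so it can be approximated by operators
with Schwartz kernels even though `A` may not be. -/
theorem schattenNorm_complProj_sub_ne_top [CompleteSpace H₁] [CompleteSpace H₂] {p : ℝ≥0∞}
    (h1 : 1 ≤ p) (A : H₁ →L[ℂ] H₂) (e : H₁) (f : H₂) (z : ℂ) :
    schattenNorm p (complProj (fun _ : Unit => f) ∘L A ∘L complProj (fun _ : Unit => e) +
      z • rankOne ℂ f e - A) ≠ ⊤ := by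
  have hr : ∀ (u : H₂) (v : H₁), schattenNorm p (rankOne ℂ u v) < ⊤ := fun u v =>
    (schattenNorm_rankOne_le h1 u v).trans_lt (ENNReal.mul_lt_top enorm_lt_top enorm_lt_top)
  have e0 : complProj (fun _ : Unit => f) ∘L A ∘L complProj (fun _ : Unit => e) +
      z • rankOne ℂ f e - A =
      -(A - complProj (fun _ : Unit => f) ∘L A ∘L complProj (fun _ : Unit => e)) +
      z • rankOne ℂ f e := by abel
  rw [e0, sub_complProj_comp]
  refine ((schattenNorm_add_le h1 _ _).trans_lt (ENNReal.add_lt_top.2 ⟨?_, ?_⟩)).ne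
  · refine (schattenNorm_neg_le _ _).trans_lt ((schattenNorm_add_le h1 _ _).trans_lt
      (ENNReal.add_lt_top.2 ⟨?_, ?_⟩))
    · simpa using hr _ _
    · simpa using hr _ _
  · exact (schattenNorm_smul_le _ _).trans_lt (ENNReal.mul_lt_top enorm_lt_top (hr _ _))

theorem schattenNorm_sum_le {p : ℝ≥0∞} (h1 : 1 ≤ p) {α : Type*} (s : Finset α)
    (T : α → H₁ →L[ℂ] H₂) : schattenNorm p (∑ i ∈ s, T i) ≤ ∑ i ∈ s, schattenNorm p (T i) := by
  classical
  induction s using Finset.induction_on with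
  | empty => simp [schattenNorm_zero]
  | insert i s hi ih =>
    rw [Finset.sum_insert hi, Finset.sum_insert hi]
    exact (schattenNorm_add_le h1 _ _).trans (add_le_add le_rfl ih)

end Sums

/-! ### Uniqueness of the form and representation of functionals -/

namespace KernelSpace

variable {d : ℕ}
  {H₁ : Type*} [NormedAddCommGroup H₁] [InnerProductSpace ℂ H₁] [CompleteSpace H₁]
  {H₂ : Type*} [NormedAddCommGroup H₂] [InnerProductSpace ℂ H₂] [CompleteSpace H₂]
  {p q : ℝ≥0∞} [Fact (1 ≤ p)] [Fact (1 ≤ q)]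
  {ι₁ : H₁ →ₗ[ℂ] 𝓢'(Rd d, ℂ)} [IsTempered ι₁] {ι₂ : H₂ →ₗ[ℂ] 𝓢'(Rd d, ℂ)} [IsTempered ι₂]

theorem hasKernel_op_schwartz (G : 𝓢(Rd d × Rd d, ℂ)) :
    HasKernel ι₁ ι₂ (ofS G) (op (schwartz p ι₁ ι₂ G)) := by
  have h := hasKernel_op (schwartz p ι₁ ι₂ G)
  rwa [ker_schwartz] at h

theorem op_schwartz_eq (G : 𝓢(Rd d × Rd d, ℂ)) :
    op (schwartz p ι₁ ι₂ G) = op (schwartz q ι₁ ι₂ G) :=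
  (hasKernel_op_schwartz G).unique (hasKernel_op_schwartz G)

/-- Operators of finite rank are approximated by operators with Schwartz kernels. -/
theorem exists_schwartz_sub_dualOp_le {X : H₁ →L[ℂ] H₂} (hX : schattenNorm 1 X ≠ ⊤)
    {ε : ℝ≥0∞} (hε : ε ≠ 0) : ∃ G, schattenNorm q
      (dualOp (schwartz q (L2Dual.incl ι₁) (L2Dual.incl ι₂) G) - X) ≤ ε := by
  set e := transport (L2Dual.rieszEquiv ι₁) (L2Dual.rieszEquiv ι₂)
  have hX' : schattenNorm 1 (e.symm X) ≠ ⊤ := by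
    rwa [← schattenNorm_transport 1 (L2Dual.rieszEquiv ι₁) (L2Dual.rieszEquiv ι₂),
      LinearEquiv.apply_symm_apply]
  -- The approximation takes place in trace norm, which dominates the norm of order `q`; this makes
  -- `q = ∞` admissible.
  obtain ⟨G, hG⟩ := exists_schwartz_sub_le (p := 1) (ι₁ := L2Dual.incl ι₁) (ι₂ := L2Dual.incl ι₂)
    ENNReal.one_ne_top hX' hε
  refine ⟨G, (schattenNorm_le_schattenNorm_one Fact.out _).trans ?_⟩
  rw [← schattenNorm_transport 1 (L2Dual.rieszEquiv ι₁) (L2Dual.rieszEquiv ι₂), map_sub,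
    LinearEquiv.apply_symm_apply] at hG
  rw [dualOp_def, op_schwartz_eq (q := 1), ← neg_sub]
  exact (schattenNorm_neg_le _ _).trans hG

variable (hp : p ≠ ⊤) (hpq : ENNReal.HolderConjugate p q)

include hp hpq

/-- For `p = 1`, the bound singles out the extension. -/
theorem eq_form_of_norm_le (hq : q = ⊤) {B : KernelSpace q (L2Dual.incl ι₁) (L2Dual.incl ι₂) →L[ℂ]
    KernelSpace p ι₁ ι₂ →L⋆[ℂ] ℂ} (hB : ExtendsL2Form B) (hle : ∀ a b, ‖B a b‖ ≤ 1 * ‖a‖ * ‖b‖) :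
    B = form hp hpq := by
  -- It suffices to treat `b` of rank one, where both its norm and its pairing with `a` are
  -- explicit.
  have htensor : ∀ a ψ φ, B a (schwartz p ι₁ ι₂ (tensor ψ φ)) =
      form hp hpq a (schwartz p ι₁ ι₂ (tensor ψ φ)) := by
    intro a ψ φ
    set b := schwartz p ι₁ ι₂ (tensor ψ φ) with hb
    set u := emb ι₂ ψ
    set v := dualVec ι₁ φ
    have hop : op b = rankOne ℂ u v := op_schwartz_tensor ψ φ
    have hnb : ‖b‖ ≤ ‖u‖ * ‖v‖ := by
      rw [norm_eq, hop]
      refine ENNReal.toReal_le_of_le_ofReal (by positivity) ?_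
      rw [ENNReal.ofReal_mul (norm_nonneg _), ofReal_norm, ofReal_norm]
      exact schattenNorm_rankOne_le Fact.out u v
    rcases eq_or_ne b 0 with h0 | h0
    · rw [h0, map_zero, map_zero]
    have hu : 0 < ‖u‖ := by
      refine norm_pos_iff.2 fun h => h0 (op_injective ?_)
      rw [hop, h]; simp
    have hv : 0 < ‖v‖ := by
      refine norm_pos_iff.2 fun h => h0 (op_injective ?_)
      rw [hop, h]; simp
    set δ := B a b - form hp hpq a b with hδ
    set A := dualOp a with hA
    -- the difference of the forms seen through perturbations of finite rank
    have hpert : ∀ X : H₁ →L[ℂ] H₂, schattenNorm 1 X ≠ ⊤ →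
        ‖δ + inner ℂ u ((A + X) v)‖ ≤ ‖A + X‖ * (‖u‖ * ‖v‖) := by
      intro X hX
      refine le_of_forall_pos_le_add fun ε hε => ?_
      obtain ⟨η, hη, hηε⟩ : ∃ η : ℝ, 0 < η ∧ 2 * η * (‖u‖ * ‖v‖) ≤ ε :=
        ⟨ε / (2 * (‖u‖ * ‖v‖)), by positivity, le_of_eq (by field_simp)⟩
      obtain ⟨G, hG⟩ := exists_schwartz_sub_dualOp_le (q := q) (ι₁ := ι₁) (ι₂ := ι₂) hX
        (ENNReal.ofReal_pos.2 hη).ne'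
      set x := schwartz q (L2Dual.incl ι₁) (L2Dual.incl ι₂) G
      have hx : B x b = form hp hpq x b :=
        (extends_iff hB G _).trans (form_schwartz_schwartz hp hpq G _).symm
      have hform : ∀ c, form hp hpq c b = inner ℂ u (dualOp c v) := fun c => by
        rw [form_apply, hop, tracePair_rankOne]
      -- The operator of `a + x` is `A + X` up to an error `η`, and for `q = ∞` the norm is at most
      -- the operator norm.
      have h1 : ‖B (a + x) b‖ ≤ (‖A + X‖ + η) * (‖u‖ * ‖v‖) := by
        refine (hle _ _).trans ?_
        rw [one_mul]
        refine mul_le_mul ?_ hnb (norm_nonneg _) (by positivity)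
        have h2 : ‖a + x‖ₑ ≤ ENNReal.ofReal (‖A + X‖ + η) := by
          rw [enorm_eq_dualOp, map_add, ENNReal.ofReal_add (norm_nonneg _) hη.le, ofReal_norm,
            show A + dualOp x = (A + X) + (dualOp x - X) by abel]
          refine (schattenNorm_add_le Fact.out _ _).trans (add_le_add ?_ hG)
          rw [hq]
          exact schattenNorm_top_le_opNorm _
        rw [← ofReal_norm] at h2
        exact (ENNReal.ofReal_le_ofReal_iff (by positivity)).1 h2
      have h3 : ‖(inner ℂ u ((dualOp x - X) v) : ℂ)‖ ≤ η * (‖u‖ * ‖v‖) := by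
        have h4 := (hasSum_tracePair Fact.out Fact.out hp hpq (schattenNorm_op_ne_top b)
          (ne_top_of_le_ne_top ENNReal.ofReal_ne_top hG)).2
        rw [hop, tracePair_rankOne] at h4
        refine h4.trans (mul_le_mul (ENNReal.toReal_le_of_le_ofReal hη.le hG) ?_
          ENNReal.toReal_nonneg hη.le)
        rw [← hop, ← norm_eq]; exact hnb
      -- The two forms agree at the Schwartz kernel `x`, so passing from `a` to `a + x` leaves the
      -- discrepancy equal to `δ`.
      have h5 : δ + inner ℂ u ((A + X) v) = B (a + x) b - inner ℂ u ((dualOp x - X) v) := by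
        have e1 : B (a + x) b = B a b + B x b := by rw [map_add, add_apply]
        rw [e1, hx, hδ, hform a, hform x, add_apply, sub_apply, inner_add_right, inner_sub_right]
        ring
      rw [h5]
      refine (norm_sub_le _ _).trans ((add_le_add h1 h3).trans ?_)
      linarith
    set e : H₁ := ((‖v‖⁻¹ : ℝ) : ℂ) • v
    set f : H₂ := ((‖u‖⁻¹ : ℝ) : ℂ) • u
    have he : ‖e‖ = 1 := by simp [e, norm_smul, hv.ne']
    have hf : ‖f‖ = 1 := by simp [f, norm_smul, hu.ne']
    by_contra hne
    have hδ0 : 0 < ‖δ‖ := norm_pos_iff.2 (sub_ne_zero.2 hne)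
    -- a large multiple of `f ⊗ e*` in the direction of `δ`
    obtain ⟨s, hs, hsA⟩ : ∃ s : ℝ, 0 < s ∧ ‖A‖ ≤ s * ‖δ‖ :=
      ⟨‖A‖ / ‖δ‖ + 1, by positivity, by
        rw [add_mul, div_mul_cancel₀ _ hδ0.ne']; nlinarith⟩
    set z : ℂ := s * δ
    have hz : ‖z‖ = s * ‖δ‖ := by simp [z, abs_of_pos hs]
    set Y := complProj (fun _ : Unit => f) ∘L A ∘L complProj (fun _ : Unit => e) +
      z • rankOne ℂ f e with hY
    have hYX : schattenNorm 1 (Y - A) ≠ ⊤ := schattenNorm_complProj_sub_ne_top le_rfl A e f z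
    have hYv : inner ℂ u (Y v) = z * (‖u‖ * ‖v‖) := by
      have hu' : (‖u‖ : ℂ) ≠ 0 := by exact_mod_cast hu.ne'
      have hv' : (‖v‖ : ℂ) ≠ 0 := by exact_mod_cast hv.ne'
      have e1 : (inner ℂ e v : ℂ) = ‖v‖ := by
        rw [inner_smul_left, inner_self_eq_norm_sq_to_K, Complex.conj_ofReal, Complex.ofReal_inv]
        change _ * (‖v‖ : ℂ) ^ 2 = _
        field_simp
      have e2 : (inner ℂ u f : ℂ) = ‖u‖ := by
        rw [inner_smul_right, inner_self_eq_norm_sq_to_K, Complex.ofReal_inv]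
        change _ * (‖u‖ : ℂ) ^ 2 = _
        field_simp
      have e3 : complProj (fun _ : Unit => e) v = 0 := by
        rw [complProj_apply]
        simp only [Finset.univ_unique, Finset.sum_const, Finset.card_singleton, one_smul, e1]
        rw [smul_smul, Complex.ofReal_inv, mul_inv_cancel₀ hv', one_smul, sub_self]
      have e4 : Y v = (z * ‖v‖) • f := by
        rw [hY, add_apply, ContinuousLinearMap.comp_apply, ContinuousLinearMap.comp_apply, e3,
          map_zero, map_zero, zero_add, smul_apply, rankOne_apply, e1, smul_smul]
      rw [e4, inner_smul_right, e2]
      ring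
    have h := hpert (Y - A) hYX
    rw [add_sub_cancel, hYv] at h
    -- Since `z` is a positive multiple of `δ`, the two terms add up without cancellation. The norm
    -- of `Y` is at most `‖z‖`, so `hpert` yields `‖δ‖ + ‖z‖ ‖u‖ ‖v‖ ≤ ‖z‖ ‖u‖ ‖v‖`, which is
    -- absurd.
    have h6 : ‖δ + z * (‖u‖ * ‖v‖)‖ = ‖δ‖ + ‖z‖ * (‖u‖ * ‖v‖) := by
      have : δ + z * (‖u‖ * ‖v‖) = ((1 + s * (‖u‖ * ‖v‖) : ℝ) : ℂ) * δ := by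
        simp only [z]; push_cast; ring
      rw [this, norm_mul, Complex.norm_real, Real.norm_of_nonneg (by positivity), hz]
      ring
    rw [h6] at h
    have h7 := norm_complProj_comp_add_rankOne_le A he hf (z := z) (by rw [hz]; exact hsA)
    nlinarith [mul_pos hu hv]
  refine eq_form_of_schwartz hp hpq fun a G => ?_
  refine eq_of_tensor (l := fun G => B a (schwartz p ι₁ ι₂ G))
    (l' := fun G => form hp hpq a (schwartz p ι₁ ι₂ G)) ((B a).continuous.comp continuous_schwartz)
    ((form hp hpq a).continuous.comp continuous_schwartz) (fun F G => by rw [map_add, map_add])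
    (fun F G => by rw [map_add, map_add]) (fun c G => by rw [map_smul, map_smulₛₗ]; rfl)
    (fun c G => by rw [map_smul, map_smulₛₗ]; rfl) (htensor a) G

/-- The norm of a functional on the kernels of operators bounds the norm of the operator which
represents it. -/
theorem schattenNorm_le_of_functional (ℓ : KernelSpace p ι₁ ι₂ →L[ℂ] ℂ) (A : H₁ →L[ℂ] H₂)
    (h : ∀ ψ φ, conj (ℓ (schwartz p ι₁ ι₂ (tensor ψ φ))) = inner ℂ (emb ι₂ ψ) (A (dualVec ι₁ φ))) :
    schattenNorm q A ≤ ‖ℓ‖ₑ := by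
  refine schattenNorm_le_of_forall_sum Fact.out hp hpq fun α _ f g c hf hg => ?_
  set N : ℝ≥0∞ := (∑ i, ‖c i‖ₑ ^ p.toReal) ^ (1 / p.toReal) with hN
  have hNt : N ≠ ⊤ := by
    refine ENNReal.rpow_ne_top_of_nonneg (by positivity) (ENNReal.sum_ne_top.2 fun i _ => ?_)
    exact ENNReal.rpow_ne_top_of_nonneg ENNReal.toReal_nonneg enorm_ne_top
  -- The families `f`, `g` are arbitrary, while the hypothesis on `ℓ` concerns Schwartz tensors
  -- only. The estimate is proved with an error `D w` for `w` in the dense set of such vectors, and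
  -- passes to `(g, f)`, where `D` vanishes, because `P` is closed.
  let D : (α → H₂) × (α → H₁) → ℝ := fun w =>
    ∑ i, ‖c i‖ * (‖g i - w.1 i‖ * ‖f i‖ + ‖w.1 i‖ * ‖f i - w.2 i‖)
  have hD0 : ∀ w, 0 ≤ D w := fun w => Finset.sum_nonneg fun i _ => by positivity
  let P : Set ((α → H₂) × (α → H₁)) :=
    {w | ‖∑ i, c i * inner ℂ (w.1 i) (A (w.2 i))‖ ≤ ‖ℓ‖ * (N.toReal + D w)}
  have hcl : IsClosed P := isClosed_le (by fun_prop) (by fun_prop)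
  have hdense : Dense ((Set.univ.pi fun _ => Set.range (emb ι₂)) ×ˢ
      (Set.univ.pi fun _ => Set.range (dualVec ι₁)) : Set ((α → H₂) × (α → H₁))) :=
    (dense_pi _ fun _ _ => denseRange_emb ι₂).prod (dense_pi _ fun _ _ => denseRange_dualVec ι₁)
  have hsub : ((Set.univ.pi fun _ => Set.range (emb ι₂)) ×ˢ
      (Set.univ.pi fun _ => Set.range (dualVec ι₁)) : Set ((α → H₂) × (α → H₁))) ⊆ P := by
    rintro ⟨w₁, w₂⟩ ⟨hw₁, hw₂⟩
    choose ψ hψ using fun i => hw₁ i (Set.mem_univ i)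
    choose φ hφ using fun i => hw₂ i (Set.mem_univ i)
    simp only at hψ hφ
    obtain rfl : (fun i => emb ι₂ (ψ i)) = w₁ := funext hψ
    obtain rfl : (fun i => dualVec ι₁ (φ i)) = w₂ := funext hφ
    set b := ∑ i, conj (c i) • schwartz p ι₁ ι₂ (tensor (ψ i) (φ i)) with hb
    have e1 : ∑ i, c i * inner ℂ (emb ι₂ (ψ i)) (A (dualVec ι₁ (φ i))) = conj (ℓ b) := by
      rw [hb, map_sum, map_sum]
      refine Finset.sum_congr rfl fun i _ => ?_
      rw [map_smul, smul_eq_mul, map_mul, Complex.conj_conj, h]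
    change ‖∑ i, c i * inner ℂ (emb ι₂ (ψ i)) (A (dualVec ι₁ (φ i)))‖ ≤ _
    rw [e1, RCLike.norm_conj]
    refine (ℓ.le_opNorm b).trans ?_
    gcongr
    rw [norm_eq]
    refine ENNReal.toReal_le_of_le_ofReal (add_nonneg ENNReal.toReal_nonneg (hD0 _)) ?_
    rw [ENNReal.ofReal_add ENNReal.toReal_nonneg (hD0 _), ENNReal.ofReal_toReal hNt]
    -- The operator of `b` is the exact diagonal operator, whose norm is at most the `ℓᵖ` norm of
    -- `c`, up to rank one errors accounted for by `D`.
    have e2 : op b = ∑ i, conj (c i) • rankOne ℂ (g i) (f i) -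
        ∑ i, conj (c i) • (rankOne ℂ (g i - emb ι₂ (ψ i)) (f i) +
          rankOne ℂ (emb ι₂ (ψ i)) (f i - dualVec ι₁ (φ i))) := by
      rw [hb, map_sum, ← Finset.sum_sub_distrib]
      refine Finset.sum_congr rfl fun i _ => ?_
      rw [map_smul, op_schwartz_tensor, ← smul_sub]
      simp
    rw [e2, sub_eq_add_neg, ← Finset.sum_neg_distrib]
    refine (schattenNorm_add_le Fact.out _ _).trans (add_le_add ?_ ?_)
    · refine (schattenNorm_sum_rankOne_le Fact.out hp hf hg _).trans (le_of_eq ?_)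
      simp [hN, ← ofReal_norm]
    · refine (schattenNorm_sum_le Fact.out _ _).trans ?_
      rw [ENNReal.ofReal_sum_of_nonneg fun i _ => by positivity]
      refine Finset.sum_le_sum fun i _ => ?_
      rw [← neg_smul]
      refine (schattenNorm_smul_le _ _).trans ?_
      rw [ENNReal.ofReal_mul (norm_nonneg _), enorm_neg, ← ofReal_norm, RCLike.norm_conj,
        ENNReal.ofReal_add (by positivity) (by positivity), ENNReal.ofReal_mul (norm_nonneg _),
        ENNReal.ofReal_mul (norm_nonneg _)]
      simp only [ofReal_norm]
      gcongr
      exact (schattenNorm_add_le Fact.out _ _).trans (add_le_add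
        (schattenNorm_rankOne_le Fact.out _ _) (schattenNorm_rankOne_le Fact.out _ _))
  have hP : (g, f) ∈ P := hcl.closure_subset_iff.2 hsub (hdense _)
  have hD : D (g, f) = 0 := by simp [D]
  change ‖∑ i, c i * inner ℂ (g i) (A (f i))‖ ≤ ‖ℓ‖ * (N.toReal + D (g, f)) at hP
  rw [hD, add_zero] at hP
  calc _ = ENNReal.ofReal ‖∑ i, c i * (inner ℂ (g i) (A (f i)) : ℂ)‖ := (ofReal_norm _).symm
    _ ≤ ENNReal.ofReal (‖ℓ‖ * N.toReal) := ENNReal.ofReal_le_ofReal hP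
    _ = _ := by
      rw [ENNReal.ofReal_mul (norm_nonneg _), ofReal_norm, ENNReal.ofReal_toReal hNt]

/-- Every functional is represented by a kernel. -/
theorem exists_form_eq (ℓ : KernelSpace p ι₁ ι₂ →L[ℂ] ℂ) :
    ∃ a, ∀ b, conj (ℓ b) = form hp hpq a b := by
  have hadd : ∀ ψ ψ' φ : 𝓢(Rd d, ℂ), tensor (ψ + ψ') φ = tensor ψ φ + tensor ψ' φ :=
    fun _ _ _ => by ext z; exact add_mul _ _ _
  have hadd' : ∀ ψ φ φ' : 𝓢(Rd d, ℂ), tensor ψ (φ + φ') = tensor ψ φ + tensor ψ φ' :=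
    fun _ _ _ => by ext z; exact mul_add _ _ _
  have hsmul : ∀ (c : ℂ) (ψ φ : 𝓢(Rd d, ℂ)), tensor (c • ψ) φ = c • tensor ψ φ :=
    fun _ _ _ => by ext z; exact mul_assoc _ _ _
  have hsmul' : ∀ (c : ℂ) (ψ φ : 𝓢(Rd d, ℂ)), tensor ψ (c • φ) = c • tensor ψ φ :=
    fun _ _ _ => by ext z; exact mul_left_comm _ _ _
  let β : 𝓢(Rd d, ℂ) →ₗ⋆[ℂ] 𝓢(Rd d, ℂ) →ₗ[ℂ] ℂ := LinearMap.mk₂'ₛₗ (starRingEnd ℂ) (RingHom.id ℂ)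
    (fun φ ψ => ℓ (schwartz p ι₁ ι₂ (tensor ψ (conjS φ))))
    (fun _ _ _ => by rw [conjS_add, hadd', map_add, map_add])
    (fun _ _ _ => by rw [conjS_smul, hsmul', map_smul, map_smul])
    (fun _ _ _ => by rw [hadd, map_add, map_add])
    (fun _ _ _ => by rw [hsmul, map_smul, map_smul]; rfl)
  -- `dualVec` is conjugate linear; its composition with conjugation, the Riesz image of Schwartz
  -- functions in `H₁'`, is linear as required by `exists_operator_of_form`.
  let e₁ : 𝓢(Rd d, ℂ) →ₗ[ℂ] H₁ := (L2Dual.riesz ι₁) ∘ₗ emb (L2Dual.incl ι₁)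
  have he₁ : ∀ φ, e₁ φ = dualVec ι₁ (conjS φ) := fun φ => L2Dual.riesz_emb ι₁ φ
  have hde₁ : DenseRange e₁ := by
    have : Set.range e₁ = Set.range (dualVec ι₁) := by
      ext x
      constructor
      · rintro ⟨φ, rfl⟩; exact ⟨_, (he₁ φ).symm⟩
      · rintro ⟨φ, rfl⟩; exact ⟨conjS φ, by rw [he₁, conjS_conjS]⟩
    rw [DenseRange, this]
    exact denseRange_dualVec ι₁
  obtain ⟨A, hA⟩ := exists_operator_of_form hde₁ (denseRange_emb ι₂) β (norm_nonneg ℓ)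
    fun φ ψ => by
      refine (ℓ.le_opNorm _).trans ?_
      rw [mul_assoc]
      gcongr
      rw [norm_eq, op_schwartz_tensor, he₁]
      refine ENNReal.toReal_le_of_le_ofReal (by positivity) ?_
      rw [ENNReal.ofReal_mul (norm_nonneg _), ofReal_norm, ofReal_norm, mul_comm]
      exact schattenNorm_rankOne_le Fact.out _ _
  have hA' : ∀ ψ φ, conj (ℓ (schwartz p ι₁ ι₂ (tensor ψ φ))) =
      inner ℂ (emb ι₂ ψ) (A (dualVec ι₁ φ)) := by
    intro ψ φ
    have h := hA (conjS φ) ψ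
    rw [he₁, conjS_conjS] at h
    rw [← inner_conj_symm, h]
    change _ = conj (ℓ (schwartz p ι₁ ι₂ (tensor ψ (conjS (conjS φ)))))
    rw [conjS_conjS]
  have hAq : schattenNorm q A ≠ ⊤ :=
    ne_top_of_le_ne_top enorm_ne_top (schattenNorm_le_of_functional hp hpq ℓ A hA')
  -- By `form_schwartz` the sought distribution must send `conjS G` to the conjugate of `ℓ` at `G`,
  -- which leaves no other choice.
  let K : 𝓢'(Rd d × Rd d, ℂ) := toDistribution
    { toFun := fun G => conj (ℓ (schwartz p ι₁ ι₂ (conjS G)))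
      map_add' := fun F G => by rw [conjS_add, map_add, map_add, map_add]
      map_smul' := fun c G => by
        rw [conjS_smul, map_smul, map_smul, smul_eq_mul, map_mul, Complex.conj_conj]; rfl
      cont := Complex.continuous_conj.comp (ℓ.continuous.comp
        (continuous_schwartz.comp continuous_conjS)) }
  have hK : HasKernel (L2Dual.incl ι₁) (L2Dual.incl ι₂) K
      ((transport (L2Dual.rieszEquiv ι₁) (L2Dual.rieszEquiv ι₂)).symm A) :=
    hasKernel_transport_symm_iff.2 fun φ g => by
      rw [← hA']
      change _ = conj (ℓ (schwartz p ι₁ ι₂ (conjS (tensor (conjS g) (conjS φ)))))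
      rw [conjS_tensor, conjS_conjS, conjS_conjS]
  refine ⟨mk K _ hK ?_, fun b => ?_⟩
  · rwa [← schattenNorm_transport q (L2Dual.rieszEquiv ι₁) (L2Dual.rieszEquiv ι₂),
      LinearEquiv.apply_symm_apply]
  · refine congrFun ((denseRange_schwartz hp).equalizer (g := fun b => conj (ℓ b))
      (by fun_prop) (ContinuousLinearMap.continuous _) (funext fun G => ?_)) b
    simp only [Function.comp_apply]
    rw [form_schwartz, ker_mk]
    change _ = conj (ℓ (schwartz p ι₁ ι₂ (conjS (conjS G))))
    rw [conjS_conjS]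

/-- Hölder's inequality for the trace gives one estimate, `schattenNorm_le_of_functional` the
reverse one. -/
theorem norm_eq_of_form_eq {ℓ : KernelSpace p ι₁ ι₂ →L[ℂ] ℂ}
    {a : KernelSpace q (L2Dual.incl ι₁) (L2Dual.incl ι₂)}
    (h : ∀ b, conj (ℓ b) = form hp hpq a b) : ‖ℓ‖ = ‖a‖ := by
  refine le_antisymm (ℓ.opNorm_le_bound (norm_nonneg a) fun b => ?_) ?_
  · rw [← RCLike.norm_conj, h, form_apply]
    simpa using norm_tracePair_le hp hpq a b
  · have h' := schattenNorm_le_of_functional hp hpq ℓ (dualOp a) fun ψ φ => by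
      rw [h, form_apply, op_schwartz_tensor, tracePair_rankOne]
    rw [← enorm_eq_dualOp] at h'
    exact enorm_le_iff_norm_le.1 h'

theorem l2FormIdentifiesDual_id : L2FormIdentifiesDual ι₁ ι₂ p q LinearMap.id 1 := by
  refine ⟨fun φ => ⟨ofS_mem φ, ofS_mem φ⟩, form hp hpq, extendsL2Form_form hp hpq, fun B hB hle => ?_,
    fun h1 B hB => eq_form_of_one_lt hp hpq h1 hB, fun b => eq_zero_of_form_eq_zero hp hpq,
    fun ℓ => ?_, fun ℓ a h => (norm_eq_of_form_eq hp hpq h).trans (one_mul _).symm⟩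
  · rcases (Fact.out : 1 ≤ p).eq_or_lt with h1 | h1
    · exact eq_form_of_norm_le hp hpq ((ENNReal.HolderConjugate.eq_top_iff_eq_one q p).2 h1.symm)
        hB hle
    · exact eq_form_of_one_lt hp hpq h1 hB
  · obtain ⟨a, ha⟩ := exists_form_eq hp hpq ℓ
    exact ⟨a, ha, fun a' ha' => eq_of_form_eq hp hpq fun b => (ha' b).symm.trans (ha b)⟩

end KernelSpace

end SchattenSymbol

namespace SchattenSymbol

/-! ### Transfer from kernels to symbols -/

theorem exists_form_comp {E F E' F' : Type*} [SeminormedAddCommGroup E] [NormedSpace ℂ E]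
    [SeminormedAddCommGroup F] [NormedSpace ℂ F] [SeminormedAddCommGroup E'] [NormedSpace ℂ E']
    [SeminormedAddCommGroup F'] [NormedSpace ℂ F'] (c : ℂ) (B : E →L[ℂ] F →L⋆[ℂ] ℂ)
    (X : E' →L[ℂ] E) (Y : F' →L[ℂ] F) :
    ∃ B' : E' →L[ℂ] F' →L⋆[ℂ] ℂ, ∀ a b, B' a b = c * B (X a) (Y b) :=
  ⟨c • B.bilinearComp X Y, fun _ _ => rfl⟩

theorem norm_comp_linearIsometryEquiv {E E' : Type*} [SeminormedAddCommGroup E] [NormedSpace ℂ E]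
    [SeminormedAddCommGroup E'] [NormedSpace ℂ E'] (ℓ : E →L[ℂ] ℂ) (Y : E' ≃ₗᵢ[ℂ] E) :
    ‖ℓ ∘L Y.toContinuousLinearEquiv.toContinuousLinearMap‖ = ‖ℓ‖ := by
  refine le_antisymm (ContinuousLinearMap.opNorm_le_bound _ (norm_nonneg _) fun x => ?_)
    (ContinuousLinearMap.opNorm_le_bound _ (norm_nonneg _) fun y => ?_)
  · rw [← Y.norm_map]; exact ℓ.le_opNorm (Y x)
  · have h := (ℓ ∘L Y.toContinuousLinearEquiv.toContinuousLinearMap).le_opNorm (Y.symm y)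
    rw [Y.symm.norm_map] at h
    refine le_trans (le_of_eq ?_) h
    exact congrArg (fun z => ‖ℓ z‖) (Y.apply_symm_apply y).symm

namespace SymbolSpace

variable {d : ℕ}
  {H₁ : Type*} [NormedAddCommGroup H₁] [InnerProductSpace ℂ H₁]
  {H₂ : Type*} [NormedAddCommGroup H₂] [InnerProductSpace ℂ H₂]
  (p : ℝ≥0∞) [Fact (1 ≤ p)] (ι₁ : H₁ →ₗ[ℂ] 𝓢'(Rd d, ℂ)) (ι₂ : H₂ →ₗ[ℂ] 𝓢'(Rd d, ℂ))
  {Q : 𝓢'(Rd d × Rd d, ℂ) →ₗ[ℂ] 𝓢'(Rd d × Rd d, ℂ)}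

/-- A bijective quantization identifies the symbols with the kernels. -/
noncomputable def toKernel (hQ : Function.Bijective Q) :
    SymbolSpace p ι₁ ι₂ Q ≃ₗᵢ[ℂ] KernelSpace p ι₁ ι₂ where
  toFun a := ⟨Q a.1, a.2⟩
  invFun b := ⟨(LinearEquiv.ofBijective Q hQ).symm b.1, by
    have h : Q ((LinearEquiv.ofBijective Q hQ).symm b.1) = b.1 :=
      (LinearEquiv.ofBijective Q hQ).apply_symm_apply b.1
    change kernelNorm p ι₁ ι₂ (Q _) < ⊤
    rw [h]
    exact b.2⟩
  map_add' a b := Subtype.ext (map_add Q a.1 b.1)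
  map_smul' c a := Subtype.ext (map_smul Q c a.1)
  left_inv a := Subtype.ext ((LinearEquiv.ofBijective Q hQ).symm_apply_apply a.1)
  right_inv b := Subtype.ext ((LinearEquiv.ofBijective Q hQ).apply_symm_apply b.1)
  norm_map' _ := rfl

theorem incl_toKernel (hQ : Function.Bijective Q) (a : SymbolSpace p ι₁ ι₂ Q) :
    incl p ι₁ ι₂ LinearMap.id (toKernel p ι₁ ι₂ hQ a) = Q (incl p ι₁ ι₂ Q a) := rfl

theorem incl_toKernel_symm (hQ : Function.Bijective Q) (b : KernelSpace p ι₁ ι₂) :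
    Q (incl p ι₁ ι₂ Q ((toKernel p ι₁ ι₂ hQ).symm b)) = incl p ι₁ ι₂ LinearMap.id b := by
  rw [← incl_toKernel p ι₁ ι₂ hQ, LinearIsometryEquiv.apply_symm_apply]

end SymbolSpace

section Transfer

variable {d : ℕ}
  {H₁ : Type*} [NormedAddCommGroup H₁] [InnerProductSpace ℂ H₁] [CompleteSpace H₁]
  {H₂ : Type*} [NormedAddCommGroup H₂] [InnerProductSpace ℂ H₂] [CompleteSpace H₂]
  {p q : ℝ≥0∞} [Fact (1 ≤ p)] [Fact (1 ≤ q)]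
  {ι₁ : H₁ →ₗ[ℂ] 𝓢'(Rd d, ℂ)} [IsTempered ι₁] {ι₂ : H₂ →ₗ[ℂ] 𝓢'(Rd d, ℂ)} [IsTempered ι₂]
  {Q : 𝓢'(Rd d × Rd d, ℂ) →ₗ[ℂ] 𝓢'(Rd d × Rd d, ℂ)}

open SymbolSpace in
/-- The duality for the kernels of operators implies the duality for the symbols, for a bijective
quantization which preserves the Schwartz functions and, up to a factor, the `L²` form. -/
theorem L2FormIdentifiesDual.of_id (h : L2FormIdentifiesDual ι₁ ι₂ p q LinearMap.id 1)
    (hQ : Function.Bijective Q) {u : 𝓢(Rd d × Rd d, ℂ) → 𝓢(Rd d × Rd d, ℂ)}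
    (hu : Function.Surjective u) (hQu : ∀ φ, Q (ofS φ) = ofS (u φ)) {c : ℝ} (hc : 0 < c)
    (hint : ∀ φ ψ, ∫ z, φ z * conj (ψ z) = (c : ℂ) * ∫ z, u φ z * conj (u ψ z)) :
    L2FormIdentifiesDual ι₁ ι₂ p q Q c := by
  obtain ⟨hmem, B, hB, huniq, huniq', hnd, hrep, hnorm⟩ := h
  set X := toKernel q (L2Dual.incl ι₁) (L2Dual.incl ι₂) hQ
  set Y := toKernel p ι₁ ι₂ hQ
  have hc' : (c : ℂ) ≠ 0 := by exact_mod_cast hc.ne'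
  obtain ⟨B₁, hB₁⟩ := exists_form_comp (c : ℂ) B X.toContinuousLinearEquiv.toContinuousLinearMap
    Y.toContinuousLinearEquiv.toContinuousLinearMap
  replace hB₁ : ∀ a b, B₁ a b = c * B (X a) (Y b) := hB₁
  -- Uniqueness is pulled back to kernels: an extension for symbols, transported by the quantization
  -- and divided by `c`, extends the `L²` form of kernels.
  have hback : ∀ B' : SymbolSpace q (L2Dual.incl ι₁) (L2Dual.incl ι₂) Q →L[ℂ]
      SymbolSpace p ι₁ ι₂ Q →L⋆[ℂ] ℂ, ExtendsL2Form B' →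
      ∃ B'' : KernelSpace q (L2Dual.incl ι₁) (L2Dual.incl ι₂) →L[ℂ] KernelSpace p ι₁ ι₂ →L⋆[ℂ] ℂ,
        ExtendsL2Form B'' ∧ (∀ a b, B'' a b = (c : ℂ)⁻¹ * B' (X.symm a) (Y.symm b)) ∧
        (B'' = B → B' = B₁) := by
    intro B' hB'
    obtain ⟨B'', hB''⟩ := exists_form_comp (c : ℂ)⁻¹ B'
      X.symm.toContinuousLinearEquiv.toContinuousLinearMap
      Y.symm.toContinuousLinearEquiv.toContinuousLinearMap
    replace hB'' : ∀ a b, B'' a b = (c : ℂ)⁻¹ * B' (X.symm a) (Y.symm b) := hB''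
    refine ⟨B'', ?_, hB'', fun h => ?_⟩
    · intro φ ψ a b ha hb
      obtain ⟨φ, rfl⟩ := hu φ
      obtain ⟨ψ, rfl⟩ := hu ψ
      have ha' : incl q (L2Dual.incl ι₁) (L2Dual.incl ι₂) Q (X.symm a) = ofS φ := hQ.1 (by
        rw [incl_toKernel_symm, ha, hQu])
      have hb' : incl p ι₁ ι₂ Q (Y.symm b) = ofS ψ := hQ.1 (by
        rw [incl_toKernel_symm, hb, hQu])
      rw [hB'', hB' φ ψ _ _ ha' hb', hint, inv_mul_cancel_left₀ hc']
    · ext a b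
      rw [hB₁, ← h, hB'', mul_inv_cancel_left₀ hc', LinearIsometryEquiv.symm_apply_apply,
        LinearIsometryEquiv.symm_apply_apply]
  refine ⟨fun φ => ?_, B₁, ?_, fun B' hB' hle => ?_, fun h1 B' hB' => ?_, fun b hb => ?_,
    fun ℓ => ?_, fun ℓ a h => ?_⟩
  · have h := hmem (u φ)
    rw [← hQu] at h
    exact h
  · intro φ ψ a b ha hb
    rw [hB₁, hint, hB (u φ) (u ψ) _ _ (by rw [incl_toKernel, ha, hQu])
      (by rw [incl_toKernel, hb, hQu])]
  · obtain ⟨B'', h1, h2, h3⟩ := hback B' hB'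
    refine h3 (huniq B'' h1 fun a b => ?_)
    rw [h2, norm_mul, norm_inv, Complex.norm_real, Real.norm_of_nonneg hc.le, inv_mul_le_iff₀ hc]
    have := hle (X.symm a) (Y.symm b)
    rw [LinearIsometryEquiv.norm_map, LinearIsometryEquiv.norm_map] at this
    linarith
  · obtain ⟨B'', h1', -, h3⟩ := hback B' hB'
    exact h3 (huniq' h1 B'' h1')
  · have h0 : Y b = 0 := hnd _ fun a => by
      have := hb (X.symm a)
      rw [hB₁, LinearIsometryEquiv.apply_symm_apply] at this
      exact (mul_eq_zero.1 this).resolve_left hc'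
    exact Y.injective (h0.trans (map_zero Y).symm)
  · obtain ⟨a, ha, hau⟩ := hrep (ℓ ∘L Y.symm.toContinuousLinearEquiv.toContinuousLinearMap)
    -- The form on symbols is `c` times the form on kernels, so the representing kernel is divided
    -- by `c`.
    refine ⟨X.symm ((c : ℂ)⁻¹ • a), fun b => ?_, fun a' ha' => ?_⟩
    · have := ha (Y b)
      simp only [ContinuousLinearMap.comp_apply] at this
      rw [hB₁, LinearIsometryEquiv.apply_symm_apply, map_smul, smul_apply, smul_eq_mul,
        mul_inv_cancel_left₀ hc', ← this]
      exact congrArg _ (congrArg ℓ (Y.symm_apply_apply b).symm)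
    · have h := hau ((c : ℂ) • X a') fun b => by
        have := ha' (Y.symm b)
        rw [hB₁, LinearIsometryEquiv.apply_symm_apply] at this
        rw [map_smul, smul_apply, smul_eq_mul, ← this]
        rfl
      rw [← h, inv_smul_smul₀ hc', LinearIsometryEquiv.symm_apply_apply]
  · have h' := hnorm (ℓ ∘L Y.symm.toContinuousLinearEquiv.toContinuousLinearMap) ((c : ℂ) • X a) fun b => by
      have := h (Y.symm b)
      rw [hB₁, LinearIsometryEquiv.apply_symm_apply] at this
      rw [map_smul, smul_apply, smul_eq_mul, ← this]
      rfl
    rw [one_mul, norm_smul, LinearIsometryEquiv.norm_map, Complex.norm_real,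
      Real.norm_of_nonneg hc.le] at h'
    rw [← h']
    exact (norm_comp_linearIsometryEquiv ℓ Y.symm).symm

end Transfer

end SchattenSymbol

namespace SchattenSymbol

variable {d : ℕ}

/-! ### Changes of variables -/

theorem measurePreserving_shear (c : Rd d →L[ℝ] Rd d) : MeasurePreserving
    (fun z : Rd d × Rd d => (z.1, c z.1 + z.2)) volume volume :=
  (MeasurePreserving.id _).skew_product (g := fun x y => c x + y) (by
    refine Continuous.measurable ?_
    unfold Function.uncurry
    fun_prop) (.of_forall fun x => (measurePreserving_add_left volume (c x)).map_eq)

theorem measurePreserving_shear_neg (c : Rd d →L[ℝ] Rd d) : MeasurePreserving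
    (fun z : Rd d × Rd d => (z.1, c z.1 - z.2)) volume volume :=
  (MeasurePreserving.id _).skew_product (g := fun x y => c x - y) (by
    refine Continuous.measurable ?_
    unfold Function.uncurry
    fun_prop) (.of_forall fun x => (Measure.measurePreserving_sub_left volume (c x)).map_eq)

theorem measurePreserving_prod_swap : MeasurePreserving (Prod.swap : Rd d × Rd d → Rd d × Rd d)
    volume volume := Measure.measurePreserving_swap

/-- Since `(1 - t) x + t y = x - t (x - y)`, the map is `(x, y) ↦ (x, x - y)` followed by a shear of
the first variable. -/
theorem measurePreserving_quantCoord (t : ℝ) :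
    MeasurePreserving (quantCoord (d := d) t) volume volume := by
  have h := (measurePreserving_prod_swap.comp ((measurePreserving_shear (d := d)
    (-(t • ContinuousLinearMap.id ℝ (Rd d)))).comp measurePreserving_prod_swap)).comp
    (measurePreserving_shear_neg (ContinuousLinearMap.id ℝ (Rd d)))
  convert h using 1
  ext z i
  · change ((1 - t) • z.1 + t • z.2) i = (-(t • (z.1 - z.2)) + z.1) i
    simp; ring
  · rfl

/-- Since `(y - x) / 2 = (x + y) / 2 - x`, the map is a shear followed by a reflected shear of the
first variable. -/
theorem measurePreserving_twistCoord :
    MeasurePreserving (twistCoord (d := d)) volume volume := by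
  have h := (measurePreserving_prod_swap.comp ((measurePreserving_shear_neg (d := d)
    ((1 / 2 : ℝ) • ContinuousLinearMap.id ℝ (Rd d))).comp measurePreserving_prod_swap)).comp
    (measurePreserving_shear (ContinuousLinearMap.id ℝ (Rd d)))
  convert h using 1
  ext z i
  · change ((1 / 2 : ℝ) • (z.2 - z.1)) i = ((1 / 2 : ℝ) • (z.1 + z.2) - z.1) i
    simp; ring
  · rfl

/-- The reflection in the second variable. -/
noncomputable def reflectSnd : (Rd d × Rd d) ≃L[ℝ] Rd d × Rd d :=
  (ContinuousLinearEquiv.refl ℝ (Rd d)).prodCongr (ContinuousLinearEquiv.neg ℝ)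

theorem measurePreserving_reflectSnd :
    MeasurePreserving (reflectSnd (d := d)) volume volume := by
  convert measurePreserving_shear_neg (0 : Rd d →L[ℝ] Rd d) using 1
  ext z i
  · rfl
  · simp [reflectSnd]

/-- Composition of Schwartz functions with a linear change of variables. -/
noncomputable abbrev compS (L : (Rd d × Rd d) ≃L[ℝ] Rd d × Rd d) :
    𝓢(Rd d × Rd d, ℂ) →L[ℂ] 𝓢(Rd d × Rd d, ℂ) := compCLMOfContinuousLinearEquiv ℂ L

theorem compS_apply (L : (Rd d × Rd d) ≃L[ℝ] Rd d × Rd d) (F : 𝓢(Rd d × Rd d, ℂ))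
    (z : Rd d × Rd d) : compS L F z = F (L z) := rfl

theorem compS_compS_symm (L : (Rd d × Rd d) ≃L[ℝ] Rd d × Rd d) (F : 𝓢(Rd d × Rd d, ℂ)) :
    compS L (compS L.symm F) = F := by
  ext z; rw [compS_apply, compS_apply, L.symm_apply_apply]

theorem compS_symm_compS (L : (Rd d × Rd d) ≃L[ℝ] Rd d × Rd d) (F : 𝓢(Rd d × Rd d, ℂ)) :
    compS L.symm (compS L F) = F := by
  ext z; rw [compS_apply, compS_apply, L.apply_symm_apply]

theorem integral_comp_equiv {L : (Rd d × Rd d) ≃L[ℝ] Rd d × Rd d}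
    (hL : MeasurePreserving L volume volume) (f : Rd d × Rd d → ℂ) :
    ∫ z, f (L z) = ∫ z, f z :=
  hL.integral_comp L.toHomeomorph.measurableEmbedding f

theorem ofS_compS {L : (Rd d × Rd d) ≃L[ℝ] Rd d × Rd d} (hL : MeasurePreserving L volume volume)
    (F G : 𝓢(Rd d × Rd d, ℂ)) : ofS (compS L F) G = ofS F (compS L.symm G) := by
  rw [ofS_apply, ofS_apply]
  refine Eq.trans ?_ (integral_comp_equiv hL fun z => F z * G (L.symm z))
  simp only [compS_apply, L.symm_apply_apply]

/-! ### The partial Fourier transform -/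

/-- The bilinear form for which the Fourier transform has the kernel `e^{i⟨v, ξ⟩}`. -/
noncomputable def phaseForm (d : ℕ) : Rd d →ₗ[ℝ] Rd d →ₗ[ℝ] ℝ := -(2 * Real.pi)⁻¹ • innerₗ (Rd d)

theorem fourierIntegral_phaseForm (f : Rd d → ℂ) (ξ : Rd d) :
    VectorFourier.fourierIntegral Real.fourierChar volume (phaseForm d) f ξ =
      ∫ v, PartialFourier.expI v ξ • f v := by
  rw [VectorFourier.fourierIntegral]
  congr 1
  ext v
  rw [Circle.smul_def, Real.fourierChar_apply]
  congr 1
  rw [PartialFourier.expI]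
  congr 1
  simp only [phaseForm, LinearMap.smul_apply, innerₗ_apply_apply, smul_eq_mul]
  have : (Real.pi : ℂ) ≠ 0 := by exact_mod_cast Real.pi_ne_zero
  push_cast
  field_simp

theorem integ_eq (F : 𝓢(Rd d × Rd d, ℂ)) (u ξ : Rd d) : PartialFourier.integ F (u, ξ) =
    VectorFourier.fourierIntegral Real.fourierChar volume (phaseForm d) (fun v => F (u, v)) ξ :=
  (fourierIntegral_phaseForm _ _).symm

theorem integrable_mul (F G : 𝓢(Rd d × Rd d, ℂ)) : Integrable fun z => F z * G z :=
  (F.memLp 2).integrable_mul (G.memLp 2)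

/-- For fixed `u` the kernel `e^{i⟨v, ξ⟩}` is symmetric, so Fubini's theorem moves the transform to
the other factor. Hence the transposed transform of distributions extends the one of Schwartz
functions. -/
theorem ofS_partialFourierInvS (F G : 𝓢(Rd d × Rd d, ℂ)) :
    ofS (partialFourierInvS F) G = ofS F (partialFourierInvS G) := by
  have key : ∀ u : Rd d, ∫ ξ, PartialFourier.integ F (u, ξ) * G (u, ξ) =
      ∫ v, F (u, v) * PartialFourier.integ G (u, v) := by
    intro u
    have h := VectorFourier.integral_bilin_fourierIntegral_eq_flip (ContinuousLinearMap.mul ℂ ℂ)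
      (L := phaseForm d) (μ := volume) (ν := volume) Real.continuous_fourierChar
      (by simp only [phaseForm, LinearMap.smul_apply, innerₗ_apply_apply]; fun_prop)
      (PartialFourier.integrable_slice F u) (PartialFourier.integrable_slice G u)
    have hflip : (phaseForm d).flip = phaseForm d := by
      ext v w
      simp [phaseForm, real_inner_comm]
    rw [hflip] at h
    simpa only [ContinuousLinearMap.mul_apply', integ_eq] using h
  have hI : ∀ (F G : 𝓢(Rd d × Rd d, ℂ)), ofS F G = ∫ u, ∫ v, F (u, v) * G (u, v) := fun F G => by
    rw [ofS_apply]
    exact integral_prod _ (integrable_mul F G)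
  rw [hI, hI]
  congr 1
  ext u
  set κ : ℂ := (((2 * Real.pi) ^ (-(d : ℝ) / 2) : ℝ) : ℂ) with hκ
  have e1 : ∀ (F : 𝓢(Rd d × Rd d, ℂ)) z, partialFourierInvS F z = κ * PartialFourier.integ F z :=
    fun F z => rfl
  simp only [e1, mul_assoc, mul_left_comm _ κ]
  rw [integral_const_mul, integral_const_mul, key]

/-- The Fourier inversion formula in the second variable. -/
theorem partialFourierInvS_partialFourierInvS (F : 𝓢(Rd d × Rd d, ℂ)) :
    partialFourierInvS (partialFourierInvS F) = compS reflectSnd F := by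
  ext ⟨u, w⟩
  set κ : ℂ := (((2 * Real.pi) ^ (-(d : ℝ) / 2) : ℝ) : ℂ) with hκ
  have e1 : ∀ (F : 𝓢(Rd d × Rd d, ℂ)) z, partialFourierInvS F z = κ * PartialFourier.integ F z :=
    fun F z => rfl
  have h2pi : (2 * Real.pi : ℝ) ≠ 0 := by positivity
  set f : Rd d → ℂ := fun v => F (u, v) with hf
  have hfc : Continuous f := F.continuous.comp (by fun_prop)
  have hfi : Integrable f := PartialFourier.integrable_slice F u
  -- The inversion theorem is available for the kernel `e^{2πi⟨v, ξ⟩}`; dilating the frequency by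
  -- `2π` translates between the two conventions.
  have hinv : ∀ ξ, FourierTransformInv.fourierInv f ξ =
      PartialFourier.integ F (u, (2 * Real.pi) • ξ) := by
    intro ξ
    rw [Real.fourierInv_eq']
    change _ = ∫ v, PartialFourier.expI v ((2 * Real.pi) • ξ) • f v
    congr 1
    ext v
    rw [PartialFourier.expI, inner_smul_right]
    congr 2
    push_cast
    ring
  have hi : Integrable fun ξ => PartialFourier.integ F (u, ξ) :=
    PartialFourier.integrable_slice (PartialFourier.integCLM F) u
  have hi' : Integrable (FourierTransformInv.fourierInv f) := by
    have : FourierTransformInv.fourierInv f = fun ξ => PartialFourier.integ F (u, (2 * Real.pi) • ξ) :=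
      funext hinv
    rw [this]
    exact hi.comp_smul h2pi
  have hi'' : Integrable (FourierTransform.fourier f) := by
    have : FourierTransform.fourier f = fun v => FourierTransformInv.fourierInv f (-v) := by
      ext v; rw [Real.fourierInv_eq_fourier_neg, neg_neg]
    rw [this]
    exact hi'.comp_neg
  have h1 : ∫ ξ, PartialFourier.expI ξ ((2 * Real.pi) • w) • FourierTransformInv.fourierInv f ξ =
      f (-w) := by
    rw [← hfc.fourier_fourierInv_eq hfi hi'', ← Real.fourierInv_eq_fourier_neg, Real.fourierInv_eq',
      hfc.fourier_fourierInv_eq hfi hi'']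
    congr 1
    ext v
    rw [PartialFourier.expI, inner_smul_right]
    congr 2
    push_cast
    ring
  have h2 := Measure.integral_comp_smul (volume : Measure (Rd d))
    (fun ξ => PartialFourier.expI ξ w • PartialFourier.integ F (u, ξ)) (2 * Real.pi)
  have h3 : ∫ ξ, PartialFourier.expI ((2 * Real.pi) • ξ) w •
      PartialFourier.integ F (u, (2 * Real.pi) • ξ) = f (-w) := by
    rw [← h1]
    congr 1
    ext ξ
    rw [hinv, PartialFourier.expI, PartialFourier.expI, inner_smul_left, inner_smul_right]
    rfl
  rw [h3, finrank_euclideanSpace_fin, abs_of_pos (by positivity)] at h2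
  -- The two normalizing factors multiply to `(2π)^{-d}`, the Jacobian of the dilation by `2π`.
  have hκ2 : κ * κ = (((2 * Real.pi) ^ d)⁻¹ : ℝ) := by
    rw [hκ, ← Complex.ofReal_mul, ← Real.rpow_add (by positivity), ← Real.rpow_natCast,
      ← Real.rpow_neg (by positivity)]
    congr 2
    ring
  have e2 : partialFourierInvS (partialFourierInvS F) (u, w) =
      κ * ∫ ξ, PartialFourier.expI ξ w • (κ * PartialFourier.integ F (u, ξ)) := rfl
  have e3 : ∀ ξ, PartialFourier.expI ξ w • (κ * PartialFourier.integ F (u, ξ)) =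
      κ * (PartialFourier.expI ξ w • PartialFourier.integ F (u, ξ)) := fun ξ => by
    simp only [smul_eq_mul]; ring
  simp only [e2, e3]
  rw [integral_const_mul, ← mul_assoc, hκ2, ← Complex.real_smul, ← h2]
  rfl

theorem partialFourierS_eq (F : 𝓢(Rd d × Rd d, ℂ)) :
    partialFourierS F = compS reflectSnd (partialFourierInvS F) := rfl

theorem reflectSnd_symm : (reflectSnd (d := d)).symm = reflectSnd := rfl

/-- The reflection is the square of the transform, so both sides are its cube. -/
theorem partialFourierInvS_reflect (F : 𝓢(Rd d × Rd d, ℂ)) :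
    partialFourierInvS (compS reflectSnd F) = compS reflectSnd (partialFourierInvS F) := by
  rw [← partialFourierInvS_partialFourierInvS, ← partialFourierInvS_partialFourierInvS]

theorem partialFourierS_partialFourierInvS (F : 𝓢(Rd d × Rd d, ℂ)) :
    partialFourierS (partialFourierInvS F) = F := by
  rw [partialFourierS_eq, partialFourierInvS_partialFourierInvS]
  exact compS_compS_symm reflectSnd F

theorem partialFourierInvS_partialFourierS (F : 𝓢(Rd d × Rd d, ℂ)) :
    partialFourierInvS (partialFourierS F) = F := by
  rw [partialFourierS_eq, partialFourierInvS_reflect, ← partialFourierS_eq,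
    partialFourierS_partialFourierInvS]

theorem ofS_partialFourierS (F G : 𝓢(Rd d × Rd d, ℂ)) :
    ofS (partialFourierS F) G = ofS F (partialFourierS G) := by
  rw [partialFourierS_eq, ofS_compS measurePreserving_reflectSnd, ofS_partialFourierInvS,
    reflectSnd_symm, partialFourierInvS_reflect, partialFourierS_eq]

theorem conjS_partialFourierInvS (F : 𝓢(Rd d × Rd d, ℂ)) :
    conjS (partialFourierInvS F) = partialFourierS (conjS F) := by
  ext ⟨u, w⟩
  rw [partialFourierS_apply, conjS_apply, partialFourierInvS_apply, map_mul, Complex.conj_ofReal,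
    ← integral_conj]
  congr 2
  ext ξ
  rw [map_mul, ← Complex.exp_conj, map_mul, Complex.conj_I, Complex.conj_ofReal, conjS_apply,
    neg_mul]

/-- Plancherel's formula in the second variable. -/
theorem ofS_partialFourierInvS_conjS (F G : 𝓢(Rd d × Rd d, ℂ)) :
    ofS (partialFourierInvS F) (conjS (partialFourierInvS G)) = ofS F (conjS G) := by
  rw [conjS_partialFourierInvS, ofS_partialFourierInvS, partialFourierInvS_partialFourierS]

theorem ofS_compS_conjS {L : (Rd d × Rd d) ≃L[ℝ] Rd d × Rd d}
    (hL : MeasurePreserving L volume volume) (F G : 𝓢(Rd d × Rd d, ℂ)) :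
    ofS (compS L F) (conjS (compS L G)) = ofS F (conjS G) := by
  have h : conjS (compS L G) = compS L (conjS G) := rfl
  rw [h, ofS_compS hL, compS_symm_compS]

theorem ofS_partialFourierS_conjS (F G : 𝓢(Rd d × Rd d, ℂ)) :
    ofS (partialFourierS F) (conjS (partialFourierS G)) = ofS F (conjS G) := by
  rw [partialFourierS_eq, partialFourierS_eq, ofS_compS_conjS measurePreserving_reflectSnd,
    ofS_partialFourierInvS_conjS]

/-! ### The quantizations -/

/-- The transpose of an automorphism of the Schwartz space is bijective. -/
theorem bijective_of_transpose {Q : 𝓢'(Rd d × Rd d, ℂ) →ₗ[ℂ] 𝓢'(Rd d × Rd d, ℂ)}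
    (S S' : 𝓢(Rd d × Rd d, ℂ) →L[ℂ] 𝓢(Rd d × Rd d, ℂ)) (hS : ∀ F, S (S' F) = F)
    (hS' : ∀ F, S' (S F) = F) (hQ : ∀ K F, Q K F = K (S F)) : Function.Bijective Q := by
  refine ⟨fun K K' h => ?_, fun K => ⟨PointwiseConvergenceCLM.precomp ℂ S' K, ?_⟩⟩
  · ext F
    rw [← hS F, ← hQ, ← hQ, h]
  · ext F
    rw [hQ]
    exact congrArg K (hS' F)

theorem integral_mul_conj_eq_ofS (F G : 𝓢(Rd d × Rd d, ℂ)) :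
    ∫ z, F z * conj (G z) = ofS F (conjS G) := by
  rw [ofS_apply]; rfl

theorem quantKernel_apply (t : ℝ) (K : 𝓢'(Rd d × Rd d, ℂ)) (F : 𝓢(Rd d × Rd d, ℂ)) :
    quantKernel t K F = K (partialFourierInvS (compS (quantCoord t).symm F)) := rfl

theorem twistKernel_apply (K : 𝓢'(Rd d × Rd d, ℂ)) (F : 𝓢(Rd d × Rd d, ℂ)) :
    twistKernel K F = K (partialFourierS (compS twistCoord.symm F)) := rfl

theorem quantKernelStd_apply (t : ℝ) (K : 𝓢'(Rd d × Rd d, ℂ)) :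
    quantKernelStd t K = (((2 * Real.pi) ^ (-(d : ℝ) / 2) : ℝ) : ℂ) • quantKernel t K := rfl

theorem bijective_quantKernel (t : ℝ) : Function.Bijective (quantKernel (d := d) t) :=
  bijective_of_transpose (partialFourierInvS ∘L compS (quantCoord t).symm)
    (compS (quantCoord t) ∘L partialFourierS)
    (fun F => by
      simp only [ContinuousLinearMap.comp_apply]
      rw [compS_symm_compS, partialFourierInvS_partialFourierS])
    (fun F => by
      simp only [ContinuousLinearMap.comp_apply]
      rw [partialFourierS_partialFourierInvS, compS_compS_symm]) fun K F => rfl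

theorem bijective_twistKernel : Function.Bijective (twistKernel (d := d)) :=
  bijective_of_transpose (partialFourierS ∘L compS twistCoord.symm)
    (compS twistCoord ∘L partialFourierInvS)
    (fun F => by
      simp only [ContinuousLinearMap.comp_apply]
      rw [compS_symm_compS, partialFourierS_partialFourierInvS])
    (fun F => by
      simp only [ContinuousLinearMap.comp_apply]
      rw [partialFourierInvS_partialFourierS, compS_compS_symm]) fun K F => rfl

theorem quantKernel_ofS (t : ℝ) (F : 𝓢(Rd d × Rd d, ℂ)) :
    quantKernel t (ofS F) = ofS (compS (quantCoord t) (partialFourierInvS F)) := by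
  ext G
  rw [quantKernel_apply, ← ofS_partialFourierInvS, ofS_compS (measurePreserving_quantCoord t)]

theorem twistKernel_ofS (F : 𝓢(Rd d × Rd d, ℂ)) :
    twistKernel (ofS F) = ofS (compS twistCoord (partialFourierS F)) := by
  ext G
  rw [twistKernel_apply, ← ofS_partialFourierS, ofS_compS measurePreserving_twistCoord]

theorem surjective_quantS (t : ℝ) : Function.Surjective fun F : 𝓢(Rd d × Rd d, ℂ) =>
    compS (quantCoord t) (partialFourierInvS F) := fun G =>
  ⟨partialFourierS (compS (quantCoord t).symm G), by
    beta_reduce; rw [partialFourierInvS_partialFourierS, compS_compS_symm]⟩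

theorem surjective_twistS : Function.Surjective fun F : 𝓢(Rd d × Rd d, ℂ) =>
    compS twistCoord (partialFourierS F) := fun G =>
  ⟨partialFourierInvS (compS twistCoord.symm G), by
    beta_reduce; rw [partialFourierS_partialFourierInvS, compS_compS_symm]⟩

/-! ### The duality for the three quantizations -/

section Main

variable
  {H₁ : Type*} [NormedAddCommGroup H₁] [InnerProductSpace ℂ H₁] [CompleteSpace H₁]
  {H₂ : Type*} [NormedAddCommGroup H₂] [InnerProductSpace ℂ H₂] [CompleteSpace H₂]
  (p q : ℝ≥0∞) [Fact (1 ≤ p)] [Fact (1 ≤ q)] (hp : p ≠ ⊤) (hpq : ENNReal.HolderConjugate p q)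
  (ι₁ : H₁ →ₗ[ℂ] 𝓢'(Rd d, ℂ)) [IsTempered ι₁] (ι₂ : H₂ →ₗ[ℂ] 𝓢'(Rd d, ℂ)) [IsTempered ι₂]

include hp hpq

theorem l2FormIdentifiesDual_quantKernel (t : ℝ) :
    L2FormIdentifiesDual ι₁ ι₂ p q (quantKernel t) 1 :=
  (KernelSpace.l2FormIdentifiesDual_id hp hpq).of_id (bijective_quantKernel t)
    (surjective_quantS t) (quantKernel_ofS t) one_pos fun F G => by
      rw [integral_mul_conj_eq_ofS, integral_mul_conj_eq_ofS,
        ofS_compS_conjS (measurePreserving_quantCoord t), ofS_partialFourierInvS_conjS,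
        Complex.ofReal_one, one_mul]

theorem l2FormIdentifiesDual_twistKernel :
    L2FormIdentifiesDual ι₁ ι₂ p q (twistKernel (d := d)) 1 :=
  (KernelSpace.l2FormIdentifiesDual_id hp hpq).of_id bijective_twistKernel
    surjective_twistS twistKernel_ofS one_pos fun F G => by
      rw [integral_mul_conj_eq_ofS, integral_mul_conj_eq_ofS,
        ofS_compS_conjS measurePreserving_twistCoord, ofS_partialFourierS_conjS,
        Complex.ofReal_one, one_mul]

/-- Relative to the unitary normalization the kernels gain the factor `κ = (2π)^{-d/2}` and the `L²`
form gains `κ²`; the constant is its inverse. -/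
theorem l2FormIdentifiesDual_quantKernelStd (t : ℝ) :
    L2FormIdentifiesDual ι₁ ι₂ p q (quantKernelStd t) ((2 * Real.pi) ^ d) := by
  set κ : ℂ := (((2 * Real.pi) ^ (-(d : ℝ) / 2) : ℝ) : ℂ) with hκ
  have hκ0 : κ ≠ 0 := by
    rw [hκ]
    exact_mod_cast (Real.rpow_pos_of_pos (by positivity : (0 : ℝ) < 2 * Real.pi) _).ne'
  have hκ2 : (((2 * Real.pi) ^ d : ℝ) : ℂ) * (κ * κ) = 1 := by
    rw [hκ, ← Complex.ofReal_mul, ← Complex.ofReal_mul, ← Real.rpow_add (by positivity),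
      ← Real.rpow_natCast, ← Real.rpow_add (by positivity)]
    norm_num
  refine (KernelSpace.l2FormIdentifiesDual_id hp hpq).of_id
    (u := fun F => κ • compS (quantCoord t) (partialFourierInvS F)) ?_ ?_ ?_ (by positivity) ?_
  · have h : ⇑(quantKernelStd (d := d) t) = (fun K => κ • K) ∘ quantKernel t := rfl
    rw [h]
    refine Function.Bijective.comp ⟨fun K K' h => ?_, fun K => ⟨κ⁻¹ • K, ?_⟩⟩
      (bijective_quantKernel t)
    · exact smul_right_injective _ hκ0 h
    · exact smul_inv_smul₀ hκ0 K
  · intro G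
    obtain ⟨F, hF⟩ := surjective_quantS t (κ⁻¹ • G)
    exact ⟨F, by beta_reduce at hF ⊢; rw [hF, smul_inv_smul₀ hκ0]⟩
  · intro F
    rw [quantKernelStd_apply, quantKernel_ofS, ofS_smul]
  · intro F G
    have hconj : conj κ = κ := Complex.conj_ofReal _
    rw [integral_mul_conj_eq_ofS, integral_mul_conj_eq_ofS, conjS_smul, hconj, ofS_smul]
    change _ = _ * (κ * ofS (compS (quantCoord t) (partialFourierInvS F))
      (κ • conjS (compS (quantCoord t) (partialFourierInvS G))))
    rw [map_smul, smul_eq_mul, ofS_compS_conjS (measurePreserving_quantCoord t),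
      ofS_partialFourierInvS_conjS, ← mul_assoc κ, ← mul_assoc, hκ2, one_mul]

end Main

end SchattenSymbol

theorem mainTheorem10 {d : ℕ} (t : ℝ) (p q : ℝ≥0∞) [Fact (1 ≤ p)] [Fact (1 ≤ q)]
    (hp : p ≠ ⊤) (hpq : ENNReal.HolderConjugate p q)
    {H₁ : Type*} [NormedAddCommGroup H₁] [InnerProductSpace ℂ H₁] [CompleteSpace H₁]
    {H₂ : Type*} [NormedAddCommGroup H₂] [InnerProductSpace ℂ H₂] [CompleteSpace H₂]
    (ι₁ : H₁ →ₗ[ℂ] 𝓢'(Rd d, ℂ)) [SchattenSymbol.IsTempered ι₁]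
    (ι₂ : H₂ →ₗ[ℂ] 𝓢'(Rd d, ℂ)) [SchattenSymbol.IsTempered ι₂] :
    SchattenSymbol.L2FormIdentifiesDual ι₁ ι₂ p q (SchattenSymbol.quantKernel t) 1 ∧
    SchattenSymbol.L2FormIdentifiesDual ι₁ ι₂ p q (SchattenSymbol.quantKernelStd t)
      ((2 * Real.pi) ^ d) ∧
    SchattenSymbol.L2FormIdentifiesDual ι₁ ι₂ p q SchattenSymbol.twistKernel 1 := by
  exact ⟨SchattenSymbol.l2FormIdentifiesDual_quantKernel p q hp hpq ι₁ ι₂ t,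
    SchattenSymbol.l2FormIdentifiesDual_quantKernelStd p q hp hpq ι₁ ι₂ t,
    SchattenSymbol.l2FormIdentifiesDual_twistKernel p q hp hpq ι₁ ι₂⟩
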